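/- Let $A$ be a von Neumann regular ring (associative with unit, not necessarily commutative; for every $a\in A$ there is $x\in A$ with $axa=a$), write $\otimes=\otimes_A$, and let $\lambda:\mathcal C\to\mathcal D$ be a morphism of $A$-corings. Regard $\mathcal C$ as a $\mathcal D$-bicomodule through $\lambda$, with coactions $c\mapsto c_1\otimes\lambda(c_2)$ and $c\mapsto\lambda(c_1)\otimes c_2$, and let $$\mathcal C\square_{\mathcal D}\mathcal C=\ker\big(\mathcal C\otimes\mathcal C\to\mathcal C\otimes\mathcal D\otimes\mathcal C,\ c\otimes c'\mapsto c_1\otimes\lambda(c_2)\otimes c'-c\otimes\lambda(c'_1)\otimes c'_2\big),$$ which is a $\mathcal C$-bicomodule with the coactions induced by $\Delta_{\mathcal C}\otimes 1$ and $1\otimes\Delta_{\mathcal C}$. A functor is called Frobenius if it has a left adjoint and a right adjoint and these two are naturally isomorphic. The extension $\lambda$ is called right (resp. left) Frobenius if the corestriction functor from right (resp. left) $\mathcal C$-comodules to right (resp. left) $\mathcal D$-comodules, which sends $(M,\rho)$ to $(M,(1\otimes\lambda)\circ\rho)$ (resp. $(M,(\lambda\otimes1)\circ\rho)$), is Frobenius.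 Then the following are equivalent: 1. $\lambda$ is right Frobenius; 2. $\lambda$ is left Frobenius; 3. there are a homomorphism of $\mathcal D$-bicomodules $\alpha:\mathcal D\to\mathcal C$ and a homomorphism of $\mathcal C$-bicomodules $\beta:\mathcal C\square_{\mathcal D}\mathcal C\to\mathcal C$ such that $$\beta\circ(\alpha\lambda\otimes 1_{\mathcal C})\circ\Delta_{\mathcal C}=\beta\circ(1_{\mathcal C}\otimes\alpha\lambda)\circ\Delta_{\mathcal C}=1_{\mathcal C},$$ that is, $\beta(\alpha\lambda(c_1)\otimes c_2)=\beta(c_1\otimes\alpha\lambda(c_2))=c$ for all $c\in\mathcal C$. In particular, this holds for every homomorphism $\lambda: C\to D$ of coalgebras over a field $K$, viewed as $K$-corings on which $K$ acts in the same way from both sides. -/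

import Mathlib

universe u

open CategoryTheory MulOpposite

/-- A ring is von Neumann regular if every element `a` has a weak inverse `x`, `a x a = a`. -/
def IsVonNeumannRegular (A : Type u) [Ring A] : Prop := ∀ a : A, ∃ x : A, a * x * a = a

/-! ### Tensor products over a noncommutative ring

Right `A`-modules are modules over `Aᵐᵒᵖ`, so that `m a` is written `op a • m`. An
`A`-bimodule is a module over `A` and over `Aᵐᵒᵖ` for which the two actions commute. -/

section Tensor

variable (A : Type u) [Ring A]

/-- The relations `m a ⊗ n = m ⊗ a n` that are imposed on `M ⊗_ℤ N` to obtain `M ⊗_A N`. -/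
def Tens.relations (M N : Type u) [AddCommGroup M] [Module Aᵐᵒᵖ M] [AddCommGroup N]
    [Module A N] : AddSubgroup (TensorProduct ℤ M N) :=
  AddSubgroup.closure
    {z | ∃ (m : M) (a : A) (n : N),
      z = TensorProduct.tmul ℤ (op a • m) n - TensorProduct.tmul ℤ m (a • n)}

/-- The tensor product `M ⊗_A N` of a right module and a left module over `A`. -/
def Tens (M N : Type u) [AddCommGroup M] [Module Aᵐᵒᵖ M] [AddCommGroup N] [Module A N] :
    Type u :=
  TensorProduct ℤ M N ⧸ Tens.relations A M N

instance (M N : Type u) [AddCommGroup M] [Module Aᵐᵒᵖ M] [AddCommGroup N] [Module A N] :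
    AddCommGroup (Tens A M N) :=
  inferInstanceAs (AddCommGroup (TensorProduct ℤ M N ⧸ Tens.relations A M N))

variable {A}

namespace Tens

section Basic

variable {M M' M'' N N' N'' P : Type u}
  [AddCommGroup M] [Module Aᵐᵒᵖ M] [AddCommGroup M'] [Module Aᵐᵒᵖ M']
  [AddCommGroup M''] [Module Aᵐᵒᵖ M'']
  [AddCommGroup N] [Module A N] [AddCommGroup N'] [Module A N'] [AddCommGroup N''] [Module A N'']
  [AddCommGroup P]

/-- The biadditive map `(m, n) ↦ m ⊗ n`. -/
def mk : M →+ N →+ Tens A M N :=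
  AddMonoidHom.mk' (fun m => AddMonoidHom.mk'
      (fun n => QuotientAddGroup.mk' (relations A M N) (TensorProduct.tmul ℤ m n))
      (fun n n' => by rw [TensorProduct.tmul_add]; rfl))
    (fun m m' => by
      ext n
      change QuotientAddGroup.mk' (relations A M N) (TensorProduct.tmul ℤ (m + m') n) = _
      rw [TensorProduct.add_tmul]; rfl)

/-- The pure tensor `m ⊗ n`. -/
def tmul (m : M) (n : N) : Tens A M N := mk m n

theorem add_tmul (m m' : M) (n : N) :
    (tmul (m + m') n : Tens A M N) = tmul m n + tmul m' n := by
  simp [tmul]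

theorem tmul_add (m : M) (n n' : N) :
    (tmul m (n + n') : Tens A M N) = tmul m n + tmul m n' := by
  simp [tmul]

theorem smul_tmul (m : M) (a : A) (n : N) :
    (tmul (op a • m) n : Tens A M N) = tmul m (a • n) := by
  have h : TensorProduct.tmul ℤ (op a • m) n - TensorProduct.tmul ℤ m (a • n)
      ∈ relations A M N := AddSubgroup.subset_closure ⟨m, a, n, rfl⟩
  have := (QuotientAddGroup.eq_zero_iff _).2 h
  exact sub_eq_zero.1 this

@[simp] theorem zero_tmul (n : N) : (tmul (0 : M) n : Tens A M N) = 0 := by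
  simp [tmul]

@[simp] theorem tmul_zero (m : M) : (tmul m (0 : N) : Tens A M N) = 0 := by
  simp [tmul]

/-- A balanced biadditive map induces an additive map on the tensor product. -/
def lift (f : M →+ N →+ P) (hf : ∀ (m : M) (a : A) (n : N), f (op a • m) n = f m (a • n)) :
    Tens A M N →+ P :=
  QuotientAddGroup.lift (relations A M N)
    (TensorProduct.liftAddHom (R := ℤ) f (fun r m n => by simp))
    ((AddSubgroup.closure_le _).2 (by
      rintro _ ⟨m, a, n, rfl⟩
      simp [AddMonoidHom.mem_ker, hf]))

@[simp] theorem lift_tmul (f : M →+ N →+ P)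
    (hf : ∀ (m : M) (a : A) (n : N), f (op a • m) n = f m (a • n)) (m : M) (n : N) :
    lift f hf (tmul m n) = f m n := rfl

@[elab_as_elim] theorem induction {p : Tens A M N → Prop} (x : Tens A M N) (zero : p 0)
    (tmul : ∀ m n, p (tmul m n)) (add : ∀ x y, p x → p y → p (x + y)) : p x := by
  obtain ⟨y, rfl⟩ := QuotientAddGroup.mk'_surjective (relations A M N) x
  induction y using TensorProduct.induction_on with
  | zero => exact zero
  | tmul m n => exact tmul m n
  | add y z hy hz => rw [map_add]; exact add _ _ hy hz

theorem hom_ext {f g : Tens A M N →+ P} (h : ∀ m n, f (tmul m n) = g (tmul m n)) : f = g := by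
  ext x
  induction x using Tens.induction with
  | zero => simp
  | tmul m n => exact h m n
  | add x y hx hy => simp [hx, hy]

/-- `f ⊗ g`, as a map of abelian groups. -/
def map (f : M →ₗ[Aᵐᵒᵖ] M') (g : N →ₗ[A] N') : Tens A M N →+ Tens A M' N' :=
  lift (AddMonoidHom.mk' (fun m => (mk (f m)).comp g.toAddMonoidHom)
      (fun m m' => by ext n; simp))
    (fun m a n => by
      change tmul (f (op a • m)) (g n) = tmul (f m) (g (a • n))
      rw [map_smul, map_smul, smul_tmul])

@[simp] theorem map_tmul (f : M →ₗ[Aᵐᵒᵖ] M') (g : N →ₗ[A] N') (m : M) (n : N) :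
    map f g (tmul m n) = tmul (f m) (g n) := rfl

theorem map_map (f : M →ₗ[Aᵐᵒᵖ] M') (g : N →ₗ[A] N') (f' : M' →ₗ[Aᵐᵒᵖ] M'')
    (g' : N' →ₗ[A] N'') (x : Tens A M N) :
    map f' g' (map f g x) = map (f'.comp f) (g'.comp g) x := by
  induction x using Tens.induction with
  | zero => simp
  | tmul m n => simp
  | add x y hx hy => simp [hx, hy]

@[simp] theorem map_id (x : Tens A M N) :
    map (LinearMap.id : M →ₗ[Aᵐᵒᵖ] M) (LinearMap.id : N →ₗ[A] N) x = x := by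
  induction x using Tens.induction with
  | zero => simp
  | tmul m n => simp
  | add x y hx hy => simp [hx, hy]

end Basic

section Module

variable {M M' N N' : Type u} [AddCommGroup M] [Module Aᵐᵒᵖ M] [AddCommGroup N] [Module A N]
  [AddCommGroup M'] [Module Aᵐᵒᵖ M'] [AddCommGroup N'] [Module A N']

/-- If `M` is a bimodule, then `M ⊗_A N` is a left module by `a (m ⊗ n) = a m ⊗ n`. -/
instance leftModule [Module A M] [SMulCommClass A Aᵐᵒᵖ M] : Module A (Tens A M N) where
  smul a := map (DistribSMul.toLinearMap Aᵐᵒᵖ M a) LinearMap.id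
  one_smul x := by
    change map _ _ x = x
    induction x using Tens.induction with
    | zero => simp
    | tmul m n => simp
    | add x y hx hy => simp [hx, hy]
  mul_smul a b x := by
    change map _ _ x = map _ _ (map _ _ x)
    induction x using Tens.induction with
    | zero => simp
    | tmul m n => simp [mul_smul]
    | add x y hx hy => simp [hx, hy]
  smul_zero a := _root_.map_zero _
  smul_add a := _root_.map_add _
  add_smul a b x := by
    change map _ _ x = map _ _ x + map _ _ x
    induction x using Tens.induction with
    | zero => simp
    | tmul m n => simp [add_smul, add_tmul]
    | add x y hx hy => simp only [_root_.map_add, hx, hy]; abel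
  zero_smul x := by
    change map _ _ x = 0
    induction x using Tens.induction with
    | zero => simp
    | tmul m n => simp
    | add x y hx hy => simp [hx, hy]

/-- The right action of a scalar on a bimodule, as a left linear map. -/
def rightMul [Module Aᵐᵒᵖ N] [SMulCommClass A Aᵐᵒᵖ N] (b : Aᵐᵒᵖ) : N →ₗ[A] N where
  toFun n := b • n
  map_add' := smul_add b
  map_smul' a n := (smul_comm a b n).symm

/-- If `N` is a bimodule, then `M ⊗_A N` is a right module by `(m ⊗ n) a = m ⊗ n a`. -/
instance rightModule [Module Aᵐᵒᵖ N] [SMulCommClass A Aᵐᵒᵖ N] : Module Aᵐᵒᵖ (Tens A M N) where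
  smul b := map LinearMap.id (rightMul b)
  one_smul x := by
    change map _ _ x = x
    induction x using Tens.induction with
    | zero => simp
    | tmul m n => simp [rightMul]
    | add x y hx hy => simp [hx, hy]
  mul_smul a b x := by
    change map _ _ x = map _ _ (map _ _ x)
    induction x using Tens.induction with
    | zero => simp
    | tmul m n => simp [mul_smul, rightMul]
    | add x y hx hy => simp [hx, hy]
  smul_zero a := _root_.map_zero _
  smul_add a := _root_.map_add _
  add_smul a b x := by
    change map _ _ x = map _ _ x + map _ _ x
    induction x using Tens.induction with
    | zero => simp
    | tmul m n => simp [add_smul, tmul_add, rightMul]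
    | add x y hx hy => simp only [_root_.map_add, hx, hy]; abel
  zero_smul x := by
    change map _ _ x = 0
    induction x using Tens.induction with
    | zero => simp
    | tmul m n => simp [rightMul]
    | add x y hx hy => simp [hx, hy]

theorem smul_def_left [Module A M] [SMulCommClass A Aᵐᵒᵖ M] (a : A) (m : M) (n : N) :
    a • (tmul m n : Tens A M N) = tmul (a • m) n := rfl

theorem smul_def_right [Module Aᵐᵒᵖ N] [SMulCommClass A Aᵐᵒᵖ N] (b : Aᵐᵒᵖ) (m : M) (n : N) :
    b • (tmul m n : Tens A M N) = tmul m (b • n) := rfl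

instance [Module A M] [SMulCommClass A Aᵐᵒᵖ M] [Module Aᵐᵒᵖ N] [SMulCommClass A Aᵐᵒᵖ N] :
    SMulCommClass A Aᵐᵒᵖ (Tens A M N) where
  smul_comm a b x := by
    induction x using Tens.induction with
    | zero => simp
    | tmul m n => simp [smul_def_left, smul_def_right]
    | add x y hx hy => simp [hx, hy]

theorem map_smul_left [Module A M] [SMulCommClass A Aᵐᵒᵖ M] [Module A M']
    [SMulCommClass A Aᵐᵒᵖ M'] (f : M →ₗ[Aᵐᵒᵖ] M') (hf : ∀ (a : A) m, f (a • m) = a • f m)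
    (g : N →ₗ[A] N') (a : A) (x : Tens A M N) : map f g (a • x) = a • map f g x := by
  induction x using Tens.induction with
  | zero => simp
  | tmul m n => simp [smul_def_left, hf]
  | add x y hx hy => simp [hx, hy]

theorem map_smul_right [Module Aᵐᵒᵖ N] [SMulCommClass A Aᵐᵒᵖ N] [Module Aᵐᵒᵖ N']
    [SMulCommClass A Aᵐᵒᵖ N'] (f : M →ₗ[Aᵐᵒᵖ] M') (g : N →ₗ[A] N')
    (hg : ∀ (b : Aᵐᵒᵖ) n, g (b • n) = b • g n) (b : Aᵐᵒᵖ) (x : Tens A M N) :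
    map f g (b • x) = b • map f g x := by
  induction x using Tens.induction with
  | zero => simp
  | tmul m n => simp [smul_def_right, hg]
  | add x y hx hy => simp [hx, hy]

/-- The canonical map `A ⊗_A N → N`, `a ⊗ n ↦ a n`. -/
def lid (N : Type u) [AddCommGroup N] [Module A N] : Tens A A N →+ N :=
  lift (AddMonoidHom.mk' (fun a => DistribSMul.toAddMonoidHom N a)
      (fun a b => by ext n; simp [add_smul]))
    (fun m a n => by simp [mul_smul])

/-- The canonical map `M ⊗_A A → M`, `m ⊗ a ↦ m a`. -/
def rid (M : Type u) [AddCommGroup M] [Module Aᵐᵒᵖ M] : Tens A M A →+ M :=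
  lift (AddMonoidHom.mk' (fun m => AddMonoidHom.mk' (fun a : A => op a • m)
        (fun a b => by simp [add_smul]))
      (fun a b => by ext n; simp))
    (fun m a n => by simp [mul_smul])

@[simp] theorem lid_tmul (a : A) (n : N) : lid N (tmul a n) = a • n := rfl

@[simp] theorem rid_tmul (m : M) (a : A) : rid M (tmul m a) = op a • m := rfl

end Module

section Assoc

variable {L M N : Type u} [AddCommGroup L] [Module Aᵐᵒᵖ L]
  [AddCommGroup M] [Module A M] [Module Aᵐᵒᵖ M] [SMulCommClass A Aᵐᵒᵖ M]
  [AddCommGroup N] [Module A N]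

/-- The left linear map `m ↦ m ⊗ n`. -/
def tmulRight (n : N) : M →ₗ[A] Tens A M N where
  toFun m := tmul m n
  map_add' m m' := add_tmul m m' n
  map_smul' a m := (smul_def_left a m n).symm

/-- The right linear map `m ↦ l ⊗ m`. -/
def tmulLeft (l : L) : M →ₗ[Aᵐᵒᵖ] Tens A L M where
  toFun m := tmul l m
  map_add' m m' := tmul_add l m m'
  map_smul' b m := (smul_def_right b l m).symm

/-- The forward associativity map `(l ⊗ m) ⊗ n ↦ l ⊗ (m ⊗ n)`. -/
def assocHom : Tens A (Tens A L M) N →+ Tens A L (Tens A M N) :=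
  lift
    (AddMonoidHom.mk' (fun x => AddMonoidHom.mk' (fun n => map LinearMap.id (tmulRight n) x)
        (fun n n' => by
          induction x using Tens.induction with
          | zero => simp
          | tmul l m => simp [tmulRight, tmul_add]
          | add x y hx hy => simp only [_root_.map_add, hx, hy]; abel))
      (fun x y => by ext n; simp))
    (fun x a n => by
      change map _ _ (op a • x) = map _ _ x
      induction x using Tens.induction with
      | zero => simp
      | tmul l m => simp [smul_def_right, tmulRight, smul_tmul]
      | add x y hx hy => rw [smul_add, _root_.map_add, _root_.map_add, hx, hy])

@[simp] theorem assocHom_tmul (l : L) (m : M) (n : N) :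
    assocHom (tmul (tmul l m : Tens A L M) n) = tmul l (tmul m n) := rfl

/-- The backward associativity map `l ⊗ (m ⊗ n) ↦ (l ⊗ m) ⊗ n`. -/
def assocInv : Tens A L (Tens A M N) →+ Tens A (Tens A L M) N :=
  lift
    (AddMonoidHom.mk' (fun l => map (tmulLeft l) LinearMap.id)
      (fun l l' => hom_ext (fun m n => by simp [tmulLeft, add_tmul])))
    (fun l a x => by
      change map _ _ x = map _ _ (a • x)
      induction x using Tens.induction with
      | zero => simp
      | tmul m n => simp [smul_def_left, tmulLeft, smul_tmul]
      | add x y hx hy => rw [smul_add, _root_.map_add, _root_.map_add, hx, hy])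

@[simp] theorem assocInv_tmul (l : L) (m : M) (n : N) :
    assocInv (tmul l (tmul m n : Tens A M N)) = tmul (tmul l m) n := rfl

/-- The canonical isomorphism `(L ⊗_A M) ⊗_A N ≃ L ⊗_A (M ⊗_A N)`. -/
def assoc : Tens A (Tens A L M) N ≃+ Tens A L (Tens A M N) :=
  AddMonoidHom.toAddEquiv assocHom assocInv
    (hom_ext (fun x n => by
      induction x using Tens.induction with
      | zero => simp
      | tmul l m => simp
      | add x y hx hy => rw [add_tmul, _root_.map_add, _root_.map_add, hx, hy]))
    (hom_ext (fun l x => by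
      induction x using Tens.induction with
      | zero => simp
      | tmul m n => simp
      | add x y hx hy => rw [tmul_add, _root_.map_add, _root_.map_add, hx, hy]))

@[simp] theorem assoc_tmul (l : L) (m : M) (n : N) :
    assoc (tmul (tmul l m : Tens A L M) n) = tmul l (tmul m n) := rfl

theorem assoc_smul_left [Module A L] [SMulCommClass A Aᵐᵒᵖ L] (a : A)
    (x : Tens A (Tens A L M) N) : assoc (a • x) = a • assoc x := by
  induction x using Tens.induction with
  | zero => simp
  | tmul y n =>
    induction y using Tens.induction with
    | zero => simp
    | tmul l m => rfl
    | add x y hx hy => rw [add_tmul, smul_add, _root_.map_add, _root_.map_add, hx, hy, smul_add]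
  | add x y hx hy => simp [hx, hy]

theorem assoc_smul_right [Module Aᵐᵒᵖ N] [SMulCommClass A Aᵐᵒᵖ N] (b : Aᵐᵒᵖ)
    (x : Tens A (Tens A L M) N) : assoc (b • x) = b • assoc x := by
  induction x using Tens.induction with
  | zero => simp
  | tmul y n =>
    induction y using Tens.induction with
    | zero => simp
    | tmul l m => rfl
    | add x y hx hy => rw [add_tmul, smul_add, _root_.map_add, _root_.map_add, hx, hy, smul_add]
  | add x y hx hy => simp [hx, hy]

end Assoc

end Tens

/-- A homomorphism of `A`-bimodules. -/
structure BimodHom (A : Type u) [Ring A] (M N : Type u) [AddCommGroup M] [Module A M]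
    [Module Aᵐᵒᵖ M] [AddCommGroup N] [Module A N] [Module Aᵐᵒᵖ N] extends M →ₗ[A] N where
  map_op_smul' : ∀ (b : Aᵐᵒᵖ) (m : M), toFun (b • m) = b • toFun m

namespace BimodHom

variable {M N : Type u} [AddCommGroup M] [Module A M] [Module Aᵐᵒᵖ M]
  [AddCommGroup N] [Module A N] [Module Aᵐᵒᵖ N]

instance : CoeFun (BimodHom A M N) (fun _ => M → N) := ⟨fun f => f.toLinearMap⟩

/-- The underlying homomorphism of left modules. -/
abbrev left (f : BimodHom A M N) : M →ₗ[A] N := f.toLinearMap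

/-- The underlying homomorphism of right modules. -/
def right (f : BimodHom A M N) : M →ₗ[Aᵐᵒᵖ] N where
  toFun := f
  map_add' := f.toLinearMap.map_add
  map_smul' := f.map_op_smul'

@[simp] theorem right_apply (f : BimodHom A M N) (m : M) : f.right m = f m := rfl

end BimodHom

namespace Tens

section BimodMaps

variable {A : Type u} [Ring A] {L L' M M' N N' : Type u}
  [AddCommGroup L] [Module Aᵐᵒᵖ L] [AddCommGroup L'] [Module Aᵐᵒᵖ L']
  [AddCommGroup M] [Module A M] [Module Aᵐᵒᵖ M] [SMulCommClass A Aᵐᵒᵖ M]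
  [AddCommGroup M'] [Module A M'] [Module Aᵐᵒᵖ M'] [SMulCommClass A Aᵐᵒᵖ M']
  [AddCommGroup N] [Module A N] [AddCommGroup N'] [Module A N']

/-- `f ⊗ g` as a map of right modules, for a bimodule map `g`. -/
def rmap (f : L →ₗ[Aᵐᵒᵖ] L') (g : BimodHom A M M') : Tens A L M →ₗ[Aᵐᵒᵖ] Tens A L' M' where
  toFun := map f g.left
  map_add' := _root_.map_add _
  map_smul' := map_smul_right f g.left g.map_op_smul'

/-- `f ⊗ g` as a map of left modules, for a bimodule map `f`. -/
def lmap (f : BimodHom A M M') (g : N →ₗ[A] N') : Tens A M N →ₗ[A] Tens A M' N' where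
  toFun := map f.right g
  map_add' := _root_.map_add _
  map_smul' := map_smul_left f.right f.left.map_smul g

@[simp] theorem rmap_apply (f : L →ₗ[Aᵐᵒᵖ] L') (g : BimodHom A M M') (x : Tens A L M) :
    rmap f g x = map f g.left x := rfl

@[simp] theorem lmap_apply (f : BimodHom A M M') (g : N →ₗ[A] N') (x : Tens A M N) :
    lmap f g x = map f.right g x := rfl

theorem assoc_naturality {P : Type u} [AddCommGroup P] [Module Aᵐᵒᵖ P]
    (r : P →ₗ[Aᵐᵒᵖ] Tens A L M) (f : L →ₗ[Aᵐᵒᵖ] L') (g : BimodHom A M M') (h : N →ₗ[A] N')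
    (x : Tens A P N) :
    assoc (map ((rmap f g).comp r) h x) =
      map f (lmap g h) (assoc (map r (LinearMap.id : N →ₗ[A] N) x)) := by
  induction x using Tens.induction with
  | zero => simp
  | add x y hx hy => simp only [_root_.map_add, hx, hy]
  | tmul p n =>
    simp only [map_tmul, LinearMap.comp_apply, rmap_apply, LinearMap.id_apply]
    generalize r p = y
    induction y using Tens.induction with
    | zero => simp
    | tmul l m => simp
    | add x y hx hy => rw [add_tmul, _root_.map_add, add_tmul, _root_.map_add, _root_.map_add,
        _root_.map_add, hx, hy]

end BimodMaps

end Tens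

end Tensor

/-! ### Corings -/

/-- An `A`-coring: an `A`-bimodule with a coassociative and counital comultiplication
`Δ : C → C ⊗_A C` and counit `ε : C → A`, both of them `A`-bimodule maps. -/
structure Coring (A : Type u) [Ring A] where
  carrier : Type u
  [addCommGroup : AddCommGroup carrier]
  [leftModule : Module A carrier]
  [rightModule : Module Aᵐᵒᵖ carrier]
  [smulCommClass : SMulCommClass A Aᵐᵒᵖ carrier]
  comul : BimodHom A carrier (Tens A carrier carrier)
  counit : BimodHom A carrier A
  coassoc : ∀ c : carrier,
    Tens.assoc (Tens.map comul.right (LinearMap.id : carrier →ₗ[A] carrier) (comul c)) =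
      Tens.map (LinearMap.id : carrier →ₗ[Aᵐᵒᵖ] carrier) comul.left (comul c)
  counit_comul : ∀ c : carrier,
    Tens.lid carrier (Tens.map counit.right (LinearMap.id : carrier →ₗ[A] carrier) (comul c)) = c
  comul_counit : ∀ c : carrier,
    Tens.rid carrier (Tens.map (LinearMap.id : carrier →ₗ[Aᵐᵒᵖ] carrier) counit.left (comul c)) = c

instance (A : Type u) [Ring A] : CoeSort (Coring A) (Type u) := ⟨Coring.carrier⟩

attribute [instance] Coring.addCommGroup Coring.leftModule Coring.rightModule
  Coring.smulCommClass

/-- A morphism of `A`-corings (an extension of corings). -/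
structure CoringHom {A : Type u} [Ring A] (C D : Coring A) extends BimodHom A C D where
  map_comul : ∀ c : C,
    D.comul (toBimodHom c) = Tens.map toBimodHom.right toBimodHom.left (C.comul c)
  map_counit : ∀ c : C, D.counit (toBimodHom c) = C.counit c

section Comodules

variable {A : Type u} [Ring A]

/-- A right comodule over a coring `C`. -/
structure RightComod (C : Coring A) where
  carrier : Type u
  [addCommGroup : AddCommGroup carrier]
  [module : Module Aᵐᵒᵖ carrier]
  coact : carrier →ₗ[Aᵐᵒᵖ] Tens A carrier C
  coassoc : ∀ m : carrier,
    Tens.assoc (Tens.map coact (LinearMap.id : C →ₗ[A] C) (coact m)) =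
      Tens.map (LinearMap.id : carrier →ₗ[Aᵐᵒᵖ] carrier) C.comul.left (coact m)
  counit : ∀ m : carrier,
    Tens.rid carrier (Tens.map (LinearMap.id : carrier →ₗ[Aᵐᵒᵖ] carrier) C.counit.left (coact m)) = m

instance (C : Coring A) : CoeSort (RightComod C) (Type u) := ⟨RightComod.carrier⟩

attribute [instance] RightComod.addCommGroup RightComod.module

/-- A left comodule over a coring `C`. -/
structure LeftComod (C : Coring A) where
  carrier : Type u
  [addCommGroup : AddCommGroup carrier]
  [module : Module A carrier]
  coact : carrier →ₗ[A] Tens A C carrier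
  coassoc : ∀ m : carrier,
    Tens.assoc (Tens.map C.comul.right (LinearMap.id : carrier →ₗ[A] carrier) (coact m)) =
      Tens.map (LinearMap.id : C →ₗ[Aᵐᵒᵖ] C) coact (coact m)
  counit : ∀ m : carrier,
    Tens.lid carrier (Tens.map C.counit.right (LinearMap.id : carrier →ₗ[A] carrier) (coact m)) = m

instance (C : Coring A) : CoeSort (LeftComod C) (Type u) := ⟨LeftComod.carrier⟩

attribute [instance] LeftComod.addCommGroup LeftComod.module

/-- A homomorphism of right comodules. -/
@[ext] structure RightComod.Hom {C : Coring A} (M N : RightComod C) where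
  hom : M →ₗ[Aᵐᵒᵖ] N
  colinear : ∀ m : M, N.coact (hom m) = Tens.map hom (LinearMap.id : C →ₗ[A] C) (M.coact m)

/-- A homomorphism of left comodules. -/
@[ext] structure LeftComod.Hom {C : Coring A} (M N : LeftComod C) where
  hom : M →ₗ[A] N
  colinear : ∀ m : M, N.coact (hom m) = Tens.map (LinearMap.id : C →ₗ[Aᵐᵒᵖ] C) hom (M.coact m)

/-- The category of right `C`-comodules. -/
instance (C : Coring A) : Category.{u} (RightComod C) where
  Hom M N := RightComod.Hom M N
  id M := ⟨LinearMap.id, fun m => by simp⟩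
  comp f g := ⟨g.hom.comp f.hom, fun m => by
    simp [g.colinear, f.colinear, Tens.map_map]⟩

/-- The category of left `C`-comodules. -/
instance (C : Coring A) : Category.{u} (LeftComod C) where
  Hom M N := LeftComod.Hom M N
  id M := ⟨LinearMap.id, fun m => by simp⟩
  comp f g := ⟨g.hom.comp f.hom, fun m => by
    simp [g.colinear, f.colinear, Tens.map_map]⟩

end Comodules

/-- A functor is Frobenius if it has a left adjoint and a right adjoint and these are
naturally isomorphic. -/
def IsFrobeniusFunctor {X Y : Type (u + 1)} [Category.{u} X] [Category.{u} Y] (U : X ⥤ Y) :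
    Prop :=
  ∃ L R : Y ⥤ X, Nonempty (L ⊣ U) ∧ Nonempty (U ⊣ R) ∧ Nonempty (L ≅ R)

/-- The cotensor product `M □_D N`, the kernel of `ω = ρ ⊗ N - M ⊗ σ : M ⊗ N → M ⊗ D ⊗ N`,
for a right `D`-coaction `ρ` on `M` and a left `D`-coaction `σ` on `N`. -/
def cotensor {A : Type u} [Ring A] (D : Coring A) {M N : Type u} [AddCommGroup M] [Module Aᵐᵒᵖ M]
    [AddCommGroup N] [Module A N] (r : M →ₗ[Aᵐᵒᵖ] Tens A M D) (s : N →ₗ[A] Tens A D N) :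
    AddSubgroup (Tens A M N) :=
  (Tens.assoc.toAddMonoidHom.comp (Tens.map r (LinearMap.id : N →ₗ[A] N)) -
    Tens.map (LinearMap.id : M →ₗ[Aᵐᵒᵖ] M) s).ker

theorem mem_cotensor {A : Type u} [Ring A] (D : Coring A) {M N : Type u} [AddCommGroup M]
    [Module Aᵐᵒᵖ M] [AddCommGroup N] [Module A N] (r : M →ₗ[Aᵐᵒᵖ] Tens A M D)
    (s : N →ₗ[A] Tens A D N) (x : Tens A M N) :
    x ∈ cotensor D r s ↔
      Tens.assoc (Tens.map r (LinearMap.id : N →ₗ[A] N) x) =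
        Tens.map (LinearMap.id : M →ₗ[Aᵐᵒᵖ] M) s x := by
  rw [cotensor, AddMonoidHom.mem_ker, AddMonoidHom.sub_apply, sub_eq_zero]; rfl

namespace CoringHom

variable {A : Type u} [Ring A] {C D : Coring A} (l : CoringHom C D)

theorem comul_comp_right : D.comul.right.comp l.right =
    (Tens.rmap l.right l.toBimodHom).comp C.comul.right :=
  LinearMap.ext l.map_comul

theorem comul_comp_left : D.comul.left.comp l.left =
    (Tens.lmap l.toBimodHom l.left).comp C.comul.left :=
  LinearMap.ext l.map_comul

theorem counit_comp_right : D.counit.right.comp l.right = C.counit.right :=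
  LinearMap.ext l.map_counit

theorem counit_comp_left : D.counit.left.comp l.left = C.counit.left :=
  LinearMap.ext l.map_counit

/-- The right `D`-coaction `m ↦ m₀ ⊗ l(m₁)` that `l : C → D` induces from a right
`C`-coaction. -/
def corestrictRight {M : Type u} [AddCommGroup M] [Module Aᵐᵒᵖ M]
    (r : M →ₗ[Aᵐᵒᵖ] Tens A M C) : M →ₗ[Aᵐᵒᵖ] Tens A M D :=
  (Tens.rmap LinearMap.id l.toBimodHom).comp r

/-- The left `D`-coaction `m ↦ l(m₋₁) ⊗ m₀` that `l : C → D` induces from a left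
`C`-coaction. -/
def corestrictLeft {M : Type u} [AddCommGroup M] [Module A M]
    (r : M →ₗ[A] Tens A C M) : M →ₗ[A] Tens A D M :=
  (Tens.lmap l.toBimodHom LinearMap.id).comp r

theorem corestrictRight_coassoc (M : RightComod C) (m : M) :
    Tens.assoc (Tens.map (l.corestrictRight M.coact) (LinearMap.id : D →ₗ[A] D)
        (l.corestrictRight M.coact m)) =
      Tens.map (LinearMap.id : M →ₗ[Aᵐᵒᵖ] M) D.comul.left (l.corestrictRight M.coact m) := by
  have h : l.corestrictRight M.coact m = Tens.map LinearMap.id l.left (M.coact m) := rfl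
  rw [h, Tens.map_map, Tens.map_map, comul_comp_left, LinearMap.comp_id, LinearMap.id_comp,
    corestrictRight, Tens.assoc_naturality, M.coassoc, Tens.map_map, LinearMap.id_comp]

theorem corestrictRight_counit (M : RightComod C) (m : M) :
    Tens.rid M (Tens.map (LinearMap.id : M →ₗ[Aᵐᵒᵖ] M) D.counit.left
      (l.corestrictRight M.coact m)) = m := by
  have h : l.corestrictRight M.coact m = Tens.map LinearMap.id l.left (M.coact m) := rfl
  rw [h, Tens.map_map, counit_comp_left, LinearMap.id_comp, M.counit]

theorem corestrictRight_colinear {M N : RightComod C} (f : RightComod.Hom M N) (m : M) :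
    l.corestrictRight N.coact (f.hom m) =
      Tens.map f.hom (LinearMap.id : D →ₗ[A] D) (l.corestrictRight M.coact m) := by
  have h (M : RightComod C) (m : M) :
    l.corestrictRight M.coact m = Tens.map LinearMap.id l.left (M.coact m) := rfl
  rw [h, h, f.colinear, Tens.map_map, Tens.map_map, LinearMap.id_comp, LinearMap.id_comp,
    LinearMap.comp_id, LinearMap.comp_id]

theorem corestrictLeft_coassoc (M : LeftComod C) (m : M) :
    Tens.assoc (Tens.map D.comul.right (LinearMap.id : M →ₗ[A] M)
        (l.corestrictLeft M.coact m)) =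
      Tens.map (LinearMap.id : D →ₗ[Aᵐᵒᵖ] D) (l.corestrictLeft M.coact)
        (l.corestrictLeft M.coact m) := by
  have h : l.corestrictLeft M.coact m = Tens.map l.right LinearMap.id (M.coact m) := rfl
  rw [h, Tens.map_map, Tens.map_map, comul_comp_right, LinearMap.comp_id, LinearMap.id_comp,
    corestrictLeft, Tens.assoc_naturality, M.coassoc, Tens.map_map, LinearMap.comp_id,
    LinearMap.comp_id]

theorem corestrictLeft_counit (M : LeftComod C) (m : M) :
    Tens.lid M (Tens.map D.counit.right (LinearMap.id : M →ₗ[A] M)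
      (l.corestrictLeft M.coact m)) = m := by
  have h : l.corestrictLeft M.coact m = Tens.map l.right LinearMap.id (M.coact m) := rfl
  rw [h, Tens.map_map, counit_comp_right, LinearMap.id_comp, M.counit]

theorem corestrictLeft_colinear {M N : LeftComod C} (f : LeftComod.Hom M N) (m : M) :
    l.corestrictLeft N.coact (f.hom m) =
      Tens.map (LinearMap.id : D →ₗ[Aᵐᵒᵖ] D) f.hom (l.corestrictLeft M.coact m) := by
  have h (M : LeftComod C) (m : M) :
    l.corestrictLeft M.coact m = Tens.map l.right LinearMap.id (M.coact m) := rfl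
  rw [h, h, f.colinear, Tens.map_map, Tens.map_map, LinearMap.id_comp, LinearMap.id_comp,
    LinearMap.comp_id, LinearMap.comp_id]

/-- The corestriction functor from right `C`-comodules to right `D`-comodules. -/
def rightCorestriction : RightComod C ⥤ RightComod D where
  obj M :=
    { carrier := M
      coact := l.corestrictRight M.coact
      coassoc := l.corestrictRight_coassoc M
      counit := l.corestrictRight_counit M }
  map f := RightComod.Hom.mk f.hom (l.corestrictRight_colinear f)
  map_id _ := rfl
  map_comp _ _ := rfl

/-- The corestriction functor from left `C`-comodules to left `D`-comodules. -/
def leftCorestriction : LeftComod C ⥤ LeftComod D where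
  obj M :=
    { carrier := M
      coact := l.corestrictLeft M.coact
      coassoc := l.corestrictLeft_coassoc M
      counit := l.corestrictLeft_counit M }
  map f := LeftComod.Hom.mk f.hom (l.corestrictLeft_colinear f)
  map_id _ := rfl
  map_comp _ _ := rfl

/-- `l : C → D` is a right Frobenius extension if the corestriction functor between the
categories of right comodules is Frobenius. -/
def IsRightFrobenius : Prop := IsFrobeniusFunctor l.rightCorestriction

/-- `l : C → D` is a left Frobenius extension if the corestriction functor between the
categories of left comodules is Frobenius. -/
def IsLeftFrobenius : Prop := IsFrobeniusFunctor l.leftCorestriction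

/-- The right `D`-coaction `c ↦ c₁ ⊗ l(c₂)` on `C`. -/
def rightCoact : C →ₗ[Aᵐᵒᵖ] Tens A C D := l.corestrictRight C.comul.right

/-- The left `D`-coaction `c ↦ l(c₁) ⊗ c₂` on `C`. -/
def leftCoact : C →ₗ[A] Tens A D C := l.corestrictLeft C.comul.left

/-- The cotensor product `C □_D C`, with its left module structure. -/
def cotensorSq : Submodule A (Tens A C C) where
  __ := cotensor D l.rightCoact l.leftCoact
  smul_mem' a x hx := by
    have hx := (mem_cotensor D l.rightCoact l.leftCoact x).1 hx
    refine (mem_cotensor D l.rightCoact l.leftCoact (a • x)).2 ?_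
    have h : ∀ (a : A) (c : C), l.rightCoact (a • c) = a • l.rightCoact c := fun a c => by
      change Tens.map _ _ (C.comul (a • c)) = a • Tens.map _ _ (C.comul c)
      rw [C.comul.left.map_smul, Tens.map_smul_left _ (fun _ _ => rfl)]
    rw [Tens.map_smul_left _ h, Tens.assoc_smul_left, hx, Tens.map_smul_left _ (fun _ _ => rfl)]

theorem mem_cotensorSq (x : Tens A C C) : x ∈ l.cotensorSq ↔
    x ∈ cotensor D l.rightCoact l.leftCoact := Iff.rfl

theorem op_smul_mem (b : Aᵐᵒᵖ) {x : Tens A C C} (hx : x ∈ l.cotensorSq) :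
    b • x ∈ l.cotensorSq := by
  rw [mem_cotensorSq, mem_cotensor] at hx ⊢
  have h : ∀ (b : Aᵐᵒᵖ) (c : C), l.leftCoact (b • c) = b • l.leftCoact c := fun b c => by
    change Tens.map _ _ (C.comul (b • c)) = b • Tens.map _ _ (C.comul c)
    rw [← C.comul.right_apply, map_smul, Tens.map_smul_right _ _ (fun _ _ => rfl)]
    rfl
  rw [Tens.map_smul_right _ _ (fun _ _ => rfl), Tens.assoc_smul_right, hx,
    Tens.map_smul_right _ _ h]

/-- The right module structure of `C □_D C`. -/
instance : Module Aᵐᵒᵖ l.cotensorSq where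
  smul b x := ⟨b • x.1, l.op_smul_mem b x.2⟩
  one_smul x := Subtype.ext (one_smul Aᵐᵒᵖ x.1)
  mul_smul a b x := Subtype.ext (mul_smul a b x.1)
  smul_zero a := Subtype.ext (smul_zero a)
  smul_add a x y := Subtype.ext (smul_add a x.1 y.1)
  add_smul a b x := Subtype.ext (add_smul a b x.1)
  zero_smul x := Subtype.ext (zero_smul Aᵐᵒᵖ x.1)

instance : SMulCommClass A Aᵐᵒᵖ l.cotensorSq where
  smul_comm a b x := Subtype.ext (smul_comm a b x.1)

/-- The inclusion of `C □_D C` in `C ⊗_A C`. -/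
def cotensorIncl : BimodHom A l.cotensorSq (Tens A C C) where
  toLinearMap := l.cotensorSq.subtype
  map_op_smul' _ _ := rfl

/-- `r` is the right `C`-coaction `x ⊗ y ↦ (x ⊗ y₁) ⊗ y₂` on `C □_D C`: it becomes `C ⊗ Δ` after
the inclusion in `C ⊗ C ⊗ C`. If `C` is flat as a left module, there is exactly one such `r`. -/
def IsCotensorRightCoaction (r : l.cotensorSq →ₗ[Aᵐᵒᵖ] Tens A l.cotensorSq C) : Prop :=
  ∀ x : l.cotensorSq,
    Tens.assoc (Tens.map l.cotensorIncl.right (LinearMap.id : C →ₗ[A] C) (r x)) =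
      Tens.map (LinearMap.id : C →ₗ[Aᵐᵒᵖ] C) C.comul.left x.1

/-- `s` is the left `C`-coaction `x ⊗ y ↦ x₁ ⊗ (x₂ ⊗ y)` on `C □_D C`: it becomes `Δ ⊗ C` after
the inclusion in `C ⊗ C ⊗ C`. If `C` is flat as a right module, there is exactly one such `s`. -/
def IsCotensorLeftCoaction (s : l.cotensorSq →ₗ[A] Tens A C l.cotensorSq) : Prop :=
  ∀ x : l.cotensorSq,
    Tens.map (LinearMap.id : C →ₗ[Aᵐᵒᵖ] C) l.cotensorIncl.left (s x) =
      Tens.assoc (Tens.map C.comul.right (LinearMap.id : C →ₗ[A] C) x.1)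

/-- The `D`-bicomodule homomorphisms `D → C`, where `C` is a `D`-bicomodule through `l`. -/
structure HomDC extends BimodHom A D C where
  right_colinear : ∀ d : D,
    l.rightCoact (toBimodHom d) =
      Tens.map toBimodHom.right (LinearMap.id : D →ₗ[A] D) (D.comul d)
  left_colinear : ∀ d : D,
    l.leftCoact (toBimodHom d) =
      Tens.map (LinearMap.id : D →ₗ[Aᵐᵒᵖ] D) toBimodHom.left (D.comul d)

/-- The `C`-bicomodule homomorphisms `C □_D C → C`. -/
structure HomCotensorC extends BimodHom A l.cotensorSq C where
  right_colinear : ∃ r : l.cotensorSq →ₗ[Aᵐᵒᵖ] Tens A l.cotensorSq C,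
    l.IsCotensorRightCoaction r ∧
    ∀ x, C.comul (toBimodHom x) = Tens.map toBimodHom.right (LinearMap.id : C →ₗ[A] C) (r x)
  left_colinear : ∃ s : l.cotensorSq →ₗ[A] Tens A C l.cotensorSq,
    l.IsCotensorLeftCoaction s ∧
    ∀ x, C.comul (toBimodHom x) = Tens.map (LinearMap.id : C →ₗ[Aᵐᵒᵖ] C) toBimodHom.left (s x)

variable {l}

/-- The map `(α l ⊗ 1) ∘ Δ : C → C □_D C`, `c ↦ α(l(c₁)) ⊗ c₂`. -/
def HomDC.insertLeft (α : l.HomDC) (c : C) : l.cotensorSq :=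
  ⟨Tens.map (α.right.comp l.right) (LinearMap.id : C →ₗ[A] C) (C.comul c), by
    rw [mem_cotensorSq, mem_cotensor, Tens.map_map, Tens.map_map]
    have h : l.rightCoact.comp (α.right.comp l.right) =
        (Tens.rmap (α.right.comp l.right) l.toBimodHom).comp C.comul.right := by
      ext c
      change l.rightCoact (α.toBimodHom (l.toBimodHom c)) = _
      rw [α.right_colinear, l.map_comul, Tens.map_map]
      rfl
    rw [h, LinearMap.comp_id, Tens.assoc_naturality, C.coassoc, Tens.map_map]
    rfl⟩

/-- The map `(1 ⊗ α l) ∘ Δ : C → C □_D C`, `c ↦ c₁ ⊗ α(l(c₂))`. -/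
def HomDC.insertRight (α : l.HomDC) (c : C) : l.cotensorSq :=
  ⟨Tens.map (LinearMap.id : C →ₗ[Aᵐᵒᵖ] C) (α.left.comp l.left) (C.comul c), by
    rw [mem_cotensorSq, mem_cotensor, Tens.map_map, Tens.map_map]
    have h : l.leftCoact.comp (α.left.comp l.left) =
        (Tens.lmap l.toBimodHom (α.left.comp l.left)).comp C.comul.left := by
      ext c
      change l.leftCoact (α.toBimodHom (l.toBimodHom c)) = _
      rw [α.left_colinear, l.map_comul, Tens.map_map]
      rfl
    rw [h, LinearMap.comp_id, LinearMap.id_comp, rightCoact, corestrictRight,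
      Tens.assoc_naturality, C.coassoc, Tens.map_map, LinearMap.id_comp]⟩

end CoringHom

/-! ### Coalgebras over a field as corings -/

section Coalgebras

variable {K : Type u} [Field K]

section Central

variable {M N P Q : Type u} [AddCommGroup M] [Module K M] [Module Kᵐᵒᵖ M] [IsCentralScalar K M]
  [AddCommGroup N] [Module K N] [Module Kᵐᵒᵖ N] [IsCentralScalar K N]
  [AddCommGroup P] [Module K P]

/-- A linear map between symmetric bimodules, as a bimodule map. -/
def LinearMap.toBimodHom (f : M →ₗ[K] N) : BimodHom K M N where
  toLinearMap := f
  map_op_smul' b m := by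
    change f (b • m) = b • f m
    rw [← op_unop b, op_smul_eq_smul, op_smul_eq_smul, map_smul]

instance : IsCentralScalar K (Tens K M N) where
  op_smul_eq_smul a x := by
    induction x using Tens.induction with
    | zero => simp
    | tmul m n =>
      rw [Tens.smul_def_left, Tens.smul_def_right, op_smul_eq_smul, ← Tens.smul_tmul,
        op_smul_eq_smul]
    | add x y hx hy => simp [hx, hy]

/-- The canonical map `M ⊗_K N → M ⊗_K N`, `m ⊗ n ↦ m ⊗ n`, from Mathlib's tensor product over a
field. -/
def Tens.ofTensor : TensorProduct K M P →ₗ[K] Tens K M P where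
  __ := TensorProduct.liftAddHom (R := K) Tens.mk (fun a m p => by
      rw [← op_smul_eq_smul]; exact Tens.smul_tmul m a p)
  map_smul' a x := by
    change TensorProduct.liftAddHom _ _ (a • x) = a • TensorProduct.liftAddHom _ _ x
    induction x using TensorProduct.induction_on with
    | zero => simp
    | tmul m n => rfl
    | add x y hx hy => rw [smul_add, map_add, map_add, hx, hy, smul_add]

@[simp] theorem Tens.ofTensor_tmul (m : M) (p : P) :
    Tens.ofTensor (TensorProduct.tmul K m p) = Tens.tmul m p := rfl

theorem Tens.map_ofTensor [AddCommGroup Q] [Module K Q] (f : M →ₗ[K] N) (g : P →ₗ[K] Q)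
    (x : TensorProduct K M P) :
    Tens.map f.toBimodHom.right g (Tens.ofTensor x) = Tens.ofTensor (TensorProduct.map f g x) := by
  induction x using TensorProduct.induction_on with
  | zero => simp
  | tmul m n => rfl
  | add x y hx hy => simp [hx, hy]

theorem Tens.map_ofTensor_left (f : M →ₗ[K] TensorProduct K N N) (x : TensorProduct K M P) :
    Tens.assoc (Tens.map (Tens.ofTensor.comp f).toBimodHom.right LinearMap.id (Tens.ofTensor x)) =
      Tens.ofTensor (TensorProduct.map LinearMap.id Tens.ofTensor
        (TensorProduct.assoc K N N P (f.rTensor P x))) := by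
  induction x using TensorProduct.induction_on with
  | zero => simp
  | add x y hx hy => simp only [map_add, hx, hy]
  | tmul m p =>
    change Tens.assoc (Tens.tmul (Tens.ofTensor (f m)) p) = Tens.ofTensor (TensorProduct.map
      LinearMap.id Tens.ofTensor (TensorProduct.assoc K N N P (TensorProduct.tmul K (f m) p)))
    generalize f m = y
    induction y using TensorProduct.induction_on with
    | zero => simp
    | add x y hx hy => simp only [map_add, Tens.add_tmul, TensorProduct.add_tmul, hx, hy]
    | tmul a b => rfl

theorem Tens.map_ofTensor_right (f : P →ₗ[K] TensorProduct K N P) (x : TensorProduct K M P) :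
    Tens.map (LinearMap.id : M →ₗ[Kᵐᵒᵖ] M) (Tens.ofTensor.comp f) (Tens.ofTensor x) =
      Tens.ofTensor (TensorProduct.map LinearMap.id Tens.ofTensor (f.lTensor M x)) := by
  induction x using TensorProduct.induction_on with
  | zero => simp
  | add x y hx hy => simp only [map_add, hx, hy]
  | tmul m p => rfl

theorem Tens.ofTensor_coassoc [Coalgebra K M] (c : M) :
    Tens.assoc (Tens.map (Tens.ofTensor.comp (Coalgebra.comul : M →ₗ[K] _)).toBimodHom.right
        (LinearMap.id : M →ₗ[K] M) (Tens.ofTensor (Coalgebra.comul (R := K) c))) =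
      Tens.map (LinearMap.id : M →ₗ[Kᵐᵒᵖ] M) (Tens.ofTensor.comp (Coalgebra.comul : M →ₗ[K] _))
        (Tens.ofTensor (Coalgebra.comul (R := K) c)) := by
  rw [Tens.map_ofTensor_left, Tens.map_ofTensor_right, Coalgebra.coassoc_apply]

theorem Tens.lid_ofTensor (f : M →ₗ[K] K) (x : TensorProduct K M P) :
    Tens.lid P (Tens.map f.toBimodHom.right (LinearMap.id : P →ₗ[K] P) (Tens.ofTensor x)) =
      TensorProduct.lid K P (f.rTensor P x) := by
  induction x using TensorProduct.induction_on with
  | zero => simp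
  | add x y hx hy => simp only [map_add, hx, hy]
  | tmul m p => rfl

theorem Tens.rid_ofTensor (f : P →ₗ[K] K) (x : TensorProduct K M P) :
    Tens.rid M (Tens.map (LinearMap.id : M →ₗ[Kᵐᵒᵖ] M) f (Tens.ofTensor x)) =
      TensorProduct.rid K M (f.lTensor M x) := by
  induction x using TensorProduct.induction_on with
  | zero => simp
  | add x y hx hy => simp only [map_add, hx, hy]
  | tmul m p => exact op_smul_eq_smul (f p) m

/-- A coalgebra over a field, with a symmetric bimodule structure, as a coring. -/
def Coring.ofCentralCoalgebra (K M : Type u) [Field K] [AddCommGroup M] [Module K M]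
    [Module Kᵐᵒᵖ M] [IsCentralScalar K M] [Coalgebra K M] : Coring K where
  carrier := M
  comul := (Tens.ofTensor.comp (Coalgebra.comul : M →ₗ[K] _)).toBimodHom
  counit := (Coalgebra.counit : M →ₗ[K] K).toBimodHom
  coassoc c := Tens.ofTensor_coassoc c
  counit_comul c := (Tens.lid_ofTensor (Coalgebra.counit : M →ₗ[K] K) _).trans (by
    rw [Coalgebra.rTensor_counit_comul, TensorProduct.lid_tmul, one_smul])
  comul_counit c := (Tens.rid_ofTensor (Coalgebra.counit : M →ₗ[K] K) _).trans (by
    rw [Coalgebra.lTensor_counit_comul, TensorProduct.rid_tmul, one_smul])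

theorem Tens.ofTensor_map_comul [Coalgebra K M] [Coalgebra K N] (f : M →ₗc[K] N) (c : M) :
    Tens.ofTensor (Coalgebra.comul (R := K) (f c)) =
      Tens.map f.toLinearMap.toBimodHom.right f.toLinearMap
        (Tens.ofTensor (Coalgebra.comul (R := K) c)) := by
  rw [Tens.map_ofTensor]
  exact congrArg Tens.ofTensor (CoalgHomClass.map_comp_comul_apply f c).symm

/-- A homomorphism of coalgebras over a field as a morphism of corings. -/
def CoringHom.ofCentralCoalgHom [Coalgebra K M] [Coalgebra K N] (f : M →ₗc[K] N) :
    CoringHom (Coring.ofCentralCoalgebra K M) (Coring.ofCentralCoalgebra K N) :=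
  let g : BimodHom K M N := f.toLinearMap.toBimodHom
  have h : ∀ c : M, Coalgebra.counit (R := K) (f c) = Coalgebra.counit (R := K) c :=
    fun c => CoalgHomClass.counit_comp_apply f c
  { toBimodHom := g
    map_comul := fun c => Tens.ofTensor_map_comul f c
    map_counit := h }

end Central

/-- The right action of a field on a vector space that agrees with the left one. -/
abbrev symmModule (K M : Type u) [Field K] [AddCommGroup M] [Module K M] : Module Kᵐᵒᵖ M :=
  Module.compHom M ((RingHom.id K).fromOpposite fun _ _ => mul_comm _ _)

/-- A coalgebra over a field, with the right action equal to the left action, as a coring. -/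
def Coring.ofCoalgebra (K M : Type u) [Field K] [AddCommGroup M] [Module K M] [Coalgebra K M] :
    Coring K :=
  letI := symmModule K M
  haveI : IsCentralScalar K M := ⟨fun _ _ => rfl⟩
  Coring.ofCentralCoalgebra K M

/-- A homomorphism of coalgebras over a field as a morphism of corings. -/
def CoringHom.ofCoalgHom {M N : Type u} [AddCommGroup M] [Module K M] [Coalgebra K M]
    [AddCommGroup N] [Module K N] [Coalgebra K N] (f : M →ₗc[K] N) :
    CoringHom (Coring.ofCoalgebra K M) (Coring.ofCoalgebra K N) :=
  letI := symmModule K M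
  haveI : IsCentralScalar K M := ⟨fun _ _ => rfl⟩
  letI := symmModule K N
  haveI : IsCentralScalar K N := ⟨fun _ _ => rfl⟩
  CoringHom.ofCentralCoalgHom f

end Coalgebras

/-!
# Frobenius extensions of corings over a von Neumann regular ring

Over a von Neumann regular ring every module is flat: its character module is injective by Baer's
criterion, because an element of `X ⊗ I`, for a left ideal `I`, is a pure tensor `x ⊗ e`, which
vanishes as soon as `x e` does. Hence the equalizer of two homomorphisms of comodules is again a
comodule, and so is the cotensor product `N □_D C`, the equalizer of two homomorphisms of cofree
comodules `N ⊗ C ⇉ (N ⊗ D) ⊗ C`. The functor `- □_D C` from right `D`-comodules to right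
`C`-comodules is right adjoint to corestriction (`CoringHom.rightAdjunction`). As adjoints are
unique, `l` is right Frobenius if and only if `- □_D C` is also left adjoint to corestriction, that
is, if there are a unit `η_N : N → N □_D C` and a counit `ε_M : M □_D C → M` satisfying the triangle
identities.

Such natural transformations are the same thing as bicomodule homomorphisms. Given `η` and `ε`, let
`α` be `η_D` followed by the map `D □_D C → C`, `d ⊗ c ↦ ε(d) c`, and let `β` be `ε_C`. Naturality
with respect to left multiplications makes them left linear. Naturality with respect to the comodule
maps `d ↦ x ⊗ d` and the coactions `N → N ⊗ D` gives `η_N(n) = n₀ ⊗ α(n₁)`; in the same way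
`ε_{X ⊗ C} = X ⊗ β`. The left colinearity of `α` and `β` follows from these formulas, and the
triangle identities at `C` and `D` become the two identities for `α` and `β`. Conversely,
`η_N(n) = n₀ ⊗ α(n₁)` and `ε_M(m ⊗ c) = m₀ ε(β(m₁ ⊗ c))` define a unit and a counit for any such
pair. The condition on `α` and `β` is symmetric, and the same argument applied to `C □_D -` and left
comodules shows that it is also equivalent to `l` being left Frobenius
(`CoringHom.isRightFrobenius_iff`, `CoringHom.isLeftFrobenius_iff`). Fields are von Neumann regular,
so coalgebras over a field are a special case.
-/

/-! ### Flatness over a von Neumann regular ring -/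

theorem IsVonNeumannRegular.op {A : Type u} [Ring A] (h : IsVonNeumannRegular A) :
    IsVonNeumannRegular Aᵐᵒᵖ := fun a => by
  obtain ⟨x, hx⟩ := h (unop a)
  refine ⟨MulOpposite.op x, unop_injective ?_⟩
  simpa [mul_assoc] using hx

theorem IsVonNeumannRegular.exists_right_unit {A : Type u} [Ring A] (h : IsVonNeumannRegular A)
    (I : Ideal A) (a b : I) : ∃ e : I, (a : A) * e = a ∧ (b : A) * e = b := by
  obtain ⟨x, hx⟩ := h a
  -- `x a` is a right unit for `a`; it is corrected by a right unit of `b - b x a`.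
  obtain ⟨y, hy⟩ := h (b - b * (x * a))
  have ha : (a : A) * (x * a) = a := by rw [← mul_assoc, hx]
  have hI : y * (b - b * (x * a)) ∈ I :=
    I.mul_mem_left _ (I.sub_mem b.2 (I.mul_mem_left _ (I.mul_mem_left _ a.2)))
  refine ⟨⟨x * a + y * (b - b * (x * a)) - x * a * (y * (b - b * (x * a))),
    I.sub_mem (I.add_mem (I.mul_mem_left _ a.2) hI) (I.mul_mem_left _ hI)⟩, ?_, ?_⟩
  · change (a : A) * (_ - _) = a
    rw [mul_sub, mul_add, ← mul_assoc (a : A) (x * a), ha, add_sub_cancel_right]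
  · change (b : A) * (_ - _) = b
    rw [mul_sub, mul_add, ← mul_assoc (b : A) (x * a), add_sub_assoc, ← sub_mul,
      ← mul_assoc (_ - _) y, hy, add_sub_cancel]

section Flat

variable {A : Type u} [Ring A]

/-- Over a von Neumann regular ring every element of `X ⊗ I`, for a left ideal `I`, is a pure
tensor, because finitely many elements of `I` have a common right unit in `I`. -/
theorem Tens.exists_eq_tmul_ideal (hA : IsVonNeumannRegular A) {X : Type u} [AddCommGroup X]
    [Module Aᵐᵒᵖ X] (I : Ideal A) (z : Tens A X I) : ∃ (x : X) (e : I), z = tmul x e := by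
  induction z using Tens.induction with
  | zero => exact ⟨0, 0, by simp⟩
  | tmul x a => exact ⟨x, a, rfl⟩
  | add y z hy hz =>
    obtain ⟨x, a, rfl⟩ := hy
    obtain ⟨x', b, rfl⟩ := hz
    obtain ⟨e, ha, hb⟩ := hA.exists_right_unit I a b
    have ha : (a : A) • e = a := Subtype.ext ha
    have hb : (b : A) • e = b := Subtype.ext hb
    refine ⟨MulOpposite.op (a : A) • x + MulOpposite.op (b : A) • x', e, ?_⟩
    rw [add_tmul, smul_tmul, smul_tmul, ha, hb]

theorem Tens.rid_map_ideal_injective (hA : IsVonNeumannRegular A) {X : Type u} [AddCommGroup X]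
    [Module Aᵐᵒᵖ X] (I : Ideal A) :
    Function.Injective ((rid X).comp (map (LinearMap.id : X →ₗ[Aᵐᵒᵖ] X) I.subtype)) := by
  refine (injective_iff_map_eq_zero _).2 fun z hz => ?_
  obtain ⟨x, e, rfl⟩ := exists_eq_tmul_ideal hA I z
  have hz : MulOpposite.op (e : A) • x = 0 := hz
  obtain ⟨y, hy⟩ := hA e
  have he : e = (e : A) • (⟨y * e, I.mul_mem_left y e.2⟩ : I) :=
    Subtype.ext (by change (e : A) = e * (y * e); rw [← mul_assoc, hy])
  rw [he, ← smul_tmul, hz, zero_tmul]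

/-- A balanced biadditive map into `ℚ/ℤ` induces a character of the tensor product. -/
def Tens.liftCharacter {M N : Type u} [AddCommGroup M] [Module Aᵐᵒᵖ M] [AddCommGroup N]
    [Module A N] (f : M →+ N →+ AddCircle (1 : ℚ))
    (hf : ∀ (m : M) (a : A) (n : N), f (op a • m) n = f m (a • n)) :
    Tens A M N →+ AddCircle (1 : ℚ) :=
  AddEquiv.ulift.toAddMonoidHom.comp
    (lift ((AddMonoidHom.compHom AddEquiv.ulift.symm.toAddMonoidHom).comp f)
      (fun m a n => congrArg ULift.up (hf m a n)))

theorem Tens.character_ext {M N : Type u} [AddCommGroup M] [Module Aᵐᵒᵖ M] [AddCommGroup N]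
    [Module A N] {χ ψ : Tens A M N →+ AddCircle (1 : ℚ)}
    (h : ∀ m n, χ (tmul m n) = ψ (tmul m n)) : χ = ψ := by
  ext x
  induction x using Tens.induction with
  | zero => simp
  | tmul m n => exact h m n
  | add x y hx hy => simp [hx, hy]

/-- The character group of a module `X`, as a module over a ring `A` acting on `X` from the other
side through `σ`: `(a f) x = f (x a)`. -/
abbrev characterModule {B : Type u} [Ring B] (σ : Aᵐᵒᵖ →+* B) (X : Type u) [AddCommGroup X]
    [Module B X] : Module A (X →+ AddCircle (1 : ℚ)) where
  smul a f := f.comp (DistribSMul.toAddMonoidHom X (σ (op a)))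
  one_smul f := by ext x; change f (σ (op 1) • x) = f x; simp
  mul_smul a b f := by
    ext x
    change f (σ (op (a * b)) • x) = f (σ (op b) • σ (op a) • x)
    rw [op_mul, map_mul, mul_smul]
  smul_zero a := rfl
  smul_add a f g := rfl
  add_smul a b f := by
    ext x
    change f (σ (op (a + b)) • x) = f (σ (op a) • x) + f (σ (op b) • x)
    rw [MulOpposite.op_add, map_add, add_smul, map_add]
  zero_smul f := by ext x; change f (σ (op 0) • x) = 0; simp

/-- Over a von Neumann regular ring, balanced maps into `ℚ/ℤ` extend along injections: the
character modules are injective, by Baer's criterion. Letting the second ring act through `σ`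
covers the flatness of left modules and of right modules alike. -/
theorem exists_balanced_extension (hA : IsVonNeumannRegular A) {B : Type u} [Ring B]
    (σ : Aᵐᵒᵖ →+* B) {X N N' : Type u} [AddCommGroup X] [Module B X] [AddCommGroup N] [Module A N]
    [AddCommGroup N'] [Module A N'] (g : N →ₗ[A] N') (hg : Function.Injective g)
    (f : N →+ X →+ AddCircle (1 : ℚ)) (hf : ∀ a n x, f (a • n) x = f n (σ (op a) • x)) :
    ∃ f' : N' →+ X →+ AddCircle (1 : ℚ),
      (∀ a n x, f' (a • n) x = f' n (σ (op a) • x)) ∧ ∀ n, f' (g n) = f n := by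
  let _ := characterModule σ X
  have baer : Module.Baer A (X →+ AddCircle (1 : ℚ)) := fun I q => by
    let _ : Module Aᵐᵒᵖ X := Module.compHom X σ
    let χ : Tens A X I →+ AddCircle (1 : ℚ) := Tens.liftCharacter q.toAddMonoidHom.flip
      (fun x a i => by
        change q i (σ (op a) • x) = q (a • i) x
        exact (DFunLike.congr_fun (q.map_smul a i) x).symm)
    obtain ⟨φ, hφ⟩ := CharacterModule.dual_surjective_of_injective
      ((Tens.rid X).comp (Tens.map LinearMap.id I.subtype)).toIntLinearMap
      (Tens.rid_map_ideal_injective hA (X := X) I) χ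
    refine ⟨LinearMap.toSpanSingleton A _ φ, fun a ha => ?_⟩
    ext x
    exact DFunLike.congr_fun hφ (Tens.tmul x ⟨a, ha⟩)
  obtain ⟨f', hf'⟩ := baer.extension_property g hg
    { f with map_smul' := fun a n => by ext x; exact hf a n x }
  refine ⟨f'.toAddMonoidHom, fun a n x => ?_, fun n => DFunLike.congr_fun hf' n⟩
  exact DFunLike.congr_fun (f'.map_smul a n) x

variable {M M' N N' : Type u} [AddCommGroup M] [Module Aᵐᵒᵖ M] [AddCommGroup M'] [Module Aᵐᵒᵖ M']
  [AddCommGroup N] [Module A N] [AddCommGroup N'] [Module A N']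

/-- Right modules over a von Neumann regular ring are flat. -/
theorem Tens.map_id_left_injective (hA : IsVonNeumannRegular A) {g : N →ₗ[A] N'}
    (hg : Function.Injective g) :
    Function.Injective (map (LinearMap.id : M →ₗ[Aᵐᵒᵖ] M) g) := by
  refine (injective_iff_map_eq_zero _).2 fun z hz => CharacterModule.eq_zero_of_character_apply ?_
  intro χ
  obtain ⟨f, hf, hfg⟩ := exists_balanced_extension hA (RingHom.id Aᵐᵒᵖ) g hg
    ((AddMonoidHom.compHom χ).comp mk).flip
    (fun a n m => congrArg χ (smul_tmul m a n).symm)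
  obtain ⟨ψ, hψ⟩ : ∃ ψ : Tens A M N' →+ AddCircle (1 : ℚ), χ = ψ.comp (map LinearMap.id g) :=
    ⟨liftCharacter f.flip fun m a n => (hf a n m).symm,
      character_ext fun m n => (DFunLike.congr_fun (hfg n) m).symm⟩
  rw [hψ]
  exact (congrArg ψ hz).trans (_root_.map_zero ψ)

/-- Left modules over a von Neumann regular ring are flat. -/
theorem Tens.map_id_right_injective (hA : IsVonNeumannRegular A) {g : M →ₗ[Aᵐᵒᵖ] M'}
    (hg : Function.Injective g) :
    Function.Injective (map g (LinearMap.id : N →ₗ[A] N)) := by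
  refine (injective_iff_map_eq_zero _).2 fun z hz => CharacterModule.eq_zero_of_character_apply ?_
  intro χ
  obtain ⟨f, hf, hfg⟩ := exists_balanced_extension hA.op (RingEquiv.opOp A).symm.toRingHom g hg
    ((AddMonoidHom.compHom χ).comp mk)
    (fun a m n => congrArg χ (smul_tmul m (unop a) n))
  obtain ⟨ψ, hψ⟩ : ∃ ψ : Tens A M' N →+ AddCircle (1 : ℚ), χ = ψ.comp (map g LinearMap.id) :=
    ⟨liftCharacter f fun m a n => hf (op a) m n,
      character_ext fun m n => (DFunLike.congr_fun (hfg m) n).symm⟩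
  rw [hψ]
  exact (congrArg ψ hz).trans (_root_.map_zero ψ)

end Flat

/-! ### Exactness of the tensor product -/

section Exact

variable {A : Type u} [Ring A]
  {M N K P : Type u} [AddCommGroup M] [AddCommGroup N] [AddCommGroup K] [AddCommGroup P]

namespace Tens

theorem map_sub_right [Module Aᵐᵒᵖ M] [Module A N] [Module Aᵐᵒᵖ K] [Module A P]
    (f : M →ₗ[Aᵐᵒᵖ] K) (g g' : N →ₗ[A] P) (z : Tens A M N) :
    map f (g - g') z = map f g z - map f g' z := by
  induction z using Tens.induction with
  | zero => simp
  | tmul m n => exact _root_.map_sub (mk (A := A) (f m)) (g n) (g' n)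
  | add x y hx hy => rw [_root_.map_add, _root_.map_add, _root_.map_add, hx, hy]; abel

theorem map_sub_left [Module Aᵐᵒᵖ M] [Module A N] [Module Aᵐᵒᵖ K] [Module A P]
    (f f' : M →ₗ[Aᵐᵒᵖ] K) (g : N →ₗ[A] P) (z : Tens A M N) :
    map (f - f') g z = map f g z - map f' g z := by
  induction z using Tens.induction with
  | zero => simp
  | tmul m n => exact _root_.map_sub (mk.flip (g n) : K →+ Tens A K P) (f m) (f' m)
  | add x y hx hy => rw [_root_.map_add, _root_.map_add, _root_.map_add, hx, hy]; abel

/-- `M ⊗ -` is right exact. -/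
theorem mem_range_map_of_mkQ_left [Module Aᵐᵒᵖ M] [Module A N] [Module A K] (i : K →ₗ[A] N)
    {z : Tens A M N} (hz : map (LinearMap.id : M →ₗ[Aᵐᵒᵖ] M) i.range.mkQ z = 0) :
    z ∈ (map (LinearMap.id : M →ₗ[Aᵐᵒᵖ] M) i).range := by
  let S := (map (LinearMap.id : M →ₗ[Aᵐᵒᵖ] M) i).range
  let q : Tens A M N →+ Tens A M N ⧸ S := QuotientAddGroup.mk' S
  let φ (m : M) : N ⧸ i.range →+ Tens A M N ⧸ S :=
    QuotientAddGroup.lift i.range.toAddSubgroup (q.comp (mk m)) (by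
      rintro _ ⟨k, rfl⟩
      exact (QuotientAddGroup.eq_zero_iff _).2 ⟨tmul m k, rfl⟩)
  let p : Tens A M (N ⧸ i.range) →+ Tens A M N ⧸ S := lift
    (AddMonoidHom.mk' φ fun m m' => by
      ext n
      obtain ⟨n, rfl⟩ := i.range.mkQ_surjective n
      exact (congrArg q (add_tmul m m' n)).trans (_root_.map_add q _ _))
    (fun m a n => by
      obtain ⟨n, rfl⟩ := i.range.mkQ_surjective n
      change q (tmul (op a • m) n) = q (tmul m (a • n))
      rw [smul_tmul])
  have h : p.comp (map LinearMap.id i.range.mkQ) = q := hom_ext fun m n => rfl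
  refine (QuotientAddGroup.eq_zero_iff z).1 ?_
  change q z = 0
  rw [← h, AddMonoidHom.comp_apply, hz, _root_.map_zero]

/-- `- ⊗ N` is right exact. -/
theorem mem_range_map_of_mkQ_right [Module Aᵐᵒᵖ M] [Module A N] [Module Aᵐᵒᵖ K]
    (i : K →ₗ[Aᵐᵒᵖ] M) {z : Tens A M N}
    (hz : map i.range.mkQ (LinearMap.id : N →ₗ[A] N) z = 0) :
    z ∈ (map i (LinearMap.id : N →ₗ[A] N)).range := by
  let S := (map i (LinearMap.id : N →ₗ[A] N)).range
  let q : Tens A M N →+ Tens A M N ⧸ S := QuotientAddGroup.mk' S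
  let φ (n : N) : M ⧸ i.range →+ Tens A M N ⧸ S :=
    QuotientAddGroup.lift i.range.toAddSubgroup (q.comp (mk.flip n)) (by
      rintro _ ⟨k, rfl⟩
      exact (QuotientAddGroup.eq_zero_iff _).2 ⟨tmul k n, rfl⟩)
  let p : Tens A (M ⧸ i.range) N →+ Tens A M N ⧸ S := lift
    (AddMonoidHom.mk' φ fun n n' => by
      ext m
      obtain ⟨m, rfl⟩ := i.range.mkQ_surjective m
      exact (congrArg q (tmul_add m n n')).trans (_root_.map_add q _ _)).flip
    (fun m a n => by
      obtain ⟨m, rfl⟩ := i.range.mkQ_surjective m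
      change q (tmul (op a • m) n) = q (tmul m (a • n))
      rw [smul_tmul])
  have h : p.comp (map i.range.mkQ LinearMap.id) = q := hom_ext fun m n => rfl
  refine (QuotientAddGroup.eq_zero_iff z).1 ?_
  change q z = 0
  rw [← h, AddMonoidHom.comp_apply, hz, _root_.map_zero]

/-- Over a von Neumann regular ring, `M ⊗ -` preserves equalizers. -/
theorem mem_range_map_id_left (hA : IsVonNeumannRegular A) [Module Aᵐᵒᵖ M] [Module A N]
    [Module A K] [Module A P] {i : K →ₗ[A] N} {f g : N →ₗ[A] P}
    (hi : i.range = f.eqLocus g) {z : Tens A M N}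
    (hz : map (LinearMap.id : M →ₗ[Aᵐᵒᵖ] M) f z = map (LinearMap.id : M →ₗ[Aᵐᵒᵖ] M) g z) :
    z ∈ (map (LinearMap.id : M →ₗ[Aᵐᵒᵖ] M) i).range := by
  have hker : i.range = (f - g).ker := by rw [hi, LinearMap.eqLocus_eq_ker_sub]
  refine mem_range_map_of_mkQ_left i (map_id_left_injective hA
    (LinearMap.ker_eq_bot.1 (i.range.ker_liftQ_eq_bot (f - g) hker.le hker.ge)) ?_)
  rw [map_map, LinearMap.id_comp, Submodule.liftQ_mkQ, map_sub_right, hz, sub_self, _root_.map_zero]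

/-- Over a von Neumann regular ring, `- ⊗ N` preserves equalizers. -/
theorem mem_range_map_id_right (hA : IsVonNeumannRegular A) [Module Aᵐᵒᵖ M] [Module A N]
    [Module Aᵐᵒᵖ K] [Module Aᵐᵒᵖ P] {i : K →ₗ[Aᵐᵒᵖ] M} {f g : M →ₗ[Aᵐᵒᵖ] P}
    (hi : i.range = f.eqLocus g) {z : Tens A M N}
    (hz : map f (LinearMap.id : N →ₗ[A] N) z = map g (LinearMap.id : N →ₗ[A] N) z) :
    z ∈ (map i (LinearMap.id : N →ₗ[A] N)).range := by
  have hker : i.range = (f - g).ker := by rw [hi, LinearMap.eqLocus_eq_ker_sub]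
  refine mem_range_map_of_mkQ_right i (map_id_right_injective hA
    (LinearMap.ker_eq_bot.1 (i.range.ker_liftQ_eq_bot (f - g) hker.le hker.ge)) ?_)
  rw [map_map, LinearMap.id_comp, Submodule.liftQ_mkQ, map_sub_left, hz, sub_self, _root_.map_zero]

end Tens

end Exact

/-! ### Linearity and naturality of the canonical maps -/

/-- The factorization of a linear map through an injective one whose range contains its values. -/
noncomputable def LinearMap.factorThrough {R X Y Z : Type u} [Ring R] [AddCommGroup X] [Module R X]
    [AddCommGroup Y] [Module R Y] [AddCommGroup Z] [Module R Z] (f : X →ₗ[R] Z) (i : Y →ₗ[R] Z)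
    (hi : Function.Injective i) (hf : ∀ x, f x ∈ i.range) : X →ₗ[R] Y :=
  (LinearEquiv.ofInjective i hi).symm.toLinearMap.comp (f.codRestrict i.range hf)

theorem LinearMap.factorThrough_spec {R X Y Z : Type u} [Ring R] [AddCommGroup X] [Module R X]
    [AddCommGroup Y] [Module R Y] [AddCommGroup Z] [Module R Z] (f : X →ₗ[R] Z) (i : Y →ₗ[R] Z)
    (hi : Function.Injective i) (hf : ∀ x, f x ∈ i.range) (x : X) :
    i (f.factorThrough i hi hf x) = f x :=
  congrArg Subtype.val ((LinearEquiv.ofInjective i hi).apply_symm_apply (f.codRestrict _ hf x))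

/-- The identity of a bimodule. -/
def BimodHom.id (A : Type u) [Ring A] (M : Type u) [AddCommGroup M] [Module A M]
    [Module Aᵐᵒᵖ M] : BimodHom A M M where
  toLinearMap := LinearMap.id
  map_op_smul' _ _ := rfl

/-- The composite of two homomorphisms of bimodules. -/
def BimodHom.comp {A : Type u} [Ring A] {M N P : Type u} [AddCommGroup M] [Module A M]
    [Module Aᵐᵒᵖ M] [AddCommGroup N] [Module A N] [Module Aᵐᵒᵖ N] [AddCommGroup P] [Module A P]
    [Module Aᵐᵒᵖ P] (g : BimodHom A N P) (f : BimodHom A M N) : BimodHom A M P where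
  toLinearMap := g.left.comp f.left
  map_op_smul' := (g.right.comp f.right).map_smul

namespace Tens

variable {A : Type u} [Ring A]

section

variable {L L' M M' N N' : Type u}
  [AddCommGroup L] [Module Aᵐᵒᵖ L] [AddCommGroup L'] [Module Aᵐᵒᵖ L']
  [AddCommGroup M] [Module A M] [Module Aᵐᵒᵖ M] [SMulCommClass A Aᵐᵒᵖ M]
  [AddCommGroup M'] [Module A M'] [Module Aᵐᵒᵖ M'] [SMulCommClass A Aᵐᵒᵖ M']
  [AddCommGroup N] [Module A N] [AddCommGroup N'] [Module A N']

theorem map_comp_left {L'' : Type u} [AddCommGroup L''] [Module Aᵐᵒᵖ L''] (f : L →ₗ[Aᵐᵒᵖ] L')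
    (f' : L' →ₗ[Aᵐᵒᵖ] L'') (x : Tens A L N) : map (f'.comp f) (LinearMap.id : N →ₗ[A] N) x =
      map f' LinearMap.id (map f LinearMap.id x) := by
  rw [map_map, LinearMap.id_comp]

theorem map_comp_right {N'' : Type u} [AddCommGroup N''] [Module A N''] (g : N →ₗ[A] N')
    (g' : N' →ₗ[A] N'') (x : Tens A L N) : map (LinearMap.id : L →ₗ[Aᵐᵒᵖ] L) (g'.comp g) x =
      map LinearMap.id g' (map LinearMap.id g x) := by
  rw [map_map, LinearMap.id_comp]

theorem map_id_map_left (f : L →ₗ[Aᵐᵒᵖ] L') (g : N →ₗ[A] N') (x : Tens A L N) :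
    map LinearMap.id g (map f LinearMap.id x) = map f g x := by
  rw [map_map, LinearMap.id_comp, LinearMap.comp_id]

theorem map_id_map_right (f : L →ₗ[Aᵐᵒᵖ] L') (g : N →ₗ[A] N') (x : Tens A L N) :
    map f LinearMap.id (map LinearMap.id g x) = map f g x := by
  rw [map_map, LinearMap.id_comp, LinearMap.comp_id]

theorem assoc_map (f : L →ₗ[Aᵐᵒᵖ] L') (g : BimodHom A M M') (h : N →ₗ[A] N')
    (x : Tens A (Tens A L M) N) : assoc (map (rmap f g) h x) = map f (lmap g h) (assoc x) := by
  have := assoc_naturality (LinearMap.id : Tens A L M →ₗ[Aᵐᵒᵖ] Tens A L M) f g h x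
  rwa [LinearMap.comp_id, map_id] at this

theorem assoc_symm_map (f : L →ₗ[Aᵐᵒᵖ] L') (g : BimodHom A M M') (h : N →ₗ[A] N')
    (x : Tens A L (Tens A M N)) :
    assoc.symm (map f (lmap g h) x) = map (rmap f g) h (assoc.symm x) := by
  rw [AddEquiv.symm_apply_eq, assoc_map, AddEquiv.apply_symm_apply]

/-- The associativity isomorphism, as an isomorphism of right modules. -/
def assocRight [Module Aᵐᵒᵖ N] [SMulCommClass A Aᵐᵒᵖ N] :
    Tens A (Tens A L M) N ≃ₗ[Aᵐᵒᵖ] Tens A L (Tens A M N) :=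
  { assoc with map_smul' := assoc_smul_right }

/-- The associativity isomorphism, as an isomorphism of left modules. -/
def assocLeft [Module A L] [SMulCommClass A Aᵐᵒᵖ L] :
    Tens A (Tens A L M) N ≃ₗ[A] Tens A L (Tens A M N) :=
  { assoc with map_smul' := assoc_smul_left }

theorem assoc_map_right (f : L →ₗ[Aᵐᵒᵖ] L') (x : Tens A (Tens A L M) N) :
    assoc (map (rmap f (BimodHom.id A M)) (LinearMap.id : N →ₗ[A] N) x) =
      map f LinearMap.id (assoc x) := by
  rw [assoc_map]
  exact congrArg (fun g => map f g (assoc x)) (LinearMap.ext fun y => map_id y)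

theorem assoc_map_left (h : N →ₗ[A] N') (x : Tens A (Tens A L M) N) :
    assoc (map (LinearMap.id : Tens A L M →ₗ[Aᵐᵒᵖ] Tens A L M) h x) =
      map LinearMap.id (lmap (BimodHom.id A M) h) (assoc x) := by
  rw [← assoc_map]
  exact congrArg (fun f => assoc (map f h x)) (LinearMap.ext fun y => (map_id y).symm)

theorem assoc_symm_map_right (f : L →ₗ[Aᵐᵒᵖ] L') (x : Tens A L (Tens A M N)) :
    assoc.symm (map f (LinearMap.id : Tens A M N →ₗ[A] Tens A M N) x) =
      map (rmap f (BimodHom.id A M)) LinearMap.id (assoc.symm x) := by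
  rw [AddEquiv.symm_apply_eq, assoc_map_right, AddEquiv.apply_symm_apply]

theorem assoc_symm_map_left (h : N →ₗ[A] N') (x : Tens A L (Tens A M N)) :
    assoc.symm (map (LinearMap.id : L →ₗ[Aᵐᵒᵖ] L) (lmap (BimodHom.id A M) h) x) =
      map LinearMap.id h (assoc.symm x) := by
  rw [AddEquiv.symm_apply_eq, assoc_map_left, AddEquiv.apply_symm_apply]

theorem assoc_symm_naturality {P : Type u} [AddCommGroup P] [Module A P]
    (r : P →ₗ[A] Tens A M N) (f : L →ₗ[Aᵐᵒᵖ] L') (g : BimodHom A M M') (h : N →ₗ[A] N')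
    (x : Tens A L P) :
    assoc.symm (map f ((lmap g h).comp r) x) =
      map (rmap f g) h (assoc.symm (map (LinearMap.id : L →ₗ[Aᵐᵒᵖ] L) r x)) := by
  rw [← assoc_symm_map, map_map, LinearMap.comp_id]

theorem rid_map (f : L →ₗ[Aᵐᵒᵖ] L') (x : Tens A L A) :
    rid L' (map f (LinearMap.id : A →ₗ[A] A) x) = f (rid L x) := by
  induction x using Tens.induction with
  | zero => simp
  | tmul l a => exact (f.map_smul (op a) l).symm
  | add x y hx hy => simp [hx, hy]

theorem lid_map (f : N →ₗ[A] N') (x : Tens A A N) :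
    lid N' (map (LinearMap.id : A →ₗ[Aᵐᵒᵖ] A) f x) = f (lid N x) := by
  induction x using Tens.induction with
  | zero => simp
  | tmul a n => exact (f.map_smul a n).symm
  | add x y hx hy => simp [hx, hy]

end

section Pentagon

variable {K L M N : Type u} [AddCommGroup K] [Module Aᵐᵒᵖ K]
  [AddCommGroup L] [Module A L] [Module Aᵐᵒᵖ L] [SMulCommClass A Aᵐᵒᵖ L]
  [AddCommGroup M] [Module A M] [Module Aᵐᵒᵖ M] [SMulCommClass A Aᵐᵒᵖ M]
  [AddCommGroup N] [Module A N]

theorem pentagon (x : Tens A (Tens A (Tens A K L) M) N) :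
    map LinearMap.id assocLeft.toLinearMap
      (assoc (map (assocRight : Tens A (Tens A K L) M ≃ₗ[Aᵐᵒᵖ] _).toLinearMap
        (LinearMap.id : N →ₗ[A] N) x)) = assoc (assoc x) := by
  induction x using Tens.induction with
  | zero => simp
  | add x y hx hy => simp only [_root_.map_add, hx, hy]
  | tmul x n =>
    induction x using Tens.induction with
    | zero => simp
    | add x y hx hy => simp only [add_tmul, _root_.map_add, hx, hy]
    | tmul x m =>
      induction x using Tens.induction with
      | zero => simp
      | add x y hx hy => simp only [add_tmul, _root_.map_add, hx, hy]
      | tmul k l => rfl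

theorem pentagon_symm (x : Tens A K (Tens A L (Tens A M N))) :
    map assocRight.symm.toLinearMap LinearMap.id
      (assoc.symm (map (LinearMap.id : K →ₗ[Aᵐᵒᵖ] K)
        (assocLeft : Tens A (Tens A L M) N ≃ₗ[A] _).symm.toLinearMap x)) =
      assoc.symm (assoc.symm x) := by
  induction x using Tens.induction with
  | zero => simp
  | add x y hx hy => simp only [_root_.map_add, hx, hy]
  | tmul k x =>
    induction x using Tens.induction with
    | zero => simp
    | add x y hx hy => simp only [tmul_add, _root_.map_add, hx, hy]
    | tmul l x =>
      induction x using Tens.induction with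
      | zero => simp
      | add x y hx hy => simp only [tmul_add, _root_.map_add, hx, hy]
      | tmul m n => rfl

end Pentagon

end Tens

/-! ### Contraction with the counit -/

namespace Coring

variable {A : Type u} [Ring A] (C : Coring A)

section Left

variable {X Y : Type u} [AddCommGroup X] [Module A X] [AddCommGroup Y] [Module A Y]

/-- The map `C ⊗ X → X`, `c ⊗ x ↦ ε(c) x`. -/
def counitLeft (X : Type u) [AddCommGroup X] [Module A X] : Tens A C X →ₗ[A] X where
  toFun z := Tens.lid X (Tens.map C.counit.right LinearMap.id z)
  map_add' y z := by rw [map_add, map_add]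
  map_smul' a z := by
    induction z using Tens.induction with
    | zero => simp
    | tmul c x =>
      change C.counit (a • c) • x = a • C.counit c • x
      rw [map_smul, ← mul_smul]; rfl
    | add y z hy hz => simp only [smul_add, map_add, hy, hz]

theorem counitLeft_apply (z : Tens A C X) :
    C.counitLeft X z = Tens.lid X (Tens.map C.counit.right LinearMap.id z) := rfl

@[simp] theorem counitLeft_tmul (c : C) (x : X) :
    C.counitLeft X (Tens.tmul c x) = C.counit c • x := rfl

theorem counitLeft_map (f : X →ₗ[A] Y) (z : Tens A C X) :
    C.counitLeft Y (Tens.map LinearMap.id f z) = f (C.counitLeft X z) := by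
  rw [counitLeft_apply, counitLeft_apply, ← Tens.lid_map, Tens.map_map, Tens.map_map,
    LinearMap.id_comp, LinearMap.id_comp, LinearMap.comp_id, LinearMap.comp_id]

/-- The map `C ⊗ X → X`, `c ⊗ x ↦ ε(c) x`, for a bimodule `X`. -/
def counitLeftBimod (X : Type u) [AddCommGroup X] [Module A X] [Module Aᵐᵒᵖ X]
    [SMulCommClass A Aᵐᵒᵖ X] : BimodHom A (Tens A C X) X where
  toLinearMap := C.counitLeft X
  map_op_smul' b z := by
    induction z using Tens.induction with
    | zero => exact (congrArg _ (smul_zero b)).trans (smul_zero b).symm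
    | tmul c x => exact smul_comm (C.counit c) b x
    | add y z hy hz =>
      change C.counitLeft X _ = b • C.counitLeft X _ at hy hz ⊢
      simp only [smul_add, map_add, hy, hz]

end Left

section Right

variable {X Y : Type u} [AddCommGroup X] [Module Aᵐᵒᵖ X] [AddCommGroup Y] [Module Aᵐᵒᵖ Y]

/-- The map `X ⊗ C → X`, `x ⊗ c ↦ x ε(c)`. -/
def counitRight (X : Type u) [AddCommGroup X] [Module Aᵐᵒᵖ X] : Tens A X C →ₗ[Aᵐᵒᵖ] X where
  toFun z := Tens.rid X (Tens.map LinearMap.id C.counit.left z)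
  map_add' y z := by rw [map_add, map_add]
  map_smul' b z := by
    induction z using Tens.induction with
    | zero => simp
    | tmul x c =>
      change op (C.counit (b • c)) • x = b • op (C.counit c) • x
      rw [← C.counit.right_apply, map_smul, ← mul_smul]; rfl
    | add y z hy hz => simp only [smul_add, map_add, hy, hz]

theorem counitRight_apply (z : Tens A X C) :
    C.counitRight X z = Tens.rid X (Tens.map LinearMap.id C.counit.left z) := rfl

@[simp] theorem counitRight_tmul (x : X) (c : C) :
    C.counitRight X (Tens.tmul x c) = op (C.counit c) • x := rfl

theorem counitRight_map (f : X →ₗ[Aᵐᵒᵖ] Y) (z : Tens A X C) :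
    C.counitRight Y (Tens.map f LinearMap.id z) = f (C.counitRight X z) := by
  rw [counitRight_apply, counitRight_apply, ← Tens.rid_map, Tens.map_map, Tens.map_map,
    LinearMap.id_comp, LinearMap.id_comp, LinearMap.comp_id, LinearMap.comp_id]

/-- The map `X ⊗ C → X`, `x ⊗ c ↦ x ε(c)`, for a bimodule `X`. -/
def counitRightBimod (X : Type u) [AddCommGroup X] [Module A X] [Module Aᵐᵒᵖ X]
    [SMulCommClass A Aᵐᵒᵖ X] : BimodHom A (Tens A X C) X where
  toFun := C.counitRight X
  map_add' := map_add _
  map_smul' a z := by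
    induction z using Tens.induction with
    | zero => simp
    | tmul x c => exact (smul_comm a (op (C.counit c)) x).symm
    | add y z hy hz => simp only [smul_add, map_add, hy, hz]
  map_op_smul' := (C.counitRight X).map_smul

end Right

section Contraction

variable {X Y : Type u} [AddCommGroup X] [Module Aᵐᵒᵖ X] [AddCommGroup Y] [Module A Y]

theorem map_counitRight_tmulLeft (x : X) (z : Tens A C Y) :
    Tens.map ((C.counitRight X).comp (Tens.tmulLeft x)) LinearMap.id z =
      Tens.tmul x (C.counitLeft Y z) := by
  induction z using Tens.induction with
  | zero => simp
  | add y z hy hz => simp only [map_add, Tens.tmul_add, hy, hz]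
  | tmul c y => exact Tens.smul_tmul x (C.counit c) y

theorem map_counitLeft_tmulRight (y : Y) (z : Tens A X C) :
    Tens.map LinearMap.id ((C.counitLeft Y).comp (Tens.tmulRight y)) z =
      Tens.tmul (C.counitRight X z) y := by
  induction z using Tens.induction with
  | zero => simp
  | add w z hw hz => simp only [map_add, Tens.add_tmul, hw, hz]
  | tmul x c => exact (Tens.smul_tmul x (C.counit c) y).symm

end Contraction

end Coring

/-! ### Right comodules -/

namespace RightComod

variable {A : Type u} [Ring A] {C : Coring A}

section Cofree

variable (C) {X Y : Type u} [AddCommGroup X] [Module Aᵐᵒᵖ X] [AddCommGroup Y] [Module Aᵐᵒᵖ Y]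

/-- A coring as a right comodule over itself. -/
abbrev regular : RightComod C where
  carrier := C
  coact := C.comul.right
  coassoc := C.coassoc
  counit := C.comul_counit

/-- The right coaction `x ⊗ c ↦ (x ⊗ c₁) ⊗ c₂` on `X ⊗ C`. -/
def cofreeCoact (X : Type u) [AddCommGroup X] [Module Aᵐᵒᵖ X] :
    Tens A X C →ₗ[Aᵐᵒᵖ] Tens A (Tens A X C) C :=
  Tens.assocRight.symm.toLinearMap.comp (Tens.rmap LinearMap.id C.comul)

theorem cofreeCoact_tmul (x : X) (c : C) : cofreeCoact C X (Tens.tmul x c) =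
    Tens.map (Tens.tmulLeft x) LinearMap.id (C.comul c) := rfl

theorem assoc_cofreeCoact (z : Tens A X C) :
    Tens.assoc (cofreeCoact C X z) = Tens.map LinearMap.id C.comul.left z :=
  Tens.assoc.apply_symm_apply _

/-- The cofree right comodule `X ⊗ C` on a right module `X`. -/
abbrev cofree (X : Type u) [AddCommGroup X] [Module Aᵐᵒᵖ X] : RightComod C where
  carrier := Tens A X C
  coact := cofreeCoact C X
  coassoc z := by
    induction z using Tens.induction with
    | zero => simp
    | add y z hy hz => simp only [map_add, hy, hz]
    | tmul x c =>
      have h : (cofreeCoact C X).comp (Tens.tmulLeft x) =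
        (Tens.rmap (Tens.tmulLeft x) (BimodHom.id A C)).comp C.comul.right := rfl
      rw [cofreeCoact_tmul, Tens.map_map, h, Tens.map_map, ← Tens.map_map C.comul.right
        LinearMap.id, Tens.assoc_map_right, C.coassoc, Tens.map_map]
      rfl
  counit z := by
    induction z using Tens.induction with
    | zero => simp
    | add y z hy hz => simp only [map_add, hy, hz]
    | tmul x c =>
      have := C.counitRight_map (Tens.tmulLeft x : C →ₗ[Aᵐᵒᵖ] Tens A X C) (C.comul c)
      exact this.trans (congrArg _ (C.comul_counit c))

variable {C}

/-- Colinearity of a map out of `X ⊗ C` can be tested on the maps `c ↦ x ⊗ c`. -/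
theorem colinear_of_tmul {P : RightComod C} (f : Tens A X C →ₗ[Aᵐᵒᵖ] P)
    (hf : ∀ (x : X) (c : C), P.coact (f (Tens.tmul x c)) =
      Tens.map (f.comp (Tens.tmulLeft x)) LinearMap.id (C.comul c)) (z : Tens A X C) :
    P.coact (f z) = Tens.map f (LinearMap.id : C →ₗ[A] C) (cofreeCoact C X z) := by
  induction z using Tens.induction with
  | zero => simp
  | add y z hy hz => simp only [map_add, hy, hz]
  | tmul x c => rw [hf, cofreeCoact_tmul, Tens.map_map, LinearMap.id_comp]

/-- A right linear map out of `X ⊗ C` that is colinear on each `x ⊗ C`, as a homomorphism out of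
the cofree comodule. -/
def cofreeLift {P : RightComod C} (f : Tens A X C →ₗ[Aᵐᵒᵖ] P)
    (hf : ∀ (x : X) (c : C), P.coact (f (Tens.tmul x c)) =
      Tens.map (f.comp (Tens.tmulLeft x)) LinearMap.id (C.comul c)) :
    Hom (cofree C X) P where
  hom := f
  colinear := colinear_of_tmul f hf

/-- The homomorphism `C → X ⊗ C`, `c ↦ x ⊗ c`, of right comodules. -/
def tmulHom (x : X) : regular C ⟶ cofree C X := Hom.mk (Tens.tmulLeft x) fun _ => rfl

variable (C) in
/-- The homomorphism `f ⊗ C` of cofree right comodules. -/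
def cofreeMap (f : X →ₗ[Aᵐᵒᵖ] Y) : cofree C X ⟶ cofree C Y :=
  cofreeLift (Tens.rmap f (BimodHom.id A C)) fun _ _ => rfl

/-- The coaction of a right comodule, as a homomorphism to the cofree comodule. -/
def coactHom (M : RightComod C) : M ⟶ cofree C M :=
  Hom.mk M.coact fun m => by
    change Tens.assoc.symm (Tens.map _ _ _) = _
    rw [AddEquiv.symm_apply_eq]
    exact (M.coassoc m).symm

theorem map_counitRight_cofreeCoact (z : Tens A X C) :
    Tens.map (C.counitRight X) LinearMap.id (cofreeCoact C X z) = z := by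
  induction z using Tens.induction with
  | zero => simp
  | add y z hy hz => simp only [map_add, hy, hz]
  | tmul x c =>
    rw [cofreeCoact_tmul, ← Tens.map_comp_left, C.map_counitRight_tmulLeft]
    exact congrArg _ (C.counit_comul c)

end Cofree

section Equalizer

variable {M P : RightComod C} (f g : Hom M P)

theorem coact_mem_range_map_subtype (hA : IsVonNeumannRegular A) (z : f.hom.eqLocus g.hom) :
    M.coact z ∈ (Tens.map (f.hom.eqLocus g.hom).subtype (LinearMap.id : C →ₗ[A] C)).range := by
  refine Tens.mem_range_map_id_right hA (Submodule.range_subtype _) ?_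
  rw [← f.colinear, ← g.colinear, z.2]

/-- The coaction on the equalizer of two homomorphisms of right comodules. It is a restriction of
the coaction of the source because `C` is flat. -/
noncomputable def equalizerCoact (hA : IsVonNeumannRegular A) :
    f.hom.eqLocus g.hom →ₗ[Aᵐᵒᵖ] Tens A (f.hom.eqLocus g.hom) C :=
  (M.coact.comp (f.hom.eqLocus g.hom).subtype).factorThrough
    (Tens.rmap (f.hom.eqLocus g.hom).subtype (BimodHom.id A C))
    (Tens.map_id_right_injective hA (Submodule.subtype_injective _))
    (coact_mem_range_map_subtype f g hA)

theorem map_equalizerCoact (hA : IsVonNeumannRegular A) (z : f.hom.eqLocus g.hom) :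
    Tens.map (f.hom.eqLocus g.hom).subtype LinearMap.id (equalizerCoact f g hA z) = M.coact z :=
  LinearMap.factorThrough_spec (M.coact.comp (f.hom.eqLocus g.hom).subtype)
    (Tens.rmap (f.hom.eqLocus g.hom).subtype (BimodHom.id A C)) _ _ z

/-- The equalizer of two homomorphisms of right comodules over a von Neumann regular ring. -/
noncomputable abbrev equalizer (hA : IsVonNeumannRegular A) : RightComod C where
  carrier := f.hom.eqLocus g.hom
  coact := equalizerCoact f g hA
  coassoc z := by
    let ι := (f.hom.eqLocus g.hom).subtype
    have h : (Tens.rmap ι (BimodHom.id A C)).comp (equalizerCoact f g hA) = M.coact.comp ι :=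
      LinearMap.ext (map_equalizerCoact f g hA)
    refine Tens.map_id_right_injective (g := ι) hA (Submodule.subtype_injective _) ?_
    rw [← Tens.assoc_map_right, ← Tens.map_comp_left, h, Tens.map_comp_left, map_equalizerCoact,
      M.coassoc, ← map_equalizerCoact f g hA, Tens.map_id_map_left, Tens.map_id_map_right]
  counit z := by
    refine Subtype.ext ((C.counitRight_map (f.hom.eqLocus g.hom).subtype _).symm.trans ?_)
    rw [map_equalizerCoact]
    exact M.counit z

/-- The inclusion of an equalizer of right comodules. -/
noncomputable def equalizerι (hA : IsVonNeumannRegular A) : Hom (equalizer f g hA) M where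
  hom := (f.hom.eqLocus g.hom).subtype
  colinear z := (map_equalizerCoact f g hA z).symm

/-- A homomorphism that equalizes `f` and `g` factors through their equalizer. -/
noncomputable def equalizerLift (hA : IsVonNeumannRegular A) {N : RightComod C} (k : Hom N M)
    (hk : ∀ n, f.hom (k.hom n) = g.hom (k.hom n)) : Hom N (equalizer f g hA) where
  hom := k.hom.codRestrict _ hk
  colinear n := by
    refine Tens.map_id_right_injective (g := (f.hom.eqLocus g.hom).subtype) hA
      (Submodule.subtype_injective _) ?_
    rw [map_equalizerCoact, ← Tens.map_comp_left]
    exact k.colinear n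

end Equalizer

end RightComod

/-! ### Left comodules -/

namespace LeftComod

variable {A : Type u} [Ring A] {C : Coring A}

section Cofree

variable (C) {X Y : Type u} [AddCommGroup X] [Module A X] [AddCommGroup Y] [Module A Y]

/-- A coring as a left comodule over itself. -/
abbrev regular : LeftComod C where
  carrier := C
  coact := C.comul.left
  coassoc := C.coassoc
  counit := C.counit_comul

/-- The left coaction `c ⊗ x ↦ c₁ ⊗ (c₂ ⊗ x)` on `C ⊗ X`. -/
def cofreeCoact (X : Type u) [AddCommGroup X] [Module A X] :
    Tens A C X →ₗ[A] Tens A C (Tens A C X) :=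
  Tens.assocLeft.toLinearMap.comp (Tens.lmap C.comul LinearMap.id)

theorem assoc_symm_cofreeCoact (z : Tens A C X) :
    Tens.assoc.symm (cofreeCoact C X z) = Tens.map C.comul.right LinearMap.id z :=
  Tens.assoc.symm_apply_apply _

theorem cofreeCoact_tmul (c : C) (x : X) : cofreeCoact C X (Tens.tmul c x) =
    Tens.map LinearMap.id (Tens.tmulRight x) (C.comul c) := rfl

/-- The cofree left comodule `C ⊗ X` on a left module `X`. -/
abbrev cofree (X : Type u) [AddCommGroup X] [Module A X] : LeftComod C where
  carrier := Tens A C X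
  coact := cofreeCoact C X
  coassoc z := by
    induction z using Tens.induction with
    | zero => simp
    | add y z hy hz => simp only [map_add, hy, hz]
    | tmul c x =>
      have h : (cofreeCoact C X).comp (Tens.tmulRight x) =
        (Tens.lmap (BimodHom.id A C) (Tens.tmulRight x)).comp C.comul.left := rfl
      rw [cofreeCoact_tmul, ← Tens.map_comp_right, h, Tens.map_comp_right, ← C.coassoc,
        ← Tens.assoc_map_left, Tens.map_id_map_left, Tens.map_id_map_right]
  counit z := by
    induction z using Tens.induction with
    | zero => simp
    | add y z hy hz => simp only [map_add, hy, hz]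
    | tmul c x =>
      have := C.counitLeft_map (Tens.tmulRight x : C →ₗ[A] Tens A C X) (C.comul c)
      exact this.trans (congrArg _ (C.counit_comul c))

variable {C}

/-- Colinearity of a map out of `C ⊗ X` can be tested on the maps `c ↦ c ⊗ x`. -/
theorem colinear_of_tmul {P : LeftComod C} (f : Tens A C X →ₗ[A] P)
    (hf : ∀ (c : C) (x : X), P.coact (f (Tens.tmul c x)) =
      Tens.map LinearMap.id (f.comp (Tens.tmulRight x)) (C.comul c)) (z : Tens A C X) :
    P.coact (f z) = Tens.map (LinearMap.id : C →ₗ[Aᵐᵒᵖ] C) f (cofreeCoact C X z) := by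
  induction z using Tens.induction with
  | zero => simp
  | add y z hy hz => simp only [map_add, hy, hz]
  | tmul c x => rw [hf, cofreeCoact_tmul, Tens.map_comp_right]

/-- A left linear map out of `C ⊗ X` that is colinear on each `C ⊗ x`, as a homomorphism out of
the cofree comodule. -/
def cofreeLift {P : LeftComod C} (f : Tens A C X →ₗ[A] P)
    (hf : ∀ (c : C) (x : X), P.coact (f (Tens.tmul c x)) =
      Tens.map LinearMap.id (f.comp (Tens.tmulRight x)) (C.comul c)) :
    Hom (cofree C X) P where
  hom := f
  colinear := colinear_of_tmul f hf

/-- The homomorphism `C → C ⊗ X`, `c ↦ c ⊗ x`, of left comodules. -/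
def tmulHom (x : X) : regular C ⟶ cofree C X := Hom.mk (Tens.tmulRight x) fun _ => rfl

variable (C) in
/-- The homomorphism `C ⊗ f` of cofree left comodules. -/
def cofreeMap (f : X →ₗ[A] Y) : cofree C X ⟶ cofree C Y :=
  cofreeLift (Tens.lmap (BimodHom.id A C) f) fun _ _ => rfl

/-- The coaction of a left comodule, as a homomorphism to the cofree comodule. -/
def coactHom (M : LeftComod C) : M ⟶ cofree C M := Hom.mk M.coact M.coassoc

theorem map_counitLeft_cofreeCoact (z : Tens A C X) :
    Tens.map LinearMap.id (C.counitLeft X) (cofreeCoact C X z) = z := by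
  induction z using Tens.induction with
  | zero => simp
  | add y z hy hz => simp only [map_add, hy, hz]
  | tmul c x =>
    rw [cofreeCoact_tmul, ← Tens.map_comp_right, C.map_counitLeft_tmulRight]
    exact congrArg (Tens.tmul · x) (C.comul_counit c)

end Cofree

section Equalizer

variable {M P : LeftComod C} (f g : Hom M P)

theorem coact_mem_range_map_subtype (hA : IsVonNeumannRegular A) (z : f.hom.eqLocus g.hom) :
    M.coact z ∈ (Tens.map (LinearMap.id : C →ₗ[Aᵐᵒᵖ] C) (f.hom.eqLocus g.hom).subtype).range := by
  refine Tens.mem_range_map_id_left hA (Submodule.range_subtype _) ?_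
  rw [← f.colinear, ← g.colinear, z.2]

/-- The coaction on the equalizer of two homomorphisms of left comodules. It is a restriction of
the coaction of the source because `C` is flat. -/
noncomputable def equalizerCoact (hA : IsVonNeumannRegular A) :
    f.hom.eqLocus g.hom →ₗ[A] Tens A C (f.hom.eqLocus g.hom) :=
  (M.coact.comp (f.hom.eqLocus g.hom).subtype).factorThrough
    (Tens.lmap (BimodHom.id A C) (f.hom.eqLocus g.hom).subtype)
    (Tens.map_id_left_injective hA (Submodule.subtype_injective _))
    (coact_mem_range_map_subtype f g hA)

theorem map_equalizerCoact (hA : IsVonNeumannRegular A) (z : f.hom.eqLocus g.hom) :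
    Tens.map LinearMap.id (f.hom.eqLocus g.hom).subtype (equalizerCoact f g hA z) = M.coact z :=
  LinearMap.factorThrough_spec (M.coact.comp (f.hom.eqLocus g.hom).subtype)
    (Tens.lmap (BimodHom.id A C) (f.hom.eqLocus g.hom).subtype) _ _ z

/-- The equalizer of two homomorphisms of left comodules over a von Neumann regular ring. -/
noncomputable abbrev equalizer (hA : IsVonNeumannRegular A) : LeftComod C where
  carrier := f.hom.eqLocus g.hom
  coact := equalizerCoact f g hA
  coassoc z := by
    let ι := (f.hom.eqLocus g.hom).subtype
    have h : (Tens.lmap (BimodHom.id A C) ι).comp (equalizerCoact f g hA) = M.coact.comp ι :=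
      LinearMap.ext (map_equalizerCoact f g hA)
    refine Tens.map_id_left_injective (g := Tens.lmap (BimodHom.id A C) ι) hA
      (Tens.map_id_left_injective hA (Submodule.subtype_injective _)) ?_
    rw [← Tens.assoc_map_left, ← Tens.map_comp_right, h, Tens.map_comp_right, map_equalizerCoact,
      ← M.coassoc, ← map_equalizerCoact f g hA, Tens.map_id_map_left, Tens.map_id_map_right]
  counit z := by
    refine Subtype.ext ((C.counitLeft_map (f.hom.eqLocus g.hom).subtype _).symm.trans ?_)
    rw [map_equalizerCoact]
    exact M.counit z

/-- The inclusion of an equalizer of left comodules. -/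
noncomputable def equalizerι (hA : IsVonNeumannRegular A) : Hom (equalizer f g hA) M where
  hom := (f.hom.eqLocus g.hom).subtype
  colinear z := (map_equalizerCoact f g hA z).symm

/-- A homomorphism that equalizes `f` and `g` factors through their equalizer. -/
noncomputable def equalizerLift (hA : IsVonNeumannRegular A) {N : LeftComod C} (k : Hom N M)
    (hk : ∀ n, f.hom (k.hom n) = g.hom (k.hom n)) : Hom N (equalizer f g hA) where
  hom := k.hom.codRestrict _ hk
  colinear n := by
    refine Tens.map_id_left_injective (g := (f.hom.eqLocus g.hom).subtype) hA
      (Submodule.subtype_injective _) ?_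
    rw [map_equalizerCoact, ← Tens.map_comp_right]
    exact k.colinear n

end Equalizer

end LeftComod

/-! ### The cotensor product as a right adjoint of corestriction, for right comodules -/

namespace CoringHom

variable {A : Type u} [Ring A] {C D : Coring A} (l : CoringHom C D)

theorem leftCoact_apply (c : C) :
    l.leftCoact c = Tens.map l.right LinearMap.id (C.comul c) := rfl

theorem rightCoact_apply (c : C) :
    l.rightCoact c = Tens.map LinearMap.id l.left (C.comul c) := rfl

theorem leftCoact_smul_right (b : Aᵐᵒᵖ) (c : C) : l.leftCoact (b • c) = b • l.leftCoact c := by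
  rw [leftCoact_apply, ← C.comul.right_apply, map_smul, Tens.map_smul_right _ _ fun _ _ => rfl]
  rfl

/-- The left `D`-coaction of `C` as a homomorphism of bimodules. -/
def leftCoactBimod : BimodHom A C (Tens A D C) where
  toLinearMap := l.leftCoact
  map_op_smul' := l.leftCoact_smul_right

section Right

open RightComod

variable (N : RightComod D)

/-- The homomorphism `n ⊗ c ↦ (n ⊗ l(c₁)) ⊗ c₂` of cofree right `C`-comodules. -/
def cofreeLeftCoact (X : Type u) [AddCommGroup X] [Module Aᵐᵒᵖ X] :
    RightComod.Hom (cofree C X) (cofree C (Tens A X D)) :=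
  cofreeLift (Tens.assocRight.symm.toLinearMap.comp (Tens.rmap LinearMap.id l.leftCoactBimod))
    fun x c => by
      have h : (Tens.assocRight.symm.toLinearMap.comp
          (Tens.rmap LinearMap.id l.leftCoactBimod)).comp (Tens.tmulLeft x) =
        (cofreeMap C ((Tens.tmulLeft x).comp l.right)).hom.comp C.comul.right :=
        LinearMap.ext fun c => (Tens.map_comp_left _ _ _).symm
      refine (congrArg (cofreeCoact C _) (DFunLike.congr_fun h c)).trans ?_
      rw [h, Tens.map_comp_left]
      exact ((cofreeMap C ((Tens.tmulLeft x).comp l.right)).colinear _).trans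
        (congrArg _ ((coactHom (regular C)).colinear c))

theorem assoc_cofreeLeftCoact {X : Type u} [AddCommGroup X] [Module Aᵐᵒᵖ X] (z : Tens A X C) :
    Tens.assoc ((l.cofreeLeftCoact X).hom z) = Tens.map LinearMap.id l.leftCoact z :=
  Tens.assoc.apply_symm_apply _

variable (hA : IsVonNeumannRegular A)

/-- The cotensor product `N □_D C` as a right `C`-comodule. -/
noncomputable abbrev rightCotensorObj : RightComod C :=
  equalizer (cofreeMap C N.coact) (l.cofreeLeftCoact N) hA

/-- The inclusion of `N □_D C` in `N ⊗ C`. -/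
noncomputable def rightCotensorIncl : l.rightCotensorObj N hA →ₗ[Aᵐᵒᵖ] Tens A N C :=
  (equalizerι _ _ hA).hom

theorem rightCotensorIncl_injective : Function.Injective (l.rightCotensorIncl N hA) :=
  Subtype.val_injective

variable {N}

theorem map_rightCotensorIncl_coact (z : l.rightCotensorObj N hA) :
    Tens.map (l.rightCotensorIncl N hA) LinearMap.id ((l.rightCotensorObj N hA).coact z) =
      cofreeCoact C N (l.rightCotensorIncl N hA z) :=
  map_equalizerCoact _ _ hA z

theorem mem_rightCotensor_iff {z : Tens A N C} :
    (cofreeMap C N.coact).hom z = (l.cofreeLeftCoact N).hom z ↔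
      Tens.assoc (Tens.map N.coact LinearMap.id z) = Tens.map LinearMap.id l.leftCoact z := by
  rw [← assoc_cofreeLeftCoact, EmbeddingLike.apply_eq_iff_eq]
  rfl

theorem assoc_map_rightCotensorIncl (z : l.rightCotensorObj N hA) :
    Tens.assoc (Tens.map N.coact LinearMap.id (l.rightCotensorIncl N hA z)) =
      Tens.map LinearMap.id l.leftCoact (l.rightCotensorIncl N hA z) :=
  l.mem_rightCotensor_iff.1 z.2

theorem map_mem_rightCotensor {N' : RightComod D} (f : N ⟶ N') (z : l.rightCotensorObj N hA) :
    (cofreeMap C N'.coact).hom (Tens.map f.hom LinearMap.id (l.rightCotensorIncl N hA z)) =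
      (l.cofreeLeftCoact N').hom
        (Tens.map f.hom LinearMap.id (l.rightCotensorIncl N hA z)) := by
  refine l.mem_rightCotensor_iff.2 ?_
  have h : N'.coact.comp f.hom = (Tens.rmap f.hom (BimodHom.id A D)).comp N.coact :=
    LinearMap.ext f.colinear
  rw [← Tens.map_comp_left, h, Tens.map_comp_left, Tens.assoc_map_right,
    assoc_map_rightCotensorIncl, Tens.map_id_map_left, Tens.map_id_map_right]

/-- The functor `- □_D C` from right `D`-comodules to right `C`-comodules. -/
noncomputable def rightCotensor : RightComod D ⥤ RightComod C where
  obj N := l.rightCotensorObj N hA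
  map {N N'} f := equalizerLift _ _ hA
    (CategoryStruct.comp (X := l.rightCotensorObj N hA) (Y := cofree C N) (Z := cofree C N')
      (equalizerι _ _ hA) (cofreeMap C f.hom))
    (l.map_mem_rightCotensor hA f)
  map_id _ := RightComod.Hom.ext (LinearMap.ext fun z => Subtype.ext (Tens.map_id z.1))
  map_comp f g := RightComod.Hom.ext (LinearMap.ext fun z => Subtype.ext
    (Tens.map_comp_left f.hom g.hom z.1))

/-- The coaction `M → M ⊗ C` of a right `C`-comodule takes values in `M □_D C`. -/
theorem assoc_map_corestrictRight (M : RightComod C) (m : M) :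
    Tens.assoc (Tens.map (l.corestrictRight M.coact) (LinearMap.id : C →ₗ[A] C) (M.coact m)) =
      Tens.map LinearMap.id l.leftCoact (M.coact m) := by
  rw [corestrictRight, Tens.assoc_naturality, M.coassoc, ← Tens.map_comp_right]
  rfl

theorem counitRight_cofreeLeftCoact {X : Type u} [AddCommGroup X] [Module Aᵐᵒᵖ X]
    (z : Tens A X C) :
    C.counitRight _ ((l.cofreeLeftCoact X).hom z) = Tens.map LinearMap.id l.left z := by
  induction z using Tens.induction with
  | zero => simp
  | add y z hy hz => simp only [map_add, hy, hz]
  | tmul x c =>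
    have h : (l.cofreeLeftCoact X).hom (Tens.tmul x c) =
      Tens.map (Tens.tmulLeft x) LinearMap.id (l.leftCoact c) := rfl
    rw [h, C.counitRight_map, leftCoact_apply, C.counitRight_map, Coring.counitRight_apply,
      C.comul_counit]
    rfl

theorem map_counitRight_coact (z : l.rightCotensorObj N hA) :
    Tens.map ((C.counitRight N).comp (l.rightCotensorIncl N hA)) LinearMap.id
      ((l.rightCotensorObj N hA).coact z) = l.rightCotensorIncl N hA z := by
  rw [Tens.map_comp_left, map_rightCotensorIncl_coact, map_counitRight_cofreeCoact]

theorem counitRight_colinear (z : l.rightCotensorObj N hA) :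
    N.coact (C.counitRight N (l.rightCotensorIncl N hA z)) =
      Tens.map ((C.counitRight N).comp (l.rightCotensorIncl N hA)) LinearMap.id
        (l.corestrictRight (l.rightCotensorObj N hA).coact z) := by
  have h : l.corestrictRight (l.rightCotensorObj N hA).coact z =
    Tens.map LinearMap.id l.left ((l.rightCotensorObj N hA).coact z) := rfl
  rw [h, Tens.map_id_map_right, ← Tens.map_id_map_left, map_counitRight_coact,
    ← C.counitRight_map, ← counitRight_cofreeLeftCoact,
    ← l.mem_rightCotensor_iff.2 (l.assoc_map_rightCotensorIncl hA z)]
  rfl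

/-- Corestriction along a morphism of corings over a von Neumann regular ring is left adjoint to
`- □_D C`. -/
noncomputable def rightAdjunction : l.rightCorestriction ⊣ l.rightCotensor hA :=
  Adjunction.mkOfUnitCounit
    { unit :=
        { app := fun M => equalizerLift _ _ hA (coactHom M) fun m =>
            l.mem_rightCotensor_iff.2 (l.assoc_map_corestrictRight M m)
          naturality := fun M M' f => RightComod.Hom.ext (LinearMap.ext fun m =>
            Subtype.ext (f.colinear m)) }
      counit :=
        { app := fun N => RightComod.Hom.mk ((C.counitRight N).comp (l.rightCotensorIncl N hA))
            (l.counitRight_colinear hA)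
          naturality := fun N N' f => RightComod.Hom.ext (LinearMap.ext fun z =>
            C.counitRight_map f.hom z.1) }
      left_triangle := by
        ext M
        exact RightComod.Hom.ext (LinearMap.ext fun m => M.counit m)
      right_triangle := by
        ext N
        exact RightComod.Hom.ext (LinearMap.ext fun z =>
          l.rightCotensorIncl_injective N hA (l.map_counitRight_coact hA z)) }

end Right

end CoringHom

/-! ### The cotensor product as a right adjoint of corestriction, for left comodules -/

namespace CoringHom

variable {A : Type u} [Ring A] {C D : Coring A} (l : CoringHom C D)

theorem rightCoact_smul_left (a : A) (c : C) : l.rightCoact (a • c) = a • l.rightCoact c := by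
  rw [rightCoact_apply, map_smul, Tens.map_smul_left _ fun _ _ => rfl]
  rfl

/-- The right `D`-coaction of `C` as a homomorphism of bimodules. -/
def rightCoactBimod : BimodHom A C (Tens A C D) where
  toFun := l.rightCoact
  map_add' := map_add _
  map_smul' := l.rightCoact_smul_left
  map_op_smul' := l.rightCoact.map_smul

section Left

open LeftComod

variable (N : LeftComod D)

/-- The homomorphism `c ⊗ n ↦ c₁ ⊗ (l(c₂) ⊗ n)` of cofree left `C`-comodules. -/
def cofreeRightCoact (X : Type u) [AddCommGroup X] [Module A X] :
    LeftComod.Hom (cofree C X) (cofree C (Tens A D X)) :=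
  cofreeLift (Tens.assocLeft.toLinearMap.comp (Tens.lmap l.rightCoactBimod LinearMap.id))
    fun c x => by
      have h : (Tens.assocLeft.toLinearMap.comp
          (Tens.lmap l.rightCoactBimod LinearMap.id)).comp (Tens.tmulRight x) =
        (cofreeMap C ((Tens.tmulRight x).comp l.left)).hom.comp C.comul.left :=
        LinearMap.ext fun c => (Tens.map_comp_right _ _ _).symm
      refine (congrArg (cofreeCoact C _) (DFunLike.congr_fun h c)).trans ?_
      rw [h, Tens.map_comp_right]
      exact ((cofreeMap C ((Tens.tmulRight x).comp l.left)).colinear _).trans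
        (congrArg _ ((coactHom (regular C)).colinear c))

theorem cofreeRightCoact_apply {X : Type u} [AddCommGroup X] [Module A X] (z : Tens A C X) :
    (l.cofreeRightCoact X).hom z = Tens.assoc (Tens.map l.rightCoact LinearMap.id z) := rfl

variable (hA : IsVonNeumannRegular A)

/-- The cotensor product `C □_D N` as a left `C`-comodule. -/
noncomputable abbrev leftCotensorObj : LeftComod C :=
  equalizer (l.cofreeRightCoact N) (cofreeMap C N.coact) hA

/-- The inclusion of `C □_D N` in `C ⊗ N`. -/
noncomputable def leftCotensorIncl : l.leftCotensorObj N hA →ₗ[A] Tens A C N :=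
  (equalizerι _ _ hA).hom

theorem leftCotensorIncl_injective : Function.Injective (l.leftCotensorIncl N hA) :=
  Subtype.val_injective

variable {N}

theorem map_leftCotensorIncl_coact (z : l.leftCotensorObj N hA) :
    Tens.map LinearMap.id (l.leftCotensorIncl N hA) ((l.leftCotensorObj N hA).coact z) =
      cofreeCoact C N (l.leftCotensorIncl N hA z) :=
  map_equalizerCoact _ _ hA z

theorem assoc_map_leftCotensorIncl (z : l.leftCotensorObj N hA) :
    Tens.assoc (Tens.map l.rightCoact LinearMap.id (l.leftCotensorIncl N hA z)) =
      Tens.map LinearMap.id N.coact (l.leftCotensorIncl N hA z) :=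
  z.2

theorem map_mem_leftCotensor {N' : LeftComod D} (f : N ⟶ N') (z : l.leftCotensorObj N hA) :
    (l.cofreeRightCoact N').hom (Tens.map LinearMap.id f.hom (l.leftCotensorIncl N hA z)) =
      (cofreeMap C N'.coact).hom
        (Tens.map LinearMap.id f.hom (l.leftCotensorIncl N hA z)) := by
  change _ = Tens.map LinearMap.id N'.coact _
  have h : N'.coact.comp f.hom = (Tens.lmap (BimodHom.id A D) f.hom).comp N.coact :=
    LinearMap.ext f.colinear
  rw [cofreeRightCoact_apply, ← Tens.map_comp_right, h, Tens.map_comp_right,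
    ← assoc_map_leftCotensorIncl, ← Tens.assoc_map_left, Tens.map_id_map_left,
    Tens.map_id_map_right]

/-- The functor `C □_D -` from left `D`-comodules to left `C`-comodules. -/
noncomputable def leftCotensor : LeftComod D ⥤ LeftComod C where
  obj N := l.leftCotensorObj N hA
  map {N N'} f := equalizerLift _ _ hA
    (CategoryStruct.comp (X := l.leftCotensorObj N hA) (Y := cofree C N) (Z := cofree C N')
      (equalizerι _ _ hA) (cofreeMap C f.hom))
    (l.map_mem_leftCotensor hA f)
  map_id _ := LeftComod.Hom.ext (LinearMap.ext fun z => Subtype.ext (Tens.map_id z.1))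
  map_comp f g := LeftComod.Hom.ext (LinearMap.ext fun z => Subtype.ext
    (Tens.map_comp_right f.hom g.hom z.1))

/-- The coaction `M → C ⊗ M` of a left `C`-comodule takes values in `C □_D M`. -/
theorem assoc_map_rightCoact_coact (M : LeftComod C) (m : M) :
    Tens.assoc (Tens.map l.rightCoact (LinearMap.id : M →ₗ[A] M) (M.coact m)) =
      Tens.map LinearMap.id (l.corestrictLeft M.coact) (M.coact m) := by
  rw [rightCoact, corestrictRight, Tens.assoc_naturality, M.coassoc, ← Tens.map_comp_right]
  rfl

theorem counitLeft_cofreeRightCoact {X : Type u} [AddCommGroup X] [Module A X]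
    (z : Tens A C X) :
    C.counitLeft _ ((l.cofreeRightCoact X).hom z) = Tens.map l.right LinearMap.id z := by
  induction z using Tens.induction with
  | zero => simp
  | add y z hy hz => simp only [map_add, hy, hz]
  | tmul c x =>
    have h : (l.cofreeRightCoact X).hom (Tens.tmul c x) =
      Tens.map LinearMap.id (Tens.tmulRight x) (l.rightCoact c) := rfl
    rw [h, C.counitLeft_map, rightCoact_apply, C.counitLeft_map, Coring.counitLeft_apply,
      C.counit_comul]
    rfl

theorem map_counitLeft_coact (z : l.leftCotensorObj N hA) :
    Tens.map LinearMap.id ((C.counitLeft N).comp (l.leftCotensorIncl N hA))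
      ((l.leftCotensorObj N hA).coact z) = l.leftCotensorIncl N hA z := by
  rw [Tens.map_comp_right, map_leftCotensorIncl_coact, map_counitLeft_cofreeCoact]

theorem counitLeft_colinear (z : l.leftCotensorObj N hA) :
    N.coact (C.counitLeft N (l.leftCotensorIncl N hA z)) =
      Tens.map LinearMap.id ((C.counitLeft N).comp (l.leftCotensorIncl N hA))
        (l.corestrictLeft (l.leftCotensorObj N hA).coact z) := by
  have h : l.corestrictLeft (l.leftCotensorObj N hA).coact z =
    Tens.map l.right LinearMap.id ((l.leftCotensorObj N hA).coact z) := rfl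
  rw [h, Tens.map_id_map_left, ← Tens.map_id_map_right, map_counitLeft_coact,
    ← C.counitLeft_map, ← assoc_map_leftCotensorIncl, ← cofreeRightCoact_apply,
    counitLeft_cofreeRightCoact]

/-- Corestriction along a morphism of corings over a von Neumann regular ring is left adjoint to
`C □_D -`. -/
noncomputable def leftAdjunction : l.leftCorestriction ⊣ l.leftCotensor hA :=
  Adjunction.mkOfUnitCounit
    { unit :=
        { app := fun M => equalizerLift _ _ hA (coactHom M) (l.assoc_map_rightCoact_coact M)
          naturality := fun M M' f => LeftComod.Hom.ext (LinearMap.ext fun m =>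
            Subtype.ext (f.colinear m)) }
      counit :=
        { app := fun N => LeftComod.Hom.mk ((C.counitLeft N).comp (l.leftCotensorIncl N hA))
            (l.counitLeft_colinear hA)
          naturality := fun N N' f => LeftComod.Hom.ext (LinearMap.ext fun z =>
            C.counitLeft_map f.hom z.1) }
      left_triangle := by
        ext M
        exact LeftComod.Hom.ext (LinearMap.ext fun m => M.counit m)
      right_triangle := by
        ext N
        exact LeftComod.Hom.ext (LinearMap.ext fun z =>
          l.leftCotensorIncl_injective N hA (l.map_counitLeft_coact hA z)) }

end Left

end CoringHom

/-! ### The coactions of `C □_D C` -/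

/-- Left multiplication on a coring, as an endomorphism of the right regular comodule. -/
def RightComod.smulHom {A : Type u} [Ring A] {C : Coring A} (a : A) :
    RightComod.regular C ⟶ RightComod.regular C :=
  Hom.mk (DistribSMul.toLinearMap Aᵐᵒᵖ C a) fun c => C.comul.left.map_smul a c

namespace CoringHom

variable {A : Type u} [Ring A] {C D : Coring A} (l : CoringHom C D)
  (hA : IsVonNeumannRegular A)

section CotensorSq

theorem mem_cotensorSq_iff_right {z : Tens A C C} : z ∈ l.cotensorSq ↔
    (RightComod.cofreeMap C l.rightCoact).hom z = (l.cofreeLeftCoact C).hom z :=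
  (mem_cotensor D l.rightCoact l.leftCoact z).trans
    (l.mem_rightCotensor_iff (N := l.rightCorestriction.obj (RightComod.regular C))).symm

/-- `C □_D C`, as the value at `C` of the functor `- □_D C`. -/
noncomputable def cotensorSqEquivRight : l.cotensorSq ≃ₗ[Aᵐᵒᵖ]
    l.rightCotensorObj (l.rightCorestriction.obj (RightComod.regular C)) hA where
  toFun x := ⟨x.1, l.mem_cotensorSq_iff_right.1 x.2⟩
  map_add' _ _ := rfl
  map_smul' _ _ := rfl
  invFun z := ⟨z.1, l.mem_cotensorSq_iff_right.2 z.2⟩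
  left_inv _ := rfl
  right_inv _ := rfl

/-- `C □_D C`, as the value at `C` of the functor `C □_D -`. -/
noncomputable def cotensorSqEquivLeft : l.cotensorSq ≃ₗ[A]
    l.leftCotensorObj (l.leftCorestriction.obj (LeftComod.regular C)) hA where
  toFun x := ⟨x.1, (mem_cotensor D _ _ _).1 x.2⟩
  map_add' _ _ := rfl
  map_smul' _ _ := rfl
  invFun z := ⟨z.1, (mem_cotensor D _ _ _).2 z.2⟩
  left_inv _ := rfl
  right_inv _ := rfl

/-- The right `C`-coaction of `C □_D C`. -/
noncomputable def cotensorSqRightCoact : l.cotensorSq →ₗ[Aᵐᵒᵖ] Tens A l.cotensorSq C :=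
  (Tens.rmap (l.cotensorSqEquivRight hA).symm.toLinearMap (BimodHom.id A C)).comp
    ((l.rightCotensorObj _ hA).coact.comp (l.cotensorSqEquivRight hA).toLinearMap)

theorem map_cotensorSqRightCoact (x : l.cotensorSq) :
    Tens.map (l.cotensorSqEquivRight hA).toLinearMap LinearMap.id (l.cotensorSqRightCoact hA x) =
      (l.rightCotensorObj _ hA).coact (l.cotensorSqEquivRight hA x) := by
  refine (Tens.map_comp_left _ _ _).symm.trans ?_
  rw [LinearEquiv.comp_symm]
  exact Tens.map_id _

theorem isCotensorRightCoaction_cotensorSqRightCoact :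
    l.IsCotensorRightCoaction (l.cotensorSqRightCoact hA) := fun x => by
  rw [← RightComod.assoc_cofreeCoact]
  refine congrArg Tens.assoc ?_
  refine (Tens.map_comp_left (l.cotensorSqEquivRight hA).toLinearMap
    (l.rightCotensorIncl _ hA) _).trans ?_
  rw [map_cotensorSqRightCoact]
  exact l.map_rightCotensorIncl_coact hA _

/-- The left `C`-coaction of `C □_D C`. -/
noncomputable def cotensorSqLeftCoact : l.cotensorSq →ₗ[A] Tens A C l.cotensorSq :=
  (Tens.lmap (BimodHom.id A C) (l.cotensorSqEquivLeft hA).symm.toLinearMap).comp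
    ((l.leftCotensorObj _ hA).coact.comp (l.cotensorSqEquivLeft hA).toLinearMap)

theorem map_cotensorSqLeftCoact (x : l.cotensorSq) :
    Tens.map LinearMap.id (l.cotensorSqEquivLeft hA).toLinearMap (l.cotensorSqLeftCoact hA x) =
      (l.leftCotensorObj _ hA).coact (l.cotensorSqEquivLeft hA x) := by
  refine (Tens.map_comp_right _ _ _).symm.trans ?_
  rw [LinearEquiv.comp_symm]
  exact Tens.map_id _

theorem isCotensorLeftCoaction_cotensorSqLeftCoact :
    l.IsCotensorLeftCoaction (l.cotensorSqLeftCoact hA) := fun x => by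
  refine (Tens.map_comp_right (l.cotensorSqEquivLeft hA).toLinearMap
    (l.leftCotensorIncl _ hA) _).trans ?_
  rw [map_cotensorSqLeftCoact]
  exact l.map_leftCotensorIncl_coact hA _

end CotensorSq

/-! ### From right Frobenius extensions to bicomodule homomorphisms -/

section RightUnit

open RightComod

variable {l hA} (η : 𝟭 (RightComod D) ⟶ l.rightCotensor hA ⋙ l.rightCorestriction)

/-- The components `N → N □_D C ⊆ N ⊗ C` of a natural transformation from the identity to
`- □_D C`. -/
noncomputable def rightUnitMap (N : RightComod D) : N →ₗ[Aᵐᵒᵖ] Tens A N C :=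
  (l.rightCotensorIncl N hA).comp (η.app N).hom

theorem rightUnitMap_hom {N N' : RightComod D} (f : N ⟶ N') (n : N) :
    rightUnitMap η N' (f.hom n) = Tens.map f.hom LinearMap.id (rightUnitMap η N n) :=
  congrArg (fun k : Hom N (l.rightCorestriction.obj (l.rightCotensorObj N' hA)) =>
    l.rightCotensorIncl N' hA (k.hom n)) (η.naturality f)

/-- The bimodule map `α : D → C` underlying a natural transformation `η` from the identity to
`- □_D C`: the component `D → D □_D C` at `D` followed by `d ⊗ c ↦ ε(d) c`. -/
noncomputable def rightUnitBimod : BimodHom A D C where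
  toFun d := D.counitLeft C (rightUnitMap η (regular D) d)
  map_add' d d' := by rw [map_add, map_add]
  map_smul' a d := by
    have h := rightUnitMap_hom η (smulHom a) d
    exact (congrArg (D.counitLeft C) h).trans ((D.counitLeft C).map_smul a _)
  map_op_smul' b d := by
    change (D.counitLeftBimod C).right _ = b • (D.counitLeftBimod C).right _
    rw [map_smul, map_smul]

/-- A natural transformation from the identity to `- □_D C` is determined by its component at `D`:
it is `n ↦ n₀ ⊗ α(n₁)`. -/
theorem rightUnitMap_eq (N : RightComod D) (n : N) :
    rightUnitMap η N n = Tens.map LinearMap.id (rightUnitBimod η).left (N.coact n) := by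
  have h (y : Tens A N D) : Tens.map (D.counitRight N) LinearMap.id
      (rightUnitMap η (cofree D N) y) = Tens.map LinearMap.id (rightUnitBimod η).left y := by
    induction y using Tens.induction with
    | zero => simp
    | add y z hy hz => simp only [map_add, hy, hz]
    | tmul n d =>
      have := rightUnitMap_hom η (tmulHom (C := D) n) d
      refine (congrArg _ this).trans ?_
      refine (Tens.map_comp_left _ _ _).symm.trans ?_
      exact D.map_counitRight_tmulLeft n _
  have h' : (D.counitRight N).comp N.coact = LinearMap.id := LinearMap.ext N.counit
  rw [← h]
  refine Eq.trans ?_ (congrArg _ (rightUnitMap_hom η (coactHom N) n)).symm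
  refine Eq.trans ?_ (Tens.map_comp_left _ _ _)
  change _ = Tens.map ((D.counitRight N).comp N.coact) LinearMap.id _
  rw [h', Tens.map_id]

theorem map_counitLeft_cofreeCoact (z : Tens A D C) :
    Tens.map (D.counitLeftBimod C).right LinearMap.id (cofreeCoact C D z) =
      C.comul (D.counitLeft C z) := by
  induction z using Tens.induction with
  | zero => simp
  | add y z hy hz => simp only [map_add, hy, hz]
  | tmul d c =>
    rw [cofreeCoact_tmul, ← Tens.map_comp_left, Coring.counitLeft_tmul, map_smul]
    rfl

/-- The homomorphism `D □_D C → C`, `d ⊗ c ↦ ε(d) c`, of right `C`-comodules. -/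
noncomputable def counitRightCotensor (l : CoringHom C D) (hA : IsVonNeumannRegular A) :
    (l.rightCotensor hA).obj (regular D) ⟶ regular C :=
  RightComod.Hom.mk ((D.counitLeftBimod C).right.comp (l.rightCotensorIncl (regular D) hA))
    fun z => by
      refine (map_counitLeft_cofreeCoact _).symm.trans ?_
      refine Eq.trans ?_ (Tens.map_comp_left _ _ _).symm
      exact congrArg _ (l.map_rightCotensorIncl_coact hA z).symm

theorem rightUnitBimod_right_colinear (d : D) : l.rightCoact (rightUnitBimod η d) =
    Tens.map (rightUnitBimod η).right LinearMap.id (D.comul d) :=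
  (η.app (regular D) ≫ l.rightCorestriction.map (counitRightCotensor l hA)).colinear d

theorem rightUnitBimod_left_colinear (d : D) : l.leftCoact (rightUnitBimod η d) =
    Tens.map LinearMap.id (rightUnitBimod η).left (D.comul d) := by
  have h := l.assoc_map_rightCotensorIncl hA (N := regular D) ((η.app (regular D)).hom d)
  have h' := congrArg (D.counitLeft (Tens A D C)) h
  rw [D.counitLeft_map] at h'
  refine h'.symm.trans (Eq.trans ?_ (rightUnitMap_eq η (regular D) d))
  exact (LeftComod.cofree D C).counit _

/-- The homomorphism of `D`-bicomodules `D → C` given by a natural transformation from the identity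
to `- □_D C`. -/
noncomputable def rightUnitHomDC : l.HomDC where
  toBimodHom := rightUnitBimod η
  right_colinear := rightUnitBimod_right_colinear η
  left_colinear := rightUnitBimod_left_colinear η

end RightUnit

section RightCounit

open RightComod

variable {l hA} (ε : l.rightCorestriction ⋙ l.rightCotensor hA ⟶ 𝟭 (RightComod C))

theorem rightCounit_hom {M M' : RightComod C} (f : M ⟶ M')
    (z : l.rightCotensorObj (l.rightCorestriction.obj M) hA) :
    (ε.app M').hom (((l.rightCotensor hA).map (l.rightCorestriction.map f)).hom z) =
      f.hom ((ε.app M).hom z) :=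
  congrArg (fun k : Hom (l.rightCotensorObj (l.rightCorestriction.obj M) hA) M' => k.hom z)
    (ε.naturality f)

/-- The bimodule map `β : C □_D C → C` underlying a natural transformation `ε` from `- □_D C` to
the identity: its component at `C`. -/
noncomputable def rightCounitBimod : BimodHom A l.cotensorSq C where
  toFun x := (ε.app (regular C)).hom (l.cotensorSqEquivRight hA x)
  map_add' x y := by rw [map_add]; exact map_add _ _ _
  map_smul' a x := rightCounit_hom ε (smulHom a) (l.cotensorSqEquivRight hA x)
  map_op_smul' b x :=
    (congrArg (ε.app (regular C)).hom ((l.cotensorSqEquivRight hA).map_smul b x)).trans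
      ((ε.app (regular C)).hom.map_smul b _)

/-- A natural transformation `- □_D C → 1` is, at a cofree comodule `X ⊗ C`, the map
`X ⊗ β : X ⊗ (C □_D C) → X ⊗ C`. -/
theorem rightCounit_cofree {X : Type u} [AddCommGroup X] [Module Aᵐᵒᵖ X]
    (w : Tens A X l.cotensorSq)
    (z : l.rightCotensorObj (l.rightCorestriction.obj (cofree C X)) hA)
    (h : Tens.assoc (l.rightCotensorIncl _ hA z) =
      Tens.map (LinearMap.id : X →ₗ[Aᵐᵒᵖ] X) l.cotensorIncl.left w) :
    (ε.app (cofree C X)).hom z = Tens.map LinearMap.id (rightCounitBimod ε).left w := by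
  obtain ⟨z', hz', hε⟩ : ∃ z' : l.rightCotensorObj (l.rightCorestriction.obj (cofree C X)) hA,
      Tens.assoc (l.rightCotensorIncl _ hA z') =
        Tens.map (LinearMap.id : X →ₗ[Aᵐᵒᵖ] X) l.cotensorIncl.left w ∧
      (ε.app (cofree C X)).hom z' = Tens.map LinearMap.id (rightCounitBimod ε).left w := by
    clear h
    induction w using Tens.induction with
    | zero => exact ⟨0, (congrArg _ (map_zero _)).trans (map_zero _), map_zero _⟩
    | add v w hv hw =>
      obtain ⟨y, hy, hy'⟩ := hv
      obtain ⟨z, hz, hz'⟩ := hw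
      refine ⟨y + z, ?_, ?_⟩
      · rw [map_add, map_add, ← hy, ← hz]
        exact map_add Tens.assoc _ _
      · rw [map_add, ← hy', ← hz']; exact map_add _ y z
    | tmul x y =>
      refine ⟨((l.rightCotensor hA).map (l.rightCorestriction.map (tmulHom x))).hom
        (l.cotensorSqEquivRight hA y), ?_, rightCounit_hom ε (tmulHom x) _⟩
      change Tens.assoc (Tens.map (Tens.tmulLeft x) LinearMap.id y.1) = Tens.tmul x y.1
      exact Tens.assoc.apply_symm_apply (Tens.tmul x y.1)
  have : z = z' := l.rightCotensorIncl_injective _ hA (Tens.assoc.injective (h.trans hz'.symm))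
  rw [this, hε]

/-- The homomorphism of `C`-bicomodules `C □_D C → C` given by a natural transformation from
`- □_D C` to the identity. -/
noncomputable def rightCounitHomCotensorC : l.HomCotensorC where
  toBimodHom := rightCounitBimod ε
  right_colinear := ⟨l.cotensorSqRightCoact hA, l.isCotensorRightCoaction_cotensorSqRightCoact hA,
    fun x => by
      refine ((ε.app (regular C)).colinear (l.cotensorSqEquivRight hA x)).trans ?_
      refine (congrArg _ (l.map_cotensorSqRightCoact hA x).symm).trans ?_
      exact (Tens.map_comp_left _ _ _).symm⟩
  left_colinear := ⟨l.cotensorSqLeftCoact hA, l.isCotensorLeftCoaction_cotensorSqLeftCoact hA,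
    fun x => by
      refine (rightCounit_hom ε (coactHom (regular C)) (l.cotensorSqEquivRight hA x)).symm.trans ?_
      exact rightCounit_cofree ε _ _ (l.isCotensorLeftCoaction_cotensorSqLeftCoact hA x).symm⟩

end RightCounit

section RightTriangle

open RightComod

variable {l hA} (adj : l.rightCotensor hA ⊣ l.rightCorestriction)

theorem rightCounit_insertRight (c : C) :
    rightCounitBimod adj.counit ((rightUnitHomDC adj.unit).insertRight c) = c := by
  have h := congrArg (fun k : Hom (l.rightCorestriction.obj (regular C))
    (l.rightCorestriction.obj (regular C)) => k.hom c)
    (adj.right_triangle_components (regular C))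
  refine Eq.trans (congrArg (adj.counit.app (regular C)).hom ?_) h
  refine l.rightCotensorIncl_injective _ hA ?_
  refine Eq.trans ?_ (rightUnitMap_eq adj.unit (l.rightCorestriction.obj (regular C)) c).symm
  exact Tens.map_comp_right l.left (rightUnitBimod adj.unit).left (C.comul c)

theorem rightCounit_insertLeft (c : C) :
    rightCounitBimod adj.counit ((rightUnitHomDC adj.unit).insertLeft c) = c := by
  let z : l.rightCotensorObj (regular D) hA :=
    ⟨l.leftCoact c, l.mem_rightCotensor_iff.2
      ((l.leftCorestriction.obj (LeftComod.regular C)).coassoc c)⟩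
  have hz : (counitRightCotensor l hA).hom z = c :=
    (l.leftCorestriction.obj (LeftComod.regular C)).counit c
  have h := congrArg (fun k : Hom (l.rightCotensorObj (regular D) hA)
    (l.rightCotensorObj (regular D) hA) => (counitRightCotensor l hA).hom (k.hom z))
    (adj.left_triangle_components (regular D))
  refine Eq.trans ?_ (h.trans hz)
  refine Eq.trans ?_ (rightCounit_hom adj.counit (counitRightCotensor l hA)
    (((l.rightCotensor hA).map (adj.unit.app (regular D))).hom z))
  refine congrArg (adj.counit.app (regular C)).hom (l.rightCotensorIncl_injective _ hA ?_)
  refine (Tens.map_comp_left l.right (rightUnitBimod adj.unit).right (C.comul c)).trans ?_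
  exact Tens.map_comp_left (adj.unit.app (regular D)).hom (counitRightCotensor l hA).hom
    (l.leftCoact c)

end RightTriangle

end CoringHom

/-! ### From bicomodule homomorphisms to right Frobenius extensions -/

/-- Coassociativity of a right comodule, after tensoring with a left module `N`. -/
theorem RightComod.map_cofreeCoact_assoc {A : Type u} [Ring A] {C : Coring A} (M : RightComod C)
    {N : Type u} [AddCommGroup N] [Module A N] (y : Tens A M N) :
    Tens.map LinearMap.id (LeftComod.cofreeCoact C N)
        (Tens.assoc (Tens.map M.coact LinearMap.id y)) =
      Tens.assoc (Tens.map M.coact LinearMap.id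
        (Tens.assoc (Tens.map M.coact LinearMap.id y))) := by
  induction y using Tens.induction with
  | zero => simp
  | add x y hx hy => simp only [map_add, hx, hy]
  | tmul m n =>
    have h : (LeftComod.cofreeCoact C N).comp (Tens.tmulRight n) =
      (Tens.lmap (BimodHom.id A C) (Tens.tmulRight n)).comp C.comul.left := rfl
    change Tens.map LinearMap.id (LeftComod.cofreeCoact C N)
        (Tens.map LinearMap.id (Tens.tmulRight n) (M.coact m)) =
      Tens.assoc (Tens.map M.coact LinearMap.id
        (Tens.map LinearMap.id (Tens.tmulRight n) (M.coact m)))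
    rw [← Tens.map_comp_right, h, Tens.map_comp_right, ← M.coassoc, ← Tens.assoc_map_left,
      Tens.map_id_map_left, Tens.map_id_map_right]

namespace CoringHom

variable {A : Type u} [Ring A] {C D : Coring A} {l : CoringHom C D}
  {hA : IsVonNeumannRegular A}

section InsertBimod

variable (α : l.HomDC)

/-- The map `c ↦ α(l(c₁)) ⊗ c₂` from `C` to `C □_D C`, as a homomorphism of bimodules. -/
def HomDC.insertLeftBimod : BimodHom A C l.cotensorSq where
  toFun := α.insertLeft
  map_add' c c' := Subtype.ext
    (map_add ((Tens.lmap (α.toBimodHom.comp l.toBimodHom) LinearMap.id).comp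
      C.comul.left) c c')
  map_smul' a c := Subtype.ext
    (map_smul ((Tens.lmap (α.toBimodHom.comp l.toBimodHom) LinearMap.id).comp
      C.comul.left) a c)
  map_op_smul' b c := Subtype.ext
    (map_smul ((Tens.rmap (α.right.comp l.right) (BimodHom.id A C)).comp C.comul.right) b c)

/-- The map `c ↦ c₁ ⊗ α(l(c₂))` from `C` to `C □_D C`, as a homomorphism of bimodules. -/
def HomDC.insertRightBimod : BimodHom A C l.cotensorSq where
  toFun := α.insertRight
  map_add' c c' := Subtype.ext
    (map_add ((Tens.lmap (BimodHom.id A C) (α.left.comp l.left)).comp C.comul.left) c c')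
  map_smul' a c := Subtype.ext
    (map_smul ((Tens.lmap (BimodHom.id A C) (α.left.comp l.left)).comp C.comul.left) a c)
  map_op_smul' b c := Subtype.ext
    (map_smul ((Tens.rmap LinearMap.id (α.toBimodHom.comp l.toBimodHom)).comp
      C.comul.right) b c)

end InsertBimod

section UnitOfHom

open RightComod

variable (hA) (α : l.HomDC)

theorem HomDC.map_mem_rightCotensor (N : RightComod D) (n : N) :
    (cofreeMap C N.coact).hom (Tens.map LinearMap.id α.left (N.coact n)) =
      (l.cofreeLeftCoact N).hom (Tens.map LinearMap.id α.left (N.coact n)) := by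
  refine l.mem_rightCotensor_iff.2 ?_
  have h : l.leftCoact.comp α.left = (Tens.lmap (BimodHom.id A D) α.left).comp D.comul.left :=
    LinearMap.ext α.left_colinear
  rw [← Tens.map_comp_right, h, Tens.map_comp_right, ← N.coassoc, ← Tens.assoc_map_left,
    Tens.map_id_map_left, Tens.map_id_map_right]

/-- The map `N → N □_D C`, `n ↦ n₀ ⊗ α(n₁)`. -/
noncomputable def HomDC.rightUnitLinear (N : RightComod D) :
    N →ₗ[Aᵐᵒᵖ] l.rightCotensorObj N hA :=
  ((Tens.rmap LinearMap.id α.toBimodHom).comp N.coact).codRestrict _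
    (α.map_mem_rightCotensor N)

theorem HomDC.rightCotensorIncl_rightUnitLinear (N : RightComod D) (n : N) :
    l.rightCotensorIncl N hA (α.rightUnitLinear hA N n) =
      Tens.map LinearMap.id α.left (N.coact n) := rfl

theorem HomDC.rightUnitLinear_colinear (N : RightComod D) (n : N) :
    l.corestrictRight (l.rightCotensorObj N hA).coact (α.rightUnitLinear hA N n) =
      Tens.map (α.rightUnitLinear hA N) LinearMap.id (N.coact n) := by
  refine Tens.map_id_right_injective hA (l.rightCotensorIncl_injective N hA)
    (Tens.assoc.injective ?_)
  have h : (l.rightCotensorIncl N hA).comp (α.rightUnitLinear hA N) =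
    (Tens.rmap LinearMap.id α.toBimodHom).comp N.coact := rfl
  have h' : l.rightCoactBimod.left.comp α.left = (Tens.lmap α.toBimodHom LinearMap.id).comp
    D.comul.left := LinearMap.ext α.right_colinear
  have h'' : l.rightCoactBimod.left =
    (Tens.lmap (BimodHom.id A C) l.left).comp C.comul.left := rfl
  rw [← Tens.map_comp_left, h, Tens.assoc_naturality, N.coassoc, ← Tens.map_comp_right, ← h',
    Tens.map_comp_right, ← rightCotensorIncl_rightUnitLinear hA, h'', Tens.map_comp_right,
    ← RightComod.assoc_cofreeCoact, ← Tens.assoc_map_left, ← map_rightCotensorIncl_coact,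
    Tens.map_id_map_left, corestrictRight]
  exact congrArg _ (Tens.map_id_map_right _ _ _)

/-- The natural transformation `n ↦ n₀ ⊗ α(n₁)` from the identity to `- □_D C`. -/
noncomputable def HomDC.rightUnit :
    𝟭 (RightComod D) ⟶ l.rightCotensor hA ⋙ l.rightCorestriction where
  app N := RightComod.Hom.mk (α.rightUnitLinear hA N) (α.rightUnitLinear_colinear hA N)
  naturality N N' f := by
    refine RightComod.Hom.ext (LinearMap.ext fun n => l.rightCotensorIncl_injective N' hA ?_)
    change Tens.map LinearMap.id α.left (N'.coact (f.hom n)) =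
      Tens.map f.hom LinearMap.id (Tens.map LinearMap.id α.left (N.coact n))
    rw [f.colinear, Tens.map_id_map_left, Tens.map_id_map_right]

end UnitOfHom

section CounitOfHom

open RightComod

variable (l) in
/-- The inclusion of `M □_D C` in `M ⊗ C` for a right `C`-comodule `M`. -/
noncomputable def rightResCotensorIncl (hA : IsVonNeumannRegular A) (M : RightComod C) :
    l.rightCotensorObj (l.rightCorestriction.obj M) hA →ₗ[Aᵐᵒᵖ] Tens A M C :=
  l.rightCotensorIncl (l.rightCorestriction.obj M) hA

theorem assoc_map_rightResCotensorIncl (M : RightComod C)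
    (z : l.rightCotensorObj (l.rightCorestriction.obj M) hA) :
    Tens.assoc (Tens.map (l.corestrictRight M.coact) LinearMap.id
      (l.rightResCotensorIncl hA M z)) =
        Tens.map LinearMap.id l.leftCoact (l.rightResCotensorIncl hA M z) :=
  l.assoc_map_rightCotensorIncl hA z

theorem map_rightResCotensorIncl_coact (M : RightComod C)
    (z : l.rightCotensorObj (l.rightCorestriction.obj M) hA) :
    Tens.map (l.rightResCotensorIncl hA M) LinearMap.id ((l.rightCotensorObj _ hA).coact z) =
      cofreeCoact C M (l.rightResCotensorIncl hA M z) :=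
  l.map_rightCotensorIncl_coact hA z

theorem range_cotensorIncl : l.cotensorIncl.left.range =
    (Tens.assocLeft.toLinearMap.comp (Tens.lmap l.rightCoactBimod LinearMap.id)).eqLocus
      (Tens.lmap (BimodHom.id A C) l.leftCoact) := by
  refine (Submodule.range_subtype _).trans (Submodule.ext fun x => ?_)
  exact mem_cotensor D l.rightCoact l.leftCoact x

theorem assoc_map_coact_mem_range (M : RightComod C)
    (z : l.rightCotensorObj (l.rightCorestriction.obj M) hA) :
    Tens.assoc (Tens.map M.coact LinearMap.id (l.rightResCotensorIncl hA M z)) ∈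
      (Tens.map (LinearMap.id : M →ₗ[Aᵐᵒᵖ] M) l.cotensorIncl.left).range := by
  refine Tens.mem_range_map_id_left hA range_cotensorIncl ?_
  have h : Tens.assocLeft.toLinearMap.comp (Tens.lmap l.rightCoactBimod LinearMap.id) =
      (Tens.lmap (BimodHom.id A C) (Tens.lmap l.toBimodHom LinearMap.id)).comp
        (LeftComod.cofreeCoact C C) :=
    LinearMap.ext fun x => Tens.assoc_naturality C.comul.right LinearMap.id l.toBimodHom
      LinearMap.id x
  have h' (y : Tens A M C) : Tens.map LinearMap.id (Tens.lmap l.toBimodHom LinearMap.id)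
      (Tens.assoc (Tens.map M.coact LinearMap.id y)) =
        Tens.assoc (Tens.map (l.corestrictRight M.coact) LinearMap.id y) :=
    (Tens.assoc_naturality M.coact LinearMap.id l.toBimodHom LinearMap.id y).symm
  rw [h, Tens.map_comp_right, M.map_cofreeCoact_assoc, ← Tens.assoc_map_left, Tens.map_id_map_left,
    ← Tens.map_id_map_right, h', assoc_map_rightResCotensorIncl, ← Tens.assoc_map_left,
    Tens.map_id_map_left, Tens.map_id_map_right]

theorem map_cotensorIncl_injective (hA : IsVonNeumannRegular A) (M : Type u) [AddCommGroup M]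
    [Module Aᵐᵒᵖ M] :
    Function.Injective (Tens.map (LinearMap.id : M →ₗ[Aᵐᵒᵖ] M) l.cotensorIncl.left) :=
  Tens.map_id_left_injective hA (Submodule.subtype_injective _)

theorem IsCotensorRightCoaction.map_smul_left (hA : IsVonNeumannRegular A)
    {r : l.cotensorSq →ₗ[Aᵐᵒᵖ] Tens A l.cotensorSq C} (hr : l.IsCotensorRightCoaction r) (a : A)
    (x : l.cotensorSq) : r (a • x) = a • r x := by
  refine Tens.map_id_right_injective (g := l.cotensorIncl.right) hA (Submodule.subtype_injective _)
    (Tens.assoc.injective ?_)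
  rw [Tens.map_smul_left _ l.cotensorIncl.left.map_smul, Tens.assoc_smul_left, hr, hr]
  exact Tens.map_smul_left _ (fun _ _ => rfl) _ a x.1

/-- A right `C`-coaction on `C □_D C`, as a homomorphism of bimodules. -/
def IsCotensorRightCoaction.bimodHom (hA : IsVonNeumannRegular A)
    {r : l.cotensorSq →ₗ[Aᵐᵒᵖ] Tens A l.cotensorSq C} (hr : l.IsCotensorRightCoaction r) :
    BimodHom A l.cotensorSq (Tens A l.cotensorSq C) where
  toFun := r
  map_add' := map_add r
  map_smul' := hr.map_smul_left hA
  map_op_smul' := r.map_smul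

variable (l hA)

/-- The coaction `m ⊗ c ↦ m₀ ⊗ (m₁ ⊗ c)`, as a map `M □_D C → M ⊗ (C □_D C)`. -/
noncomputable def rightCoactCotensor (M : RightComod C) :
    l.rightCotensorObj (l.rightCorestriction.obj M) hA →ₗ[Aᵐᵒᵖ] Tens A M l.cotensorSq :=
  LinearMap.factorThrough
    ((Tens.assocRight.toLinearMap.comp (Tens.rmap M.coact (BimodHom.id A C))).comp
      (l.rightResCotensorIncl hA M))
    (Tens.rmap LinearMap.id l.cotensorIncl)
    (Tens.map_id_left_injective hA (Submodule.subtype_injective _))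
    (assoc_map_coact_mem_range M)

theorem map_rightCoactCotensor (M : RightComod C)
    (z : l.rightCotensorObj (l.rightCorestriction.obj M) hA) :
    Tens.map LinearMap.id l.cotensorIncl.left (l.rightCoactCotensor hA M z) =
      Tens.assoc (Tens.map M.coact LinearMap.id (l.rightResCotensorIncl hA M z)) :=
  LinearMap.factorThrough_spec
    ((Tens.assocRight.toLinearMap.comp (Tens.rmap M.coact (BimodHom.id A C))).comp
      (l.rightResCotensorIncl hA M))
    (Tens.rmap LinearMap.id l.cotensorIncl) _ _ z

variable {l}

theorem rightCoactCotensor_map {M M' : RightComod C} (f : M ⟶ M')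
    (z : l.rightCotensorObj (l.rightCorestriction.obj M) hA) :
    l.rightCoactCotensor hA M'
        (((l.rightCotensor hA).map (l.rightCorestriction.map f)).hom z) =
      Tens.map f.hom LinearMap.id (l.rightCoactCotensor hA M z) := by
  refine map_cotensorIncl_injective hA M' ?_
  have h : M'.coact.comp f.hom = (Tens.rmap f.hom (BimodHom.id A C)).comp M.coact :=
    LinearMap.ext f.colinear
  refine (l.map_rightCoactCotensor hA M' _).trans ?_
  rw [Tens.map_id_map_left, ← Tens.map_id_map_right f.hom, map_rightCoactCotensor,
    ← Tens.assoc_map_right, ← Tens.map_comp_left, ← h]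
  exact congrArg _ (Tens.map_comp_left f.hom M'.coact _).symm

theorem assoc_map_rightCoactCotensor (M : RightComod C)
    {s : l.cotensorSq →ₗ[A] Tens A C l.cotensorSq} (hs : l.IsCotensorLeftCoaction s)
    (z : l.rightCotensorObj (l.rightCorestriction.obj M) hA) :
    Tens.assoc (Tens.map M.coact LinearMap.id (l.rightCoactCotensor hA M z)) =
      Tens.map LinearMap.id s (l.rightCoactCotensor hA M z) := by
  refine Tens.map_id_left_injective (g := Tens.lmap (BimodHom.id A C) l.cotensorIncl.left) hA
    (map_cotensorIncl_injective hA C) ?_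
  have h : (Tens.lmap (BimodHom.id A C) l.cotensorIncl.left).comp s =
    (LeftComod.cofreeCoact C C).comp l.cotensorIncl.left := LinearMap.ext hs
  rw [← Tens.map_comp_right, h, Tens.map_comp_right, map_rightCoactCotensor,
    M.map_cofreeCoact_assoc, ← map_rightCoactCotensor, ← Tens.assoc_map_left,
    Tens.map_id_map_left, Tens.map_id_map_right]

theorem assoc_map_rightCoactCotensor_coact (M : RightComod C)
    {r : l.cotensorSq →ₗ[Aᵐᵒᵖ] Tens A l.cotensorSq C} (hr : l.IsCotensorRightCoaction r)
    (z : l.rightCotensorObj (l.rightCorestriction.obj M) hA) :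
    Tens.assoc (Tens.map (l.rightCoactCotensor hA M) LinearMap.id
        ((l.rightCotensorObj _ hA).coact z)) =
      Tens.map LinearMap.id (hr.bimodHom hA).left (l.rightCoactCotensor hA M z) := by
  let j : Tens A l.cotensorSq C →ₗ[A] Tens A C (Tens A C C) :=
    Tens.assocLeft.toLinearMap.comp (Tens.lmap l.cotensorIncl LinearMap.id)
  have hj : Function.Injective j := Tens.assoc.injective.comp
    (Tens.map_id_right_injective hA (Submodule.subtype_injective _))
  refine Tens.map_id_left_injective (g := j) hA hj ?_
  have h : j.comp (hr.bimodHom hA).left =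
    (Tens.lmap (BimodHom.id A C) C.comul.left).comp l.cotensorIncl.left := LinearMap.ext hr
  have h' : (Tens.rmap LinearMap.id l.cotensorIncl).comp (l.rightCoactCotensor hA M) =
      Tens.assocRight.toLinearMap.comp ((Tens.rmap M.coact (BimodHom.id A C)).comp
        (l.rightResCotensorIncl hA M)) :=
    LinearMap.ext (l.map_rightCoactCotensor hA M)
  rw [← Tens.map_comp_right, h, Tens.map_comp_right l.cotensorIncl.left, map_rightCoactCotensor,
    Tens.map_comp_right, ← Tens.assoc_naturality, h', Tens.map_comp_left, Tens.pentagon,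
    Tens.map_comp_left,
    map_rightResCotensorIncl_coact, Tens.assoc_map_right, RightComod.assoc_cofreeCoact,
    ← Tens.assoc_map_left, Tens.map_id_map_left, Tens.map_id_map_right]

variable (β : l.HomCotensorC)

/-- The map `M □_D C → M`, `m ⊗ c ↦ m₀ ε(β(m₁ ⊗ c))`. -/
noncomputable def HomCotensorC.rightCounitLinear (M : RightComod C) :
    l.rightCotensorObj (l.rightCorestriction.obj M) hA →ₗ[Aᵐᵒᵖ] M :=
  (C.counitRight M).comp
    ((Tens.rmap LinearMap.id β.toBimodHom).comp (l.rightCoactCotensor hA M))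

theorem HomCotensorC.coact_rightCounitLinear (M : RightComod C)
    (z : l.rightCotensorObj (l.rightCorestriction.obj M) hA) :
    M.coact (β.rightCounitLinear hA M z) =
      Tens.map LinearMap.id β.left (l.rightCoactCotensor hA M z) := by
  obtain ⟨s, hs, hβ⟩ := β.left_colinear
  have h : (Tens.lmap (BimodHom.id A C) β.left).comp s = C.comul.left.comp β.left :=
    LinearMap.ext fun x => (hβ x).symm
  -- `v = m₀ ⊗ β(m₁ ⊗ c)` lies in `M □_C C`, so it is determined by its image in `M`.
  have hv : Tens.map M.coact LinearMap.id
      (Tens.map LinearMap.id β.left (l.rightCoactCotensor hA M z)) =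
      cofreeCoact C M (Tens.map LinearMap.id β.left (l.rightCoactCotensor hA M z)) := by
    refine Tens.assoc.injective ?_
    rw [RightComod.assoc_cofreeCoact, ← Tens.map_comp_right, ← h, Tens.map_comp_right,
      ← assoc_map_rightCoactCotensor hA M hs, ← Tens.assoc_map_left, Tens.map_id_map_left,
      Tens.map_id_map_right]
  refine (C.counitRight_map M.coact _).symm.trans ?_
  refine (congrArg _ hv).trans ?_
  exact (cofree C M).counit _

theorem HomCotensorC.rightCounitLinear_colinear (M : RightComod C)
    (z : l.rightCotensorObj (l.rightCorestriction.obj M) hA) :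
    M.coact (β.rightCounitLinear hA M z) =
      Tens.map (β.rightCounitLinear hA M) LinearMap.id ((l.rightCotensorObj _ hA).coact z) := by
  obtain ⟨r, hr, hβ⟩ := β.right_colinear
  have h : (Tens.lmap β.toBimodHom LinearMap.id).comp (hr.bimodHom hA).left =
    C.comul.left.comp β.left := LinearMap.ext fun x => (hβ x).symm
  have h' : Tens.map (Tens.rmap LinearMap.id β.toBimodHom) LinearMap.id
      (Tens.map (l.rightCoactCotensor hA M) LinearMap.id ((l.rightCotensorObj _ hA).coact z)) =
      cofreeCoact C M (Tens.map LinearMap.id β.left (l.rightCoactCotensor hA M z)) := by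
    refine Tens.assoc.injective ?_
    rw [Tens.assoc_map, assoc_map_rightCoactCotensor_coact hA M hr, RightComod.assoc_cofreeCoact,
      ← Tens.map_comp_right, ← Tens.map_comp_right, h]
  rw [coact_rightCounitLinear, rightCounitLinear, Tens.map_comp_left, Tens.map_comp_left, h',
    map_counitRight_cofreeCoact]

/-- The natural transformation `m ⊗ c ↦ m₀ ε(β(m₁ ⊗ c))` from `- □_D C` to the identity. -/
noncomputable def HomCotensorC.rightCounit :
    l.rightCorestriction ⋙ l.rightCotensor hA ⟶ 𝟭 (RightComod C) where
  app M := RightComod.Hom.mk (β.rightCounitLinear hA M) (β.rightCounitLinear_colinear hA M)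
  naturality M M' f := by
    refine RightComod.Hom.ext (LinearMap.ext fun z => ?_)
    change C.counitRight M' (Tens.map LinearMap.id β.left (l.rightCoactCotensor hA M' _)) =
      f.hom (C.counitRight M (Tens.map LinearMap.id β.left (l.rightCoactCotensor hA M z)))
    refine (congrArg (fun w => C.counitRight M' (Tens.map LinearMap.id β.left w))
      (rightCoactCotensor_map hA f z)).trans ?_
    rw [← C.counitRight_map, Tens.map_id_map_left, Tens.map_id_map_right]

theorem HomCotensorC.rightCounitBimod_rightCounit (x : l.cotensorSq) :
    rightCounitBimod (β.rightCounit hA) x = β.toBimodHom x := by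
  obtain ⟨s, hs, hβ⟩ := β.left_colinear
  have h : l.rightCoactCotensor hA (regular C) (l.cotensorSqEquivRight hA x) = s x :=
    map_cotensorIncl_injective hA C ((map_rightCoactCotensor l hA _ _).trans (hs x).symm)
  change C.counitRight C (Tens.map LinearMap.id β.left (l.rightCoactCotensor hA (regular C)
    (l.cotensorSqEquivRight hA x))) = _
  rw [h]
  exact (congrArg _ (hβ x).symm).trans (C.comul_counit _)

end CounitOfHom

section AdjunctionOfHom

open RightComod

variable (hA) {α : l.HomDC} {β : l.HomCotensorC}

theorem rightCounitLinear_rightUnitLinear (h : ∀ c : C, β.toBimodHom (α.insertRight c) = c)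
    (M : RightComod C) (m : M) : β.rightCounitLinear hA M
      (α.rightUnitLinear hA (l.rightCorestriction.obj M) m) = m := by
  have h₁ : l.rightCoactCotensor hA M (α.rightUnitLinear hA (l.rightCorestriction.obj M) m) =
      Tens.map LinearMap.id α.insertRightBimod.left (M.coact m) := by
    refine map_cotensorIncl_injective hA M ?_
    have h₂ : l.cotensorIncl.left.comp α.insertRightBimod.left =
      (Tens.lmap (BimodHom.id A C) (α.left.comp l.left)).comp C.comul.left := rfl
    have h₄ : l.rightResCotensorIncl hA M
        (α.rightUnitLinear hA (l.rightCorestriction.obj M) m) =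
        Tens.map LinearMap.id (α.left.comp l.left) (M.coact m) :=
      (Tens.map_comp_right l.left α.left (M.coact m)).symm
    refine (map_rightCoactCotensor l hA M _).trans ?_
    refine (congrArg (fun y => Tens.assoc (Tens.map M.coact LinearMap.id y)) h₄).trans ?_
    rw [← Tens.map_comp_right, h₂, Tens.map_comp_right _ (Tens.lmap _ _), ← M.coassoc,
      ← Tens.assoc_map_left, Tens.map_id_map_left, Tens.map_id_map_right]
  have h₃ : β.left.comp α.insertRightBimod.left = LinearMap.id := LinearMap.ext h
  change C.counitRight M (Tens.map LinearMap.id β.left (l.rightCoactCotensor hA M _)) = m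
  rw [h₁, ← Tens.map_comp_right, h₃, Tens.map_id]
  exact M.counit m

theorem rightCounitLinear_map_rightUnit (h : ∀ c : C, β.toBimodHom (α.insertLeft c) = c)
    (N : RightComod D) (z : l.rightCotensorObj N hA) :
    β.rightCounitLinear hA (l.rightCotensorObj N hA)
      (((l.rightCotensor hA).map ((α.rightUnit hA).app N)).hom z) = z := by
  refine l.rightCotensorIncl_injective N hA ?_
  refine (rightCounit_hom (β.rightCounit hA) (M := l.rightCotensorObj N hA)
    (equalizerι (cofreeMap C N.coact) (l.cofreeLeftCoact N) hA) _).symm.trans ?_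
  refine (rightCounit_cofree (β.rightCounit hA)
    (Tens.map LinearMap.id α.insertLeftBimod.left (l.rightCotensorIncl N hA z)) _ ?_).trans ?_
  · have h₁ : l.cotensorIncl.left.comp α.insertLeftBimod.left =
      (Tens.lmap α.toBimodHom LinearMap.id).comp l.leftCoact :=
      LinearMap.ext fun c => Tens.map_comp_left l.right α.right (C.comul c)
    rw [← Tens.map_comp_right, h₁, Tens.map_comp_right, ← l.assoc_map_rightCotensorIncl,
      ← Tens.assoc_naturality]
    exact congrArg Tens.assoc (Tens.map_comp_left _ _ _).symm
  · have h₂ : (rightCounitBimod (β.rightCounit hA)).left.comp α.insertLeftBimod.left =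
      LinearMap.id := LinearMap.ext fun c => (β.rightCounitBimod_rightCounit hA _).trans (h c)
    rw [← Tens.map_comp_right, h₂, Tens.map_id]

/-- The adjunction between `- □_D C` and corestriction defined by a pair of bicomodule maps. -/
noncomputable def rightAdjunctionOfHom (hl : ∀ c : C, β.toBimodHom (α.insertLeft c) = c)
    (hr : ∀ c : C, β.toBimodHom (α.insertRight c) = c) :
    l.rightCotensor hA ⊣ l.rightCorestriction :=
  Adjunction.mkOfUnitCounit
    { unit := α.rightUnit hA
      counit := β.rightCounit hA
      left_triangle := by
        ext N
        exact RightComod.Hom.ext (LinearMap.ext (rightCounitLinear_map_rightUnit hA hl N))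
      right_triangle := by
        ext M
        exact RightComod.Hom.ext (LinearMap.ext (rightCounitLinear_rightUnitLinear hA hr M)) }

end AdjunctionOfHom

theorem isRightFrobenius_iff (hA : IsVonNeumannRegular A) : l.IsRightFrobenius ↔
    ∃ (α : l.HomDC) (β : l.HomCotensorC),
      (∀ c : C, β.toBimodHom (α.insertLeft c) = c) ∧
      (∀ c : C, β.toBimodHom (α.insertRight c) = c) := by
  constructor
  · rintro ⟨L, R, ⟨adjL⟩, ⟨adjR⟩, ⟨e⟩⟩
    let adj : l.rightCotensor hA ⊣ l.rightCorestriction :=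
      adjL.ofNatIsoLeft (e ≪≫ adjR.rightAdjointUniq (l.rightAdjunction hA))
    exact ⟨rightUnitHomDC adj.unit, rightCounitHomCotensorC adj.counit,
      rightCounit_insertLeft adj, rightCounit_insertRight adj⟩
  · rintro ⟨α, β, hl, hr⟩
    exact ⟨_, _, ⟨rightAdjunctionOfHom hA hl hr⟩, ⟨l.rightAdjunction hA⟩, ⟨Iso.refl _⟩⟩

end CoringHom

/-! ### From left Frobenius extensions to bicomodule homomorphisms -/

/-- Right multiplication on a coring, as an endomorphism of the left regular comodule. -/
def LeftComod.smulHom {A : Type u} [Ring A] {C : Coring A} (b : Aᵐᵒᵖ) :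
    LeftComod.regular C ⟶ LeftComod.regular C :=
  Hom.mk (Tens.rightMul b) fun c => C.comul.right.map_smul b c

namespace CoringHom

variable {A : Type u} [Ring A] {C D : Coring A} (l : CoringHom C D)
  (hA : IsVonNeumannRegular A)

section LeftUnit

open LeftComod

variable {l hA} (η : 𝟭 (LeftComod D) ⟶ l.leftCotensor hA ⋙ l.leftCorestriction)

/-- The components `N → C □_D N ⊆ C ⊗ N` of a natural transformation from the identity to
`C □_D -`. -/
noncomputable def leftUnitMap (N : LeftComod D) : N →ₗ[A] Tens A C N :=
  (l.leftCotensorIncl N hA).comp (η.app N).hom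

theorem leftUnitMap_hom {N N' : LeftComod D} (f : N ⟶ N') (n : N) :
    leftUnitMap η N' (f.hom n) = Tens.map LinearMap.id f.hom (leftUnitMap η N n) :=
  congrArg (fun k : Hom N (l.leftCorestriction.obj (l.leftCotensorObj N' hA)) =>
    l.leftCotensorIncl N' hA (k.hom n)) (η.naturality f)

/-- The bimodule map `α : D → C` underlying a natural transformation `η` from the identity to
`C □_D -`: the component `D → C □_D D` at `D` followed by `c ⊗ d ↦ c ε(d)`. -/
noncomputable def leftUnitBimod : BimodHom A D C where
  toFun d := D.counitRight C (leftUnitMap η (regular D) d)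
  map_add' d d' := by rw [map_add, map_add]
  map_smul' a d := by
    change (D.counitRightBimod C).left _ = a • (D.counitRightBimod C).left _
    rw [map_smul, map_smul]
  map_op_smul' b d := by
    have h := leftUnitMap_hom η (smulHom b) d
    exact (congrArg (D.counitRight C) h).trans ((D.counitRight C).map_smul b _)

/-- A natural transformation from the identity to `C □_D -` is determined by its component at `D`:
it is `n ↦ α(n₋₁) ⊗ n₀`. -/
theorem leftUnitMap_eq (N : LeftComod D) (n : N) :
    leftUnitMap η N n = Tens.map (leftUnitBimod η).right LinearMap.id (N.coact n) := by
  have h (y : Tens A D N) : Tens.map LinearMap.id (D.counitLeft N)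
      (leftUnitMap η (cofree D N) y) = Tens.map (leftUnitBimod η).right LinearMap.id y := by
    induction y using Tens.induction with
    | zero => simp
    | add y z hy hz => simp only [map_add, hy, hz]
    | tmul d n =>
      have := leftUnitMap_hom η (tmulHom (C := D) n) d
      refine (congrArg _ this).trans ?_
      refine (Tens.map_comp_right _ _ _).symm.trans ?_
      exact D.map_counitLeft_tmulRight n _
  have h' : (D.counitLeft N).comp N.coact = LinearMap.id := LinearMap.ext N.counit
  rw [← h]
  refine Eq.trans ?_ (congrArg _ (leftUnitMap_hom η (coactHom N) n)).symm
  refine Eq.trans ?_ (Tens.map_comp_right _ _ _)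
  change _ = Tens.map LinearMap.id ((D.counitLeft N).comp N.coact) _
  rw [h', Tens.map_id]

theorem map_counitRight_cofreeCoact (z : Tens A C D) :
    Tens.map LinearMap.id (D.counitRightBimod C).left (cofreeCoact C D z) =
      C.comul (D.counitRight C z) := by
  induction z using Tens.induction with
  | zero => simp
  | add y z hy hz => simp only [map_add, hy, hz]
  | tmul c d =>
    rw [cofreeCoact_tmul, ← Tens.map_comp_right, Coring.counitRight_tmul]
    exact (C.comul.right.map_smul (op (D.counit d)) c).symm

/-- The homomorphism `C □_D D → C`, `c ⊗ d ↦ c ε(d)`, of left `C`-comodules. -/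
noncomputable def counitLeftCotensor (l : CoringHom C D) (hA : IsVonNeumannRegular A) :
    (l.leftCotensor hA).obj (regular D) ⟶ regular C :=
  LeftComod.Hom.mk ((D.counitRightBimod C).left.comp (l.leftCotensorIncl (regular D) hA))
    fun z => by
      refine (map_counitRight_cofreeCoact _).symm.trans ?_
      refine Eq.trans ?_ (Tens.map_comp_right _ _ _).symm
      exact congrArg _ (l.map_leftCotensorIncl_coact hA z).symm

theorem leftUnitBimod_left_colinear (d : D) : l.leftCoact (leftUnitBimod η d) =
    Tens.map LinearMap.id (leftUnitBimod η).left (D.comul d) :=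
  (η.app (regular D) ≫ l.leftCorestriction.map (counitLeftCotensor l hA)).colinear d

theorem leftUnitBimod_right_colinear (d : D) : l.rightCoact (leftUnitBimod η d) =
    Tens.map (leftUnitBimod η).right LinearMap.id (D.comul d) := by
  have h := l.assoc_map_leftCotensorIncl hA (N := regular D) ((η.app (regular D)).hom d)
  have h' := congrArg (D.counitRight (Tens A C D)) (Tens.assoc.eq_symm_apply.2 h)
  rw [D.counitRight_map] at h'
  refine h'.trans (Eq.trans ?_ (leftUnitMap_eq η (regular D) d))
  exact (RightComod.cofree D C).counit _

/-- The homomorphism of `D`-bicomodules `D → C` given by a natural transformation from the identity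
to `C □_D -`. -/
noncomputable def leftUnitHomDC : l.HomDC where
  toBimodHom := leftUnitBimod η
  right_colinear := leftUnitBimod_right_colinear η
  left_colinear := leftUnitBimod_left_colinear η

end LeftUnit

section LeftCounit

open LeftComod

variable {l hA} (ε : l.leftCorestriction ⋙ l.leftCotensor hA ⟶ 𝟭 (LeftComod C))

theorem leftCounit_hom {M M' : LeftComod C} (f : M ⟶ M')
    (z : l.leftCotensorObj (l.leftCorestriction.obj M) hA) :
    (ε.app M').hom (((l.leftCotensor hA).map (l.leftCorestriction.map f)).hom z) =
      f.hom ((ε.app M).hom z) :=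
  congrArg (fun k : Hom (l.leftCotensorObj (l.leftCorestriction.obj M) hA) M' => k.hom z)
    (ε.naturality f)

/-- The bimodule map `β : C □_D C → C` underlying a natural transformation `ε` from `C □_D -` to
the identity: its component at `C`. -/
noncomputable def leftCounitBimod : BimodHom A l.cotensorSq C where
  toFun x := (ε.app (regular C)).hom (l.cotensorSqEquivLeft hA x)
  map_add' x y := by rw [map_add]; exact map_add _ _ _
  map_smul' a x :=
    (congrArg (ε.app (regular C)).hom ((l.cotensorSqEquivLeft hA).map_smul a x)).trans
      ((ε.app (regular C)).hom.map_smul a _)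
  map_op_smul' b x := leftCounit_hom ε (smulHom b) (l.cotensorSqEquivLeft hA x)

/-- A natural transformation `C □_D - → 1` is, at a cofree comodule `C ⊗ X`, the map
`β ⊗ X : (C □_D C) ⊗ X → C ⊗ X`. -/
theorem leftCounit_cofree {X : Type u} [AddCommGroup X] [Module A X]
    (w : Tens A l.cotensorSq X)
    (z : l.leftCotensorObj (l.leftCorestriction.obj (cofree C X)) hA)
    (h : l.leftCotensorIncl _ hA z =
      Tens.assoc (Tens.map l.cotensorIncl.right (LinearMap.id : X →ₗ[A] X) w)) :
    (ε.app (cofree C X)).hom z = Tens.map (leftCounitBimod ε).right LinearMap.id w := by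
  obtain ⟨z', hz', hε⟩ : ∃ z' : l.leftCotensorObj (l.leftCorestriction.obj (cofree C X)) hA,
      l.leftCotensorIncl _ hA z' =
        Tens.assoc (Tens.map l.cotensorIncl.right (LinearMap.id : X →ₗ[A] X) w) ∧
      (ε.app (cofree C X)).hom z' = Tens.map (leftCounitBimod ε).right LinearMap.id w := by
    clear h
    induction w using Tens.induction with
    | zero => exact ⟨0, map_zero _, map_zero _⟩
    | add v w hv hw =>
      obtain ⟨y, hy, hy'⟩ := hv
      obtain ⟨z, hz, hz'⟩ := hw
      refine ⟨y + z, ?_, ?_⟩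
      · rw [map_add, map_add, map_add, ← hy, ← hz]
        rfl
      · rw [map_add, ← hy', ← hz']; exact map_add _ y z
    | tmul y x =>
      exact ⟨((l.leftCotensor hA).map (l.leftCorestriction.map (tmulHom x))).hom
        (l.cotensorSqEquivLeft hA y), rfl, leftCounit_hom ε (tmulHom x) _⟩
  have : z = z' := l.leftCotensorIncl_injective _ hA (h.trans hz'.symm)
  rw [this, hε]

/-- The homomorphism of `C`-bicomodules `C □_D C → C` given by a natural transformation from
`C □_D -` to the identity. -/
noncomputable def leftCounitHomCotensorC : l.HomCotensorC where
  toBimodHom := leftCounitBimod ε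
  right_colinear := ⟨l.cotensorSqRightCoact hA, l.isCotensorRightCoaction_cotensorSqRightCoact hA,
    fun x => by
      refine (leftCounit_hom ε (coactHom (regular C)) (l.cotensorSqEquivLeft hA x)).symm.trans ?_
      exact leftCounit_cofree ε _ _ (l.isCotensorRightCoaction_cotensorSqRightCoact hA x).symm⟩
  left_colinear := ⟨l.cotensorSqLeftCoact hA, l.isCotensorLeftCoaction_cotensorSqLeftCoact hA,
    fun x => by
      refine ((ε.app (regular C)).colinear (l.cotensorSqEquivLeft hA x)).trans ?_
      refine (congrArg _ (l.map_cotensorSqLeftCoact hA x).symm).trans ?_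
      exact (Tens.map_comp_right _ _ _).symm⟩

end LeftCounit

section LeftTriangle

open LeftComod

variable {l hA} (adj : l.leftCotensor hA ⊣ l.leftCorestriction)

theorem leftCounit_insertLeft (c : C) :
    leftCounitBimod adj.counit ((leftUnitHomDC adj.unit).insertLeft c) = c := by
  have h := congrArg (fun k : Hom (l.leftCorestriction.obj (regular C))
    (l.leftCorestriction.obj (regular C)) => k.hom c)
    (adj.right_triangle_components (regular C))
  refine Eq.trans (congrArg (adj.counit.app (regular C)).hom ?_) h
  refine l.leftCotensorIncl_injective _ hA ?_
  refine Eq.trans ?_ (leftUnitMap_eq adj.unit (l.leftCorestriction.obj (regular C)) c).symm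
  exact Tens.map_comp_left l.right (leftUnitBimod adj.unit).right (C.comul c)

theorem leftCounit_insertRight (c : C) :
    leftCounitBimod adj.counit ((leftUnitHomDC adj.unit).insertRight c) = c := by
  let z : l.leftCotensorObj (regular D) hA :=
    ⟨l.rightCoact c, (l.rightCorestriction.obj (RightComod.regular C)).coassoc c⟩
  have hz : (counitLeftCotensor l hA).hom z = c :=
    (l.rightCorestriction.obj (RightComod.regular C)).counit c
  have h := congrArg (fun k : Hom (l.leftCotensorObj (regular D) hA)
    (l.leftCotensorObj (regular D) hA) => (counitLeftCotensor l hA).hom (k.hom z))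
    (adj.left_triangle_components (regular D))
  refine Eq.trans ?_ (h.trans hz)
  refine Eq.trans ?_ (leftCounit_hom adj.counit (counitLeftCotensor l hA)
    (((l.leftCotensor hA).map (adj.unit.app (regular D))).hom z))
  refine congrArg (adj.counit.app (regular C)).hom (l.leftCotensorIncl_injective _ hA ?_)
  refine (Tens.map_comp_right l.left (leftUnitBimod adj.unit).left (C.comul c)).trans ?_
  exact Tens.map_comp_right (adj.unit.app (regular D)).hom (counitLeftCotensor l hA).hom
    (l.rightCoact c)

end LeftTriangle

end CoringHom

/-! ### From bicomodule homomorphisms to left Frobenius extensions -/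

/-- Coassociativity of a left comodule, after tensoring with a right module `N`. -/
theorem LeftComod.map_cofreeCoact_assoc_symm {A : Type u} [Ring A] {C : Coring A} (M : LeftComod C)
    {N : Type u} [AddCommGroup N] [Module Aᵐᵒᵖ N] (y : Tens A N M) :
    Tens.map (RightComod.cofreeCoact C N) LinearMap.id
        (Tens.assoc.symm (Tens.map LinearMap.id M.coact y)) =
      Tens.assoc.symm (Tens.map LinearMap.id M.coact
        (Tens.assoc.symm (Tens.map LinearMap.id M.coact y))) := by
  induction y using Tens.induction with
  | zero => simp
  | add x y hx hy => simp only [map_add, hx, hy]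
  | tmul n m =>
    have h : (RightComod.cofreeCoact C N).comp (Tens.tmulLeft n) =
      (Tens.rmap (Tens.tmulLeft n) (BimodHom.id A C)).comp C.comul.right := rfl
    change Tens.map (RightComod.cofreeCoact C N) LinearMap.id
        (Tens.map (Tens.tmulLeft n) LinearMap.id (M.coact m)) =
      Tens.assoc.symm (Tens.map LinearMap.id M.coact
        (Tens.map (Tens.tmulLeft n) LinearMap.id (M.coact m)))
    rw [AddEquiv.eq_symm_apply, ← Tens.map_comp_left, h, Tens.map_comp_left, Tens.assoc_map_right,
      M.coassoc, Tens.map_id_map_left, Tens.map_id_map_right]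

namespace CoringHom

variable {A : Type u} [Ring A] {C D : Coring A} {l : CoringHom C D}
  {hA : IsVonNeumannRegular A}

section LeftUnitOfHom

open LeftComod

variable (hA) (α : l.HomDC)

theorem HomDC.map_mem_leftCotensor (N : LeftComod D) (n : N) :
    (l.cofreeRightCoact N).hom (Tens.map α.right LinearMap.id (N.coact n)) =
      (cofreeMap C N.coact).hom (Tens.map α.right LinearMap.id (N.coact n)) := by
  change _ = Tens.map LinearMap.id N.coact _
  have h : l.rightCoact.comp α.right = (Tens.rmap α.right (BimodHom.id A D)).comp D.comul.right :=
    LinearMap.ext α.right_colinear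
  rw [cofreeRightCoact_apply, ← Tens.map_comp_left, h, Tens.map_comp_left, Tens.assoc_map_right,
    N.coassoc, Tens.map_id_map_left, Tens.map_id_map_right]

/-- The map `N → C □_D N`, `n ↦ α(n₋₁) ⊗ n₀`. -/
noncomputable def HomDC.leftUnitLinear (N : LeftComod D) :
    N →ₗ[A] l.leftCotensorObj N hA :=
  ((Tens.lmap α.toBimodHom LinearMap.id).comp N.coact).codRestrict _
    (α.map_mem_leftCotensor N)

theorem HomDC.leftCotensorIncl_leftUnitLinear (N : LeftComod D) (n : N) :
    l.leftCotensorIncl N hA (α.leftUnitLinear hA N n) =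
      Tens.map α.right LinearMap.id (N.coact n) := rfl

theorem HomDC.leftUnitLinear_colinear (N : LeftComod D) (n : N) :
    l.corestrictLeft (l.leftCotensorObj N hA).coact (α.leftUnitLinear hA N n) =
      Tens.map LinearMap.id (α.leftUnitLinear hA N) (N.coact n) := by
  refine Tens.map_id_left_injective hA (l.leftCotensorIncl_injective N hA)
    (Tens.assoc.symm.injective ?_)
  have h : (l.leftCotensorIncl N hA).comp (α.leftUnitLinear hA N) =
    (Tens.lmap α.toBimodHom LinearMap.id).comp N.coact := rfl
  have h' : l.leftCoactBimod.right.comp α.right = (Tens.rmap LinearMap.id α.toBimodHom).comp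
    D.comul.right := LinearMap.ext α.left_colinear
  have h'' : l.leftCoactBimod.right =
    (Tens.rmap l.right (BimodHom.id A C)).comp C.comul.right := rfl
  rw [← Tens.map_comp_right, h, Tens.assoc_symm_naturality, ← N.coassoc,
    AddEquiv.symm_apply_apply, ← Tens.map_comp_left, ← h', Tens.map_comp_left,
    ← leftCotensorIncl_leftUnitLinear hA, h'', Tens.map_comp_left,
    ← LeftComod.assoc_symm_cofreeCoact, ← Tens.assoc_symm_map_right, ← map_leftCotensorIncl_coact,
    Tens.map_id_map_right, corestrictLeft]
  exact congrArg _ (Tens.map_id_map_left _ _ _)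

/-- The natural transformation `n ↦ α(n₋₁) ⊗ n₀` from the identity to `C □_D -`. -/
noncomputable def HomDC.leftUnit : 𝟭 (LeftComod D) ⟶ l.leftCotensor hA ⋙ l.leftCorestriction where
  app N := LeftComod.Hom.mk (α.leftUnitLinear hA N) (α.leftUnitLinear_colinear hA N)
  naturality N N' f := by
    refine LeftComod.Hom.ext (LinearMap.ext fun n => l.leftCotensorIncl_injective N' hA ?_)
    change Tens.map α.right LinearMap.id (N'.coact (f.hom n)) =
      Tens.map LinearMap.id f.hom (Tens.map α.right LinearMap.id (N.coact n))
    rw [f.colinear, Tens.map_id_map_left, Tens.map_id_map_right]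

end LeftUnitOfHom

section LeftCounitOfHom

open LeftComod

variable (l) in
/-- The inclusion of `C □_D M` in `C ⊗ M` for a left `C`-comodule `M`. -/
noncomputable def leftResCotensorIncl (hA : IsVonNeumannRegular A) (M : LeftComod C) :
    l.leftCotensorObj (l.leftCorestriction.obj M) hA →ₗ[A] Tens A C M :=
  l.leftCotensorIncl (l.leftCorestriction.obj M) hA

theorem map_rightCoact_leftResCotensorIncl (M : LeftComod C)
    (z : l.leftCotensorObj (l.leftCorestriction.obj M) hA) :
    Tens.map l.rightCoact LinearMap.id (l.leftResCotensorIncl hA M z) =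
      Tens.assoc.symm (Tens.map LinearMap.id (l.corestrictLeft M.coact)
        (l.leftResCotensorIncl hA M z)) :=
  Tens.assoc.eq_symm_apply.2 (l.assoc_map_leftCotensorIncl hA z)

theorem map_leftResCotensorIncl_coact (M : LeftComod C)
    (z : l.leftCotensorObj (l.leftCorestriction.obj M) hA) :
    Tens.map LinearMap.id (l.leftResCotensorIncl hA M) ((l.leftCotensorObj _ hA).coact z) =
      cofreeCoact C M (l.leftResCotensorIncl hA M z) :=
  l.map_leftCotensorIncl_coact hA z

theorem range_cotensorIncl_right : l.cotensorIncl.right.range =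
    (Tens.rmap l.rightCoact (BimodHom.id A C)).eqLocus
      (Tens.assocRight.symm.toLinearMap.comp (Tens.rmap LinearMap.id l.leftCoactBimod)) := by
  ext x
  refine Iff.trans ⟨?_, fun h => ⟨⟨x, h⟩, rfl⟩⟩
    ((mem_cotensor D l.rightCoact l.leftCoact x).trans Tens.assoc.eq_symm_apply.symm)
  rintro ⟨y, rfl⟩
  exact y.2

theorem assoc_symm_map_coact_mem_range (M : LeftComod C)
    (z : l.leftCotensorObj (l.leftCorestriction.obj M) hA) :
    Tens.assoc.symm (Tens.map LinearMap.id M.coact (l.leftResCotensorIncl hA M z)) ∈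
      (Tens.map l.cotensorIncl.right (LinearMap.id : M →ₗ[A] M)).range := by
  refine Tens.mem_range_map_id_right hA range_cotensorIncl_right ?_
  have h : Tens.assocRight.symm.toLinearMap.comp (Tens.rmap LinearMap.id l.leftCoactBimod) =
      (Tens.rmap (Tens.rmap LinearMap.id l.toBimodHom) (BimodHom.id A C)).comp
        (RightComod.cofreeCoact C C) :=
    LinearMap.ext fun x => Tens.assoc_symm_naturality C.comul.left LinearMap.id l.toBimodHom
      LinearMap.id x
  have h' (y : Tens A C M) : Tens.map (Tens.rmap LinearMap.id l.toBimodHom) LinearMap.id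
      (Tens.assoc.symm (Tens.map LinearMap.id M.coact y)) =
        Tens.assoc.symm (Tens.map LinearMap.id (l.corestrictLeft M.coact) y) :=
    (Tens.assoc_symm_naturality M.coact LinearMap.id l.toBimodHom LinearMap.id y).symm
  rw [h, Tens.map_comp_left, M.map_cofreeCoact_assoc_symm, ← Tens.assoc_symm_map_right,
    ← Tens.assoc_symm_map_right, Tens.map_id_map_right, Tens.map_id_map_right,
    ← Tens.map_id_map_left (Tens.rmap _ _), h', ← map_rightCoact_leftResCotensorIncl,
    Tens.map_id_map_left]

theorem map_cotensorIncl_right_injective (hA : IsVonNeumannRegular A) (M : Type u) [AddCommGroup M]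
    [Module A M] :
    Function.Injective (Tens.map l.cotensorIncl.right (LinearMap.id : M →ₗ[A] M)) :=
  Tens.map_id_right_injective hA (Submodule.subtype_injective _)

/-- A left `C`-coaction on `C □_D C`, as a homomorphism of bimodules. -/
def IsCotensorLeftCoaction.bimodHom (hA : IsVonNeumannRegular A)
    {s : l.cotensorSq →ₗ[A] Tens A C l.cotensorSq} (hs : l.IsCotensorLeftCoaction s) :
    BimodHom A l.cotensorSq (Tens A C l.cotensorSq) where
  toLinearMap := s
  map_op_smul' b x := by
    refine Tens.map_id_left_injective (g := l.cotensorIncl.left) hA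
      (Submodule.subtype_injective _) ?_
    refine (hs _).trans ?_
    refine Eq.trans ?_ (Tens.map_smul_right _ _ l.cotensorIncl.right.map_smul b (s x)).symm
    rw [hs, ← Tens.assoc_smul_right]
    exact congrArg Tens.assoc (Tens.map_smul_right _ _ (fun _ _ => rfl) b x.1)

variable (l hA)

/-- The coaction `c ⊗ m ↦ (c ⊗ m₋₁) ⊗ m₀`, as a map `C □_D M → (C □_D C) ⊗ M`. -/
noncomputable def leftCoactCotensor (M : LeftComod C) :
    l.leftCotensorObj (l.leftCorestriction.obj M) hA →ₗ[A] Tens A l.cotensorSq M :=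
  LinearMap.factorThrough
    ((Tens.assocLeft.symm.toLinearMap.comp (Tens.lmap (BimodHom.id A C) M.coact)).comp
      (l.leftResCotensorIncl hA M))
    (Tens.lmap l.cotensorIncl LinearMap.id)
    (map_cotensorIncl_right_injective hA M)
    (assoc_symm_map_coact_mem_range M)

theorem map_leftCoactCotensor (M : LeftComod C)
    (z : l.leftCotensorObj (l.leftCorestriction.obj M) hA) :
    Tens.map l.cotensorIncl.right LinearMap.id (l.leftCoactCotensor hA M z) =
      Tens.assoc.symm (Tens.map LinearMap.id M.coact (l.leftResCotensorIncl hA M z)) :=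
  LinearMap.factorThrough_spec
    ((Tens.assocLeft.symm.toLinearMap.comp (Tens.lmap (BimodHom.id A C) M.coact)).comp
      (l.leftResCotensorIncl hA M))
    (Tens.lmap l.cotensorIncl LinearMap.id) _ _ z

variable {l}

theorem leftCoactCotensor_map {M M' : LeftComod C} (f : M ⟶ M')
    (z : l.leftCotensorObj (l.leftCorestriction.obj M) hA) :
    l.leftCoactCotensor hA M'
        (((l.leftCotensor hA).map (l.leftCorestriction.map f)).hom z) =
      Tens.map LinearMap.id f.hom (l.leftCoactCotensor hA M z) := by
  refine map_cotensorIncl_right_injective hA M' ?_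
  have h : M'.coact.comp f.hom = (Tens.lmap (BimodHom.id A C) f.hom).comp M.coact :=
    LinearMap.ext f.colinear
  refine (l.map_leftCoactCotensor hA M' _).trans ?_
  rw [Tens.map_id_map_right, ← Tens.map_id_map_left _ f.hom, map_leftCoactCotensor,
    ← Tens.assoc_symm_map_left, ← Tens.map_comp_right, ← h]
  exact congrArg _ (Tens.map_comp_right f.hom M'.coact _).symm

theorem assoc_symm_map_leftCoactCotensor (M : LeftComod C)
    {r : l.cotensorSq →ₗ[Aᵐᵒᵖ] Tens A l.cotensorSq C} (hr : l.IsCotensorRightCoaction r)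
    (z : l.leftCotensorObj (l.leftCorestriction.obj M) hA) :
    Tens.assoc.symm (Tens.map LinearMap.id M.coact (l.leftCoactCotensor hA M z)) =
      Tens.map r LinearMap.id (l.leftCoactCotensor hA M z) := by
  refine Tens.map_id_right_injective (g := Tens.rmap l.cotensorIncl.right (BimodHom.id A C)) hA
    (map_cotensorIncl_right_injective hA C) ?_
  have h : (Tens.rmap l.cotensorIncl.right (BimodHom.id A C)).comp r =
      (RightComod.cofreeCoact C C).comp l.cotensorIncl.right :=
    LinearMap.ext fun x => Tens.assoc.eq_symm_apply.2 (hr x)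
  rw [← Tens.map_comp_left, h, Tens.map_comp_left, map_leftCoactCotensor,
    M.map_cofreeCoact_assoc_symm, ← map_leftCoactCotensor, ← Tens.assoc_symm_map_right,
    Tens.map_id_map_left, Tens.map_id_map_right]

theorem assoc_symm_map_leftCoactCotensor_coact (M : LeftComod C)
    {s : l.cotensorSq →ₗ[A] Tens A C l.cotensorSq} (hs : l.IsCotensorLeftCoaction s)
    (z : l.leftCotensorObj (l.leftCorestriction.obj M) hA) :
    Tens.assoc.symm (Tens.map LinearMap.id (l.leftCoactCotensor hA M)
        ((l.leftCotensorObj _ hA).coact z)) =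
      Tens.map (hs.bimodHom hA).right LinearMap.id (l.leftCoactCotensor hA M z) := by
  let j : Tens A C l.cotensorSq →ₗ[Aᵐᵒᵖ] Tens A (Tens A C C) C :=
    Tens.assocRight.symm.toLinearMap.comp (Tens.rmap LinearMap.id l.cotensorIncl)
  have hj : Function.Injective j := Tens.assoc.symm.injective.comp
    (Tens.map_id_left_injective hA (Submodule.subtype_injective _))
  refine Tens.map_id_right_injective (g := j) hA hj ?_
  have h : j.comp (hs.bimodHom hA).right =
      (Tens.rmap C.comul.right (BimodHom.id A C)).comp l.cotensorIncl.right :=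
    LinearMap.ext fun x => Tens.assoc.symm_apply_eq.2 (hs x)
  have h' : (Tens.lmap l.cotensorIncl LinearMap.id).comp (l.leftCoactCotensor hA M) =
      Tens.assocLeft.symm.toLinearMap.comp ((Tens.lmap (BimodHom.id A C) M.coact).comp
        (l.leftResCotensorIncl hA M)) :=
    LinearMap.ext (l.map_leftCoactCotensor hA M)
  rw [← Tens.map_comp_left, h, Tens.map_comp_left l.cotensorIncl.right, map_leftCoactCotensor,
    Tens.map_comp_left, ← Tens.assoc_symm_naturality, h', Tens.map_comp_right, Tens.pentagon_symm,
    Tens.map_comp_right, map_leftResCotensorIncl_coact, Tens.assoc_symm_map_left,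
    LeftComod.assoc_symm_cofreeCoact, ← Tens.assoc_symm_map_right, Tens.map_id_map_left,
    Tens.map_id_map_right]

variable (β : l.HomCotensorC)

/-- The map `C □_D M → M`, `c ⊗ m ↦ ε(β(c ⊗ m₋₁)) m₀`. -/
noncomputable def HomCotensorC.leftCounitLinear (M : LeftComod C) :
    l.leftCotensorObj (l.leftCorestriction.obj M) hA →ₗ[A] M :=
  (C.counitLeft M).comp
    ((Tens.lmap β.toBimodHom LinearMap.id).comp (l.leftCoactCotensor hA M))

theorem HomCotensorC.coact_leftCounitLinear (M : LeftComod C)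
    (z : l.leftCotensorObj (l.leftCorestriction.obj M) hA) :
    M.coact (β.leftCounitLinear hA M z) =
      Tens.map β.right LinearMap.id (l.leftCoactCotensor hA M z) := by
  obtain ⟨r, hr, hβ⟩ := β.right_colinear
  have h : (Tens.rmap β.right (BimodHom.id A C)).comp r = C.comul.right.comp β.right :=
    LinearMap.ext fun x => (hβ x).symm
  -- `v = β(c ⊗ m₋₁) ⊗ m₀` lies in `C □_C M`, so it is determined by its image in `M`.
  have hv : Tens.map LinearMap.id M.coact
      (Tens.map β.right LinearMap.id (l.leftCoactCotensor hA M z)) =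
      cofreeCoact C M (Tens.map β.right LinearMap.id (l.leftCoactCotensor hA M z)) := by
    refine Tens.assoc.symm.injective ?_
    rw [LeftComod.assoc_symm_cofreeCoact, ← Tens.map_comp_left, ← h, Tens.map_comp_left,
      ← assoc_symm_map_leftCoactCotensor hA M hr, ← Tens.assoc_symm_map_right,
      Tens.map_id_map_left, Tens.map_id_map_right]
  refine (C.counitLeft_map M.coact _).symm.trans ?_
  refine (congrArg _ hv).trans ?_
  exact (cofree C M).counit _

theorem HomCotensorC.leftCounitLinear_colinear (M : LeftComod C)
    (z : l.leftCotensorObj (l.leftCorestriction.obj M) hA) :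
    M.coact (β.leftCounitLinear hA M z) =
      Tens.map LinearMap.id (β.leftCounitLinear hA M) ((l.leftCotensorObj _ hA).coact z) := by
  obtain ⟨s, hs, hβ⟩ := β.left_colinear
  have h : (Tens.rmap LinearMap.id β.toBimodHom).comp (hs.bimodHom hA).right =
    C.comul.right.comp β.right := LinearMap.ext fun x => (hβ x).symm
  have h' : Tens.map LinearMap.id (Tens.lmap β.toBimodHom LinearMap.id)
      (Tens.map LinearMap.id (l.leftCoactCotensor hA M) ((l.leftCotensorObj _ hA).coact z)) =
      cofreeCoact C M (Tens.map β.right LinearMap.id (l.leftCoactCotensor hA M z)) := by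
    refine Tens.assoc.symm.injective ?_
    rw [Tens.assoc_symm_map, assoc_symm_map_leftCoactCotensor_coact hA M hs,
      LeftComod.assoc_symm_cofreeCoact, ← Tens.map_comp_left, ← Tens.map_comp_left, h]
  rw [coact_leftCounitLinear, leftCounitLinear, Tens.map_comp_right, Tens.map_comp_right, h']
  exact (LeftComod.map_counitLeft_cofreeCoact _).symm

/-- The natural transformation `c ⊗ m ↦ ε(β(c ⊗ m₋₁)) m₀` from `C □_D -` to the identity. -/
noncomputable def HomCotensorC.leftCounit :
    l.leftCorestriction ⋙ l.leftCotensor hA ⟶ 𝟭 (LeftComod C) where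
  app M := LeftComod.Hom.mk (β.leftCounitLinear hA M) (β.leftCounitLinear_colinear hA M)
  naturality M M' f := by
    refine LeftComod.Hom.ext (LinearMap.ext fun z => ?_)
    change C.counitLeft M' (Tens.map β.right LinearMap.id (l.leftCoactCotensor hA M' _)) =
      f.hom (C.counitLeft M (Tens.map β.right LinearMap.id (l.leftCoactCotensor hA M z)))
    refine (congrArg (fun w => C.counitLeft M' (Tens.map β.right LinearMap.id w))
      (leftCoactCotensor_map hA f z)).trans ?_
    rw [← C.counitLeft_map, Tens.map_id_map_left, Tens.map_id_map_right]

theorem HomCotensorC.leftCounitBimod_leftCounit (x : l.cotensorSq) :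
    leftCounitBimod (β.leftCounit hA) x = β.toBimodHom x := by
  obtain ⟨r, hr, hβ⟩ := β.right_colinear
  have h : l.leftCoactCotensor hA (regular C) (l.cotensorSqEquivLeft hA x) = r x :=
    map_cotensorIncl_right_injective hA C ((map_leftCoactCotensor l hA _ _).trans
      (Tens.assoc.symm_apply_eq.2 (hr x).symm))
  change C.counitLeft C (Tens.map β.right LinearMap.id (l.leftCoactCotensor hA (regular C)
    (l.cotensorSqEquivLeft hA x))) = _
  rw [h]
  exact (congrArg _ (hβ x).symm).trans (C.counit_comul _)

end LeftCounitOfHom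

section LeftAdjunctionOfHom

open LeftComod

variable (hA) {α : l.HomDC} {β : l.HomCotensorC}

theorem leftCounitLinear_leftUnitLinear (h : ∀ c : C, β.toBimodHom (α.insertLeft c) = c)
    (M : LeftComod C) (m : M) : β.leftCounitLinear hA M
      (α.leftUnitLinear hA (l.leftCorestriction.obj M) m) = m := by
  have h₁ : l.leftCoactCotensor hA M (α.leftUnitLinear hA (l.leftCorestriction.obj M) m) =
      Tens.map α.insertLeftBimod.right LinearMap.id (M.coact m) := by
    refine map_cotensorIncl_right_injective hA M ?_
    have h₂ : l.cotensorIncl.right.comp α.insertLeftBimod.right =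
      (Tens.rmap (α.right.comp l.right) (BimodHom.id A C)).comp C.comul.right := rfl
    have h₄ : l.leftResCotensorIncl hA M
        (α.leftUnitLinear hA (l.leftCorestriction.obj M) m) =
        Tens.map (α.right.comp l.right) LinearMap.id (M.coact m) :=
      (Tens.map_comp_left l.right α.right (M.coact m)).symm
    refine (map_leftCoactCotensor l hA M _).trans ?_
    refine (congrArg (fun y => Tens.assoc.symm (Tens.map LinearMap.id M.coact y)) h₄).trans ?_
    rw [← Tens.map_comp_left, h₂, Tens.map_comp_left _ (Tens.rmap _ _), AddEquiv.symm_apply_eq,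
      Tens.assoc_map_right, M.coassoc, Tens.map_id_map_left, Tens.map_id_map_right]
  have h₃ : β.right.comp α.insertLeftBimod.right = LinearMap.id := LinearMap.ext h
  change C.counitLeft M (Tens.map β.right LinearMap.id (l.leftCoactCotensor hA M _)) = m
  rw [h₁, ← Tens.map_comp_left, h₃, Tens.map_id]
  exact M.counit m

theorem leftCounitLinear_map_leftUnit (h : ∀ c : C, β.toBimodHom (α.insertRight c) = c)
    (N : LeftComod D) (z : l.leftCotensorObj N hA) :
    β.leftCounitLinear hA (l.leftCotensorObj N hA)
      (((l.leftCotensor hA).map ((α.leftUnit hA).app N)).hom z) = z := by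
  refine l.leftCotensorIncl_injective N hA ?_
  refine (leftCounit_hom (β.leftCounit hA) (M := l.leftCotensorObj N hA)
    (equalizerι (l.cofreeRightCoact N) (cofreeMap C N.coact) hA) _).symm.trans ?_
  refine (leftCounit_cofree (β.leftCounit hA)
    (Tens.map α.insertRightBimod.right LinearMap.id (l.leftCotensorIncl N hA z)) _ ?_).trans ?_
  · have h₁ : l.cotensorIncl.right.comp α.insertRightBimod.right =
      (Tens.rmap LinearMap.id α.toBimodHom).comp l.rightCoact :=
      LinearMap.ext fun c => Tens.map_comp_right l.left α.left (C.comul c)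
    rw [← Tens.map_comp_left, h₁, Tens.assoc_naturality, assoc_map_leftCotensorIncl,
      ← Tens.map_comp_right]
    exact (Tens.map_comp_right _ _ _).symm
  · have h₂ : (leftCounitBimod (β.leftCounit hA)).right.comp α.insertRightBimod.right =
      LinearMap.id := LinearMap.ext fun c => (β.leftCounitBimod_leftCounit hA _).trans (h c)
    rw [← Tens.map_comp_left, h₂, Tens.map_id]

/-- The adjunction between `C □_D -` and corestriction defined by a pair of bicomodule maps. -/
noncomputable def leftAdjunctionOfHom (hl : ∀ c : C, β.toBimodHom (α.insertLeft c) = c)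
    (hr : ∀ c : C, β.toBimodHom (α.insertRight c) = c) :
    l.leftCotensor hA ⊣ l.leftCorestriction :=
  Adjunction.mkOfUnitCounit
    { unit := α.leftUnit hA
      counit := β.leftCounit hA
      left_triangle := by
        ext N
        exact LeftComod.Hom.ext (LinearMap.ext (leftCounitLinear_map_leftUnit hA hr N))
      right_triangle := by
        ext M
        exact LeftComod.Hom.ext (LinearMap.ext (leftCounitLinear_leftUnitLinear hA hl M)) }

end LeftAdjunctionOfHom

theorem isLeftFrobenius_iff (hA : IsVonNeumannRegular A) : l.IsLeftFrobenius ↔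
    ∃ (α : l.HomDC) (β : l.HomCotensorC),
      (∀ c : C, β.toBimodHom (α.insertLeft c) = c) ∧
      (∀ c : C, β.toBimodHom (α.insertRight c) = c) := by
  constructor
  · rintro ⟨L, R, ⟨adjL⟩, ⟨adjR⟩, ⟨e⟩⟩
    let adj : l.leftCotensor hA ⊣ l.leftCorestriction :=
      adjL.ofNatIsoLeft (e ≪≫ adjR.rightAdjointUniq (l.leftAdjunction hA))
    exact ⟨leftUnitHomDC adj.unit, leftCounitHomCotensorC adj.counit,
      leftCounit_insertLeft adj, leftCounit_insertRight adj⟩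
  · rintro ⟨α, β, hl, hr⟩
    exact ⟨_, _, ⟨leftAdjunctionOfHom hA hl hr⟩, ⟨l.leftAdjunction hA⟩, ⟨Iso.refl _⟩⟩

end CoringHom

theorem IsVonNeumannRegular.of_field (K : Type u) [Field K] : IsVonNeumannRegular K :=
  fun a => ⟨a⁻¹, mul_inv_mul_cancel a⟩

/-- For an extension `l : C → D` of corings over a von Neumann regular ring, the right Frobenius
property, the left Frobenius property and the existence of bicomodule maps `α : D → C` and
`β : C □_D C → C` with `β ∘ (α l ⊗ 1) ∘ Δ = β ∘ (1 ⊗ α l) ∘ Δ = 1` are equivalent; in particular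
this holds for extensions of coalgebras over a field. -/
theorem theorem2p9 :
    (∀ (A : Type u) [Ring A], IsVonNeumannRegular A →
      ∀ (C D : Coring A) (l : CoringHom C D),
        (l.IsRightFrobenius ↔
          ∃ (α : l.HomDC) (β : l.HomCotensorC),
            (∀ c : C, β.toBimodHom (α.insertLeft c) = c) ∧
            (∀ c : C, β.toBimodHom (α.insertRight c) = c)) ∧
        (l.IsLeftFrobenius ↔
          ∃ (α : l.HomDC) (β : l.HomCotensorC),
            (∀ c : C, β.toBimodHom (α.insertLeft c) = c) ∧
            (∀ c : C, β.toBimodHom (α.insertRight c) = c))) ∧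
    (∀ (K : Type u) [Field K] (C D : Type u) [AddCommGroup C] [Module K C] [Coalgebra K C]
      [AddCommGroup D] [Module K D] [Coalgebra K D] (f : C →ₗc[K] D),
        ((CoringHom.ofCoalgHom f).IsRightFrobenius ↔
          ∃ (α : (CoringHom.ofCoalgHom f).HomDC) (β : (CoringHom.ofCoalgHom f).HomCotensorC),
            (∀ c, β.toBimodHom (α.insertLeft c) = c) ∧
            (∀ c, β.toBimodHom (α.insertRight c) = c)) ∧
        ((CoringHom.ofCoalgHom f).IsLeftFrobenius ↔
          ∃ (α : (CoringHom.ofCoalgHom f).HomDC) (β : (CoringHom.ofCoalgHom f).HomCotensorC),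
            (∀ c, β.toBimodHom (α.insertLeft c) = c) ∧
            (∀ c, β.toBimodHom (α.insertRight c) = c))) := by
  exact ⟨fun A _ hA C D l => ⟨l.isRightFrobenius_iff hA, l.isLeftFrobenius_iff hA⟩,
    fun K _ C D _ _ _ _ _ _ f =>
      ⟨(CoringHom.ofCoalgHom f).isRightFrobenius_iff (.of_field K),
        (CoringHom.ofCoalgHom f).isLeftFrobenius_iff (.of_field K)⟩⟩
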